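/- Let $k>0$, $\nu\in\mathbb{R}$, $a_4>0$ and $x_1<x_2<x_3<x_4$ be real numbers, and define $a_0,\dots,a_3$ by $$a_0+a_1t+a_2t^2+a_3t^3+a_4t^4=a_4(t-x_1)(t-x_2)(t-x_3)(t-x_4).$$ Let $X=\sum_{i}a_ix^i$, $Y=\sum_i a_iy^i$, $F=Xy^2-x^2Y$, $$H=(\nu x+y)\bigl((\nu x-y)(a_1-a_3xy)-2(1-\nu)(a_0-a_4x^2y^2)\bigr),$$ $$G=X\,(a_0\nu^2+2a_3\nu y^3-a_4y^4+2a_4\nu y^4)+(a_0-2a_0\nu-2a_1\nu x-a_4\nu^2x^4)\,Y .$$ Let $\Omega=\{(x,y): x_2<x<x_3,\ x_1<y<x_2\}$. Suppose that $H>0$ on $\Omega$ and that $H\ne 0$ at the three turning points $(x_2,x_1)$, $(x_3,x_1)$, $(x_3,x_2)$. Consider on $U=\Omega\times\mathbb{R}^2$, with coordinates $(x,y,\tau,\phi)$, the Chen–Teo metric $$g=\frac{kH}{(x-y)^3}\Bigl(\frac{dx^2}{X}-\frac{dy^2}{Y}-\frac{XY}{kF}\,d\phi^2\Bigr)+\frac{(F\,d\tau+G\,d\phi)^2}{FH(x-y)},$$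 with the orientation in which $dx\wedge dy\wedge d\tau\wedge d\phi$ is positive. Let $W_{abcd}$ be its Weyl tensor (the Riemann tensor having the sign for which $R_{abab}>0$ on round spheres). At a point, the (anti-)self-dual part $W^\pm$, regarded as an endomorphism of the 3-dimensional space of (anti-)self-dual 2-forms, is of type $O$, $D$ or $I$ if it has exactly one, two or three distinct eigenvalues, respectively. Then the following hold. 1. $g$ is positive definite and Ricci-flat on $U$. 2. Consider the complex null tetrad $$L=\tfrac1{\sqrt2}\Bigl(\sqrt{\tfrac{H(x-y)}{F}}\,\partial_\tau+i\sqrt{\tfrac{F(x-y)^3}{HX(-Y)}}\,\bigl(\partial_\phi-\tfrac GF\partial_\tau\bigr)\Bigr),\qquad N=\overline L,$$ $$M=\tfrac{i\sqrt{(x-y)^3}}{\sqrt{2kH}}\bigl(\sqrt X\,\partial_x+i\sqrt{-Y}\,\partial_y\bigr),\qquad P=-\overline M,$$ and put $f=x\sqrt{-Y}+iy\sqrt X$. Everywhere on $U$, the Weyl scalars $\Psi_2=W(L,M,N,P)$ and $\Psi_0=W(L,M,M,L)$ satisfy $$\Psi_2=\frac{(1+\nu)(x-y)^3}{4k(\nu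 x+y)^3},\qquad \Psi_0=\frac{3f\,\Psi_2}{\bar f}.$$ 3. The Weyl tensor of $g$ is of type $O^+I^-$ for $\nu=-1$, of type $D^+D^-$ for $\nu=1$, and of type $D^+I^-$ for $-1<\nu<1$, in the following sense. At every point of $U$, $W^+$ is of type $O$ if $\nu=-1$ and of type $D$ if $-1<\nu\le 1$. If $\nu=1$, then $W^-$ is of type $D$ at every point of $U$. If $-1\le\nu<1$, then $W^-$ is of type $I$ (algebraically general) at the points of a dense subset of $U$; in particular there is such a point. -/

import Mathlib

noncomputable section

namespace ChenTeo

/-! ### Curvature of a metric in a coordinate chart of dimension four -/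

/-- Points of the coordinate space `ℝ⁴`. -/
abbrev Pt : Type := Fin 4 → ℝ

/-- A (pseudo-)metric in coordinates: the matrix of components `g_{ij}` at each point. -/
abbrev MetricField : Type := Pt → Matrix (Fin 4) (Fin 4) ℝ

/-- The partial derivative `∂_i f` at `p`. -/
def pd (i : Fin 4) (f : Pt → ℝ) (p : Pt) : ℝ :=
  lineDeriv ℝ f p (Pi.single i 1)

/-- Christoffel symbols `Γ^i_{jk} = ½ g^{il} (∂_j g_{lk} + ∂_k g_{lj} - ∂_l g_{jk})`. -/
def christoffel (g : MetricField) (i j k : Fin 4) (p : Pt) : ℝ :=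
  1 / 2 * ∑ l, (g p)⁻¹ i l *
    (pd j (fun q => g q l k) p + pd k (fun q => g q l j) p - pd l (fun q => g q j k) p)

/-- The Riemann tensor `R^i_{jkl} = ∂_k Γ^i_{lj} - ∂_l Γ^i_{kj} + Γ^i_{km} Γ^m_{lj} -
Γ^i_{lm} Γ^m_{kj}` of the Levi-Civita connection, that is, `R(∂_k, ∂_l) ∂_j = R^i_{jkl} ∂_i`. -/
def riemannUp (g : MetricField) (p : Pt) (i j k l : Fin 4) : ℝ :=
  pd k (christoffel g i l j) p - pd l (christoffel g i k j) p
    + ∑ m, (christoffel g i k m p * christoffel g m l j p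
      - christoffel g i l m p * christoffel g m k j p)

/-- The Riemann tensor with all indices lowered; `R_{abab} > 0` on round spheres. -/
def riemann (g : MetricField) (p : Pt) (a b c d : Fin 4) : ℝ :=
  ∑ m, g p a m * riemannUp g p m b c d

/-- The Ricci tensor `R_{jl} = R^i_{jil}`. -/
def ricci (g : MetricField) (p : Pt) (j l : Fin 4) : ℝ :=
  ∑ i, riemannUp g p i j i l

/-- The scalar curvature. -/
def scalarCurvature (g : MetricField) (p : Pt) : ℝ :=
  ∑ j, ∑ l, (g p)⁻¹ j l * ricci g p j l

/-- The Weyl tensor `W_{abcd}`, the trace-free part of the Riemann tensor in dimension four. -/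
def weyl (g : MetricField) (p : Pt) (a b c d : Fin 4) : ℝ :=
  riemann g p a b c d
    - 1 / 2 * (g p a c * ricci g p b d - g p a d * ricci g p b c
        - g p b c * ricci g p a d + g p b d * ricci g p a c)
    + scalarCurvature g p / 6 * (g p a c * g p b d - g p a d * g p b c)

/-! ### Hodge duality and the algebraic type of the Weyl tensor -/

/-- The Levi-Civita symbol, normalised by `leviCivita 0 1 2 3 = 1`. -/
def leviCivita (a b c d : Fin 4) : ℤ :=
  ((1 : Matrix (Fin 4) (Fin 4) ℤ).submatrix ![a, b, c, d] id).det

/-- The Hodge dual `(*ω)_{ab} = ½ ε_{ab}^{cd} ω_{cd}` of a 2-form (given by its matrix of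
components), for the orientation in which the coordinate 4-form `dp⁰ ∧ dp¹ ∧ dp² ∧ dp³` is
positive: the volume form is `√(det g) dp⁰ ∧ dp¹ ∧ dp² ∧ dp³`. -/
def hodge (g : MetricField) (p : Pt) (ω : Matrix (Fin 4) (Fin 4) ℝ) :
    Matrix (Fin 4) (Fin 4) ℝ :=
  Matrix.of fun a b => 1 / 2 * ∑ c, ∑ d, ∑ e, ∑ f,
    √(g p).det * (leviCivita a b c d : ℝ) * (g p)⁻¹ c e * (g p)⁻¹ d f * ω e f

/-- The Weyl tensor as an endomorphism of 2-forms, `ω_{ab} ↦ W_{ab}^{cd} ω_{cd}`. -/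
def weylOp (g : MetricField) (p : Pt) (ω : Matrix (Fin 4) (Fin 4) ℝ) :
    Matrix (Fin 4) (Fin 4) ℝ :=
  Matrix.of fun a b => ∑ c, ∑ d, ∑ e, ∑ f,
    weyl g p a b c d * (g p)⁻¹ c e * (g p)⁻¹ d f * ω e f

/-- The eigenvalues of the self-dual part `W⁺` (`s = 1`) or the anti-self-dual part `W⁻`
(`s = -1`) of the Weyl tensor at `p`, acting on the 2-forms `ω` with `*ω = s ω`. The Weyl
endomorphism preserves this three-dimensional space, and its restriction is `W⁺` or `W⁻`. For a
positive definite `g` that restriction is self-adjoint, so all its eigenvalues are real. -/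
def weylEigenvalues (g : MetricField) (p : Pt) (s : ℝ) : Set ℝ :=
  {μ | ∃ ω : Matrix (Fin 4) (Fin 4) ℝ,
    ω ≠ 0 ∧ ω.transpose = -ω ∧ hodge g p ω = s • ω ∧ weylOp g p ω = μ • ω}

/-- Type `O`: exactly one distinct eigenvalue. -/
def IsTypeO (g : MetricField) (p : Pt) (s : ℝ) : Prop := (weylEigenvalues g p s).ncard = 1

/-- Type `D`: exactly two distinct eigenvalues. -/
def IsTypeD (g : MetricField) (p : Pt) (s : ℝ) : Prop := (weylEigenvalues g p s).ncard = 2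

/-- Type `I` (algebraically general): exactly three distinct eigenvalues. -/
def IsTypeI (g : MetricField) (p : Pt) (s : ℝ) : Prop := (weylEigenvalues g p s).ncard = 3

/-- The component `W(u, v, w, z)` of the Weyl tensor on complex vectors. -/
def weylC (g : MetricField) (p : Pt) (u v w z : Fin 4 → ℂ) : ℂ :=
  ∑ a, ∑ b, ∑ c, ∑ d, (weyl g p a b c d : ℂ) * u a * v b * w c * z d

/-! ### The Chen–Teo metrics -/

/-- The parameters of the Chen–Teo metrics. -/
structure Params where
  k : ℝ
  ν : ℝ
  a₀ : ℝ
  a₁ : ℝ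
  a₂ : ℝ
  a₃ : ℝ
  a₄ : ℝ

/-- The parameters for which the quartic `X` is `a₄ (x - x₁) (x - x₂) (x - x₃) (x - x₄)`. -/
def Params.ofRoots (k ν a₄ x₁ x₂ x₃ x₄ : ℝ) : Params where
  k := k
  ν := ν
  a₀ := a₄ * (x₁ * x₂ * x₃ * x₄)
  a₁ := -a₄ * (x₁ * x₂ * x₃ + x₁ * x₂ * x₄ + x₁ * x₃ * x₄ + x₂ * x₃ * x₄)
  a₂ := a₄ * (x₁ * x₂ + x₁ * x₃ + x₂ * x₃ + x₁ * x₄ + x₂ * x₄ + x₃ * x₄)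
  a₃ := -a₄ * (x₁ + x₂ + x₃ + x₄)
  a₄ := a₄

namespace Params

/-- The quartic, called `X` as a function of `x` and `Y` as a function of `y`. -/
def quartic (P : Params) (t : ℝ) : ℝ :=
  P.a₀ + P.a₁ * t + P.a₂ * t ^ 2 + P.a₃ * t ^ 3 + P.a₄ * t ^ 4

def H (P : Params) (x y : ℝ) : ℝ :=
  (P.ν * x + y) * ((P.ν * x - y) * (P.a₁ - P.a₃ * x * y)
    - 2 * (1 - P.ν) * (P.a₀ - P.a₄ * x ^ 2 * y ^ 2))

def F (P : Params) (x y : ℝ) : ℝ :=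
  P.quartic x * y ^ 2 - x ^ 2 * P.quartic y

def G (P : Params) (x y : ℝ) : ℝ :=
  P.quartic x * (P.a₀ * P.ν ^ 2 + 2 * P.a₃ * P.ν * y ^ 3 - P.a₄ * y ^ 4
      + 2 * P.a₄ * P.ν * y ^ 4)
    + (P.a₀ - 2 * P.a₀ * P.ν - 2 * P.a₁ * P.ν * x - P.a₄ * P.ν ^ 2 * x ^ 4) * P.quartic y

/-- The components, in the coordinates `(x, y, τ, φ)` (in this order), of
`k H / (x - y)³ (dx² / X - dy² / Y - X Y / (k F) dφ²) + (F dτ + G dφ)² / (F H (x - y))`. -/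
def metric (P : Params) : MetricField := fun p =>
  let x := p 0
  let y := p 1
  let X := P.quartic x
  let Y := P.quartic y
  let H := P.H x y
  let F := P.F x y
  let G := P.G x y
  !![P.k * H / (x - y) ^ 3 * (1 / X), 0, 0, 0;
     0, P.k * H / (x - y) ^ 3 * (-1 / Y), 0, 0;
     0, 0, F ^ 2 / (F * H * (x - y)), F * G / (F * H * (x - y));
     0, 0, F * G / (F * H * (x - y)),
       P.k * H / (x - y) ^ 3 * (-(X * Y) / (P.k * F)) + G ^ 2 / (F * H * (x - y))]

/-- The complex null vector `L` of the Killing tetrad. -/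
def tetradL (P : Params) (p : Pt) : Fin 4 → ℂ :=
  let x := p 0
  let y := p 1
  let X := P.quartic x
  let Y := P.quartic y
  let H := P.H x y
  let F := P.F x y
  let G := P.G x y
  let α : ℝ := √(H * (x - y) / F)
  let β : ℝ := √(F * (x - y) ^ 3 / (H * X * (-Y)))
  (1 / (√2 : ℂ)) • ![0, 0, (α : ℂ) - Complex.I * β * (G / F : ℝ), Complex.I * β]

/-- The complex null vector `N`, the complex conjugate of `L`. -/
def tetradN (P : Params) (p : Pt) : Fin 4 → ℂ :=
  let x := p 0
  let y := p 1
  let X := P.quartic x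
  let Y := P.quartic y
  let H := P.H x y
  let F := P.F x y
  let G := P.G x y
  let α : ℝ := √(H * (x - y) / F)
  let β : ℝ := √(F * (x - y) ^ 3 / (H * X * (-Y)))
  (1 / (√2 : ℂ)) • ![0, 0, (α : ℂ) + Complex.I * β * (G / F : ℝ), -Complex.I * β]

/-- The complex null vector `M` of the Killing tetrad. -/
def tetradM (P : Params) (p : Pt) : Fin 4 → ℂ :=
  let x := p 0
  let y := p 1
  (Complex.I * (√((x - y) ^ 3) : ℝ) / (√(2 * P.k * P.H x y) : ℝ)) •
    ![(√(P.quartic x) : ℂ), Complex.I * (√(-P.quartic y) : ℝ), 0, 0]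

/-- The complex null vector `P` of the Killing tetrad, minus the complex conjugate of `M`. -/
def tetradP (P : Params) (p : Pt) : Fin 4 → ℂ :=
  let x := p 0
  let y := p 1
  (Complex.I * (√((x - y) ^ 3) : ℝ) / (√(2 * P.k * P.H x y) : ℝ)) •
    ![(√(P.quartic x) : ℂ), -Complex.I * (√(-P.quartic y) : ℝ), 0, 0]

/-- The Weyl scalar `Ψ₀ = W(L, M, M, L)`. -/
def Psi0 (P : Params) (p : Pt) : ℂ :=
  weylC P.metric p (P.tetradL p) (P.tetradM p) (P.tetradM p) (P.tetradL p)

/-- The Weyl scalar `Ψ₂ = W(L, M, N, P)`. -/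
def Psi2 (P : Params) (p : Pt) : ℂ :=
  weylC P.metric p (P.tetradL p) (P.tetradM p) (P.tetradN p) (P.tetradP p)

/-- The complex function `f = x √(-Y) + i y √X`. -/
def f (P : Params) (x y : ℝ) : ℂ :=
  (x : ℂ) * (√(-P.quartic y) : ℝ) + Complex.I * y * (√(P.quartic x) : ℝ)

end Params

/-- The coordinate domain: `x₂ < x < x₃`, `x₁ < y < x₂`, with `τ` and `φ` arbitrary. -/
def domain (x₁ x₂ x₃ : ℝ) : Set Pt :=
  {p | p 0 ∈ Set.Ioo x₂ x₃ ∧ p 1 ∈ Set.Ioo x₁ x₂}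

end ChenTeo

end

/-! With D = x - y the metric is the stationary axisymmetric one L (dx²/X - dy²/Y) + f (dτ + q dφ)²
- X Y/(D⁴ f) dφ², where L = k H/D³, f = F/(H D) and q = G/F. In Riemannian signature the Ernst
potential splits into two independent real functions f + v and f - v, with v the twist potential of
q, and the gradient and the trace-free Hessian of f ± v govern W^±. For the Chen–Teo metric both
potentials are rational: H = N h with N = ν x + y, and the potentials are x/N and -A/h with a
polynomial A.

For every vacuum metric of this form the Riemann tensor is the mean of a self-dual and an
anti-self-dual tensor, each of which preserves the line spanned by dx ∧ dy ± c dτ ∧ dφ (in the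
adapted coframe) and its orthogonal plane (`Stationary.riemann_eq_part`). The eigenvalue on the line
is 2λ, and those on the plane are -λ ± 2√δ (`PetrovFrame.mem_weylEigenvalues_iff`). So the type is O
if λ = δ = 0, it is D if 4δ = 9λ² with λ ≠ 0, and it is I if δ ≠ 0 and 4δ ≠ 9λ². Ricci-flatness is
the vanishing of the traces.

That the Chen–Teo functions satisfy the vacuum equations (`QuarticPoint.Regular.isVacuum`) and what
λ and δ are reduces to polynomial identities. For W⁺, λ = (1 + ν) D³/(2 k N³), and 4δ = 9λ² because
(x²Y + y²X)² - 4 x²y² X Y = F². For W⁻, λ = P D³/(k h³) with a polynomial P, and by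
`QuarticPoint.sq_u_add_sq_w` 4δ = (9 P² + 72 (1 - ν) X Y J h) D⁶/(k² h⁶) with the constant J = a₀
a₃² - a₁² a₄.

J is a product of a₄³ and the three differences x₃x₄ - x₁x₂, x₂x₄ - x₁x₃, x₁x₄ - x₂x₃, each of which
divides H at one of the turning points; hence J ≠ 0. If ν = 1, then P = -J D³ and W⁻ is of type D.
If ν ≠ 1, then 4δ - 9λ² has no zeros, and W⁻ is of type I wherever 9 P² + 72 (1 - ν) X Y J h ≠ 0.
Were this polynomial zero on an open set, it would vanish along whole lines x = const. At y = x₁ the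
factor Y has a simple zero, so P = 0 there, P² vanishes to second order, and the first-order term
forces h(x, x₁) = 0. By analytic continuation in x also h(x₂, x₁) = 0, against H(x₂, x₁) ≠ 0
(`Params.frequently_generic`). -/

noncomputable section

namespace ChenTeo

open Matrix

set_option linter.unusedSimpArgs false

/-! ### Gradients of functions of the first two coordinates -/

/-- The function `u` has the total derivative `a dp⁰ + b dp¹` at `p`. -/
def HasGrad (u : Pt → ℝ) (p : Pt) (a b : ℝ) : Prop :=
  HasFDerivAt u (a • ContinuousLinearMap.proj (R := ℝ) (φ := fun _ : Fin 4 => ℝ) 0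
    + b • ContinuousLinearMap.proj (R := ℝ) (φ := fun _ : Fin 4 => ℝ) 1) p

namespace HasGrad

variable {u v : Pt → ℝ} {p : Pt} {a b a' b' : ℝ}

theorem congr_grad (h : HasGrad u p a b) (ha : a = a') (hb : b = b') : HasGrad u p a' b' := by
  subst ha hb; exact h

theorem pd_zero (h : HasGrad u p a b) : pd 0 u p = a := by
  have := (HasFDerivAt.hasLineDerivAt h (Pi.single 0 1)).lineDeriv
  simpa [pd] using this

theorem pd_one (h : HasGrad u p a b) : pd 1 u p = b := by
  have := (HasFDerivAt.hasLineDerivAt h (Pi.single 1 1)).lineDeriv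
  simpa [pd] using this

theorem pd_two (h : HasGrad u p a b) : pd 2 u p = 0 := by
  have := (HasFDerivAt.hasLineDerivAt h (Pi.single 2 1)).lineDeriv
  simpa [pd] using this

theorem pd_three (h : HasGrad u p a b) : pd 3 u p = 0 := by
  have := (HasFDerivAt.hasLineDerivAt h (Pi.single 3 1)).lineDeriv
  simpa [pd] using this

theorem const (c : ℝ) : HasGrad (fun _ => c) p 0 0 := by
  simpa [HasGrad] using hasFDerivAt_const c p

theorem coord_zero : HasGrad (fun p => p 0) p 1 0 := by
  rw [HasGrad, one_smul, zero_smul, add_zero]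
  exact hasFDerivAt_apply 0 p

theorem coord_one : HasGrad (fun p => p 1) p 0 1 := by
  rw [HasGrad, one_smul, zero_smul, zero_add]
  exact hasFDerivAt_apply 1 p

theorem add (hu : HasGrad u p a b) (hv : HasGrad v p a' b') :
    HasGrad (fun q => u q + v q) p (a + a') (b + b') := by
  unfold HasGrad at *
  convert! HasFDerivAt.add hu hv using 1
  ext i; simp; ring

theorem neg (hu : HasGrad u p a b) : HasGrad (fun q => -u q) p (-a) (-b) := by
  unfold HasGrad at *
  convert! HasFDerivAt.neg hu using 1
  ext i; simp; ring

theorem sub (hu : HasGrad u p a b) (hv : HasGrad v p a' b') :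
    HasGrad (fun q => u q - v q) p (a - a') (b - b') := by
  simpa [sub_eq_add_neg] using hu.add hv.neg

theorem mul (hu : HasGrad u p a b) (hv : HasGrad v p a' b') :
    HasGrad (fun q => u q * v q) p (a * v p + u p * a') (b * v p + u p * b') := by
  unfold HasGrad at *
  convert! HasFDerivAt.mul hu hv using 1
  ext i; simp; ring

theorem comp {r : ℝ → ℝ} {r' : ℝ} (hr : HasDerivAt r r' (u p)) (hu : HasGrad u p a b) :
    HasGrad (fun q => r (u q)) p (r' * a) (r' * b) := by
  unfold HasGrad at *
  convert! hr.comp_hasFDerivAt p hu using 1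
  ext i; simp; ring

theorem inv (hu : HasGrad u p a b) (h0 : u p ≠ 0) :
    HasGrad (fun q => (u q)⁻¹) p (-a / u p ^ 2) (-b / u p ^ 2) :=
  (hu.comp (hasDerivAt_inv h0)).congr_grad (by ring) (by ring)

theorem div (hu : HasGrad u p a b) (hv : HasGrad v p a' b') (h0 : v p ≠ 0) :
    HasGrad (fun q => u q / v q) p ((a * v p - u p * a') / v p ^ 2)
      ((b * v p - u p * b') / v p ^ 2) := by
  have := hu.mul (hv.inv h0)
  simp only [← div_eq_mul_inv] at this
  exact this.congr_grad (by field_simp; ring) (by field_simp; ring)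

theorem pow (hu : HasGrad u p a b) (n : ℕ) :
    HasGrad (fun q => u q ^ n) p (n * u p ^ (n - 1) * a) (n * u p ^ (n - 1) * b) :=
  hu.comp (hasDerivAt_pow n (u p))

end HasGrad

/-! ### Christoffel symbols and curvature from closed forms -/

/-- The Koszul formula in coordinates: a torsion-free metric connection is the Levi-Civita
connection. The matrix `Γ k` has the entries `Γ^i_{kj}`. -/
theorem christoffel_eq_of_compatible (g : MetricField) (p : Pt)
    (Γ : Fin 4 → Matrix (Fin 4) (Fin 4) ℝ) (hinv : (g p)⁻¹ * g p = 1)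
    (htor : ∀ i j k, Γ j i k = Γ k i j)
    (hcompat : ∀ k l j, pd k (fun q => g q l j) p = (g p * Γ k) l j + (g p * Γ k) j l)
    (i j k : Fin 4) : christoffel g i j k p = Γ j i k := by
  -- Absence of torsion makes `g * Γ` symmetric in the direction and the last index, so four of the
  -- six terms of the Koszul expression cancel.
  have hT : ∀ l a b, (g p * Γ a) l b = (g p * Γ b) l a := fun l a b => by
    simp only [Matrix.mul_apply, htor _ a b]
  have key : ∀ l, pd j (fun q => g q l k) p + pd k (fun q => g q l j) p
      - pd l (fun q => g q j k) p = 2 * (g p * Γ j) l k := fun l => by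
    rw [hcompat, hcompat, hcompat, hT l k j, hT j k l, hT k j l]; ring
  simp only [christoffel, key]
  calc 1 / 2 * ∑ l, (g p)⁻¹ i l * (2 * (g p * Γ j) l k)
      = ((g p)⁻¹ * (g p * Γ j)) i k := by
        rw [Matrix.mul_apply, Finset.mul_sum]
        exact Finset.sum_congr rfl fun l _ => by ring
    _ = Γ j i k := by rw [← Matrix.mul_assoc, hinv, Matrix.one_mul]

/-- The Riemann tensor in terms of closed forms of the Christoffel symbols near a point;
`dΓ k l` is the matrix of the `k`-th partial derivatives of the entries of `Γ l`. -/
theorem riemannUp_eq_of_christoffel (g : MetricField) (p : Pt)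
    (Γ : Fin 4 → Pt → Matrix (Fin 4) (Fin 4) ℝ) (dΓ : Fin 4 → Fin 4 → Matrix (Fin 4) (Fin 4) ℝ)
    (hΓ : ∀ᶠ q in nhds p, ∀ i j k, christoffel g i j k q = Γ j q i k)
    (hd : ∀ k l i j, pd k (fun q => Γ l q i j) p = dΓ k l i j) (i j k l : Fin 4) :
    riemannUp g p i j k l
      = (dΓ k l - dΓ l k + (Γ k p * Γ l p - Γ l p * Γ k p)) i j := by
  have hp := hΓ.self_of_nhds
  have e : ∀ k l, pd k (christoffel g i l j) p = dΓ k l i j := fun k l => by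
    rw [← hd]
    refine Filter.EventuallyEq.lineDeriv_eq ?_
    filter_upwards [hΓ] with q hq using hq i l j
  simp only [riemannUp, e, hp, Matrix.add_apply, Matrix.sub_apply, Matrix.mul_apply,
    Finset.sum_sub_distrib]

/-- The matrix-valued function `A` has the total derivative `A₀ dp⁰ + A₁ dp¹` at `p`. -/
def HasMGrad (A : Pt → Matrix (Fin 4) (Fin 4) ℝ) (p : Pt) (A₀ A₁ : Matrix (Fin 4) (Fin 4) ℝ) :
    Prop :=
  ∀ i j, HasGrad (fun r => A r i j) p (A₀ i j) (A₁ i j)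

namespace HasMGrad

variable {A B : Pt → Matrix (Fin 4) (Fin 4) ℝ} {p : Pt} {A₀ A₁ B₀ B₁ : Matrix (Fin 4) (Fin 4) ℝ}

theorem congr_grad {A₀' A₁' : Matrix (Fin 4) (Fin 4) ℝ} (h : HasMGrad A p A₀ A₁) (h₀ : A₀ = A₀')
    (h₁ : A₁ = A₁') : HasMGrad A p A₀' A₁' := by
  subst h₀ h₁; exact h

theorem const (C : Matrix (Fin 4) (Fin 4) ℝ) : HasMGrad (fun _ => C) p 0 0 :=
  fun i j => HasGrad.const (C i j)

theorem add (hA : HasMGrad A p A₀ A₁) (hB : HasMGrad B p B₀ B₁) :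
    HasMGrad (fun r => A r + B r) p (A₀ + B₀) (A₁ + B₁) :=
  fun i j => (hA i j).add (hB i j)

theorem sub (hA : HasMGrad A p A₀ A₁) (hB : HasMGrad B p B₀ B₁) :
    HasMGrad (fun r => A r - B r) p (A₀ - B₀) (A₁ - B₁) :=
  fun i j => (hA i j).sub (hB i j)

theorem transpose (hA : HasMGrad A p A₀ A₁) : HasMGrad (fun r => (A r)ᵀ) p A₀ᵀ A₁ᵀ :=
  fun i j => hA j i

theorem smul {u : Pt → ℝ} {a b : ℝ} (hu : HasGrad u p a b) (hA : HasMGrad A p A₀ A₁) :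
    HasMGrad (fun r => u r • A r) p (a • A p + u p • A₀) (b • A p + u p • A₁) :=
  fun i j => hu.mul (hA i j)

theorem mul (hA : HasMGrad A p A₀ A₁) (hB : HasMGrad B p B₀ B₁) :
    HasMGrad (fun r => A r * B r) p (A₀ * B p + A p * B₀) (A₁ * B p + A p * B₁) := by
  intro i j
  have h := (((hA i 0).mul (hB 0 j)).add ((hA i 1).mul (hB 1 j))).add
    (((hA i 2).mul (hB 2 j)).add ((hA i 3).mul (hB 3 j)))
  simp only [Matrix.mul_apply, Matrix.add_apply, Fin.sum_univ_four, ← add_assoc] at h ⊢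
  exact h.congr_grad (by ring) (by ring)

end HasMGrad

/-! ### Connections in a sheared coframe -/

/-- The elementary matrix that generates the group of the matrices `shear t`. -/
def shearGen : Matrix (Fin 4) (Fin 4) ℝ := Matrix.single 2 3 1

theorem shearGen_mul_self : shearGen * shearGen = 0 :=
  Matrix.single_mul_single_of_ne _ _ _ _ (by decide) _

theorem shearGen_apply (i j : Fin 4) :
    shearGen i j = if j = 3 then (if i = 2 then 1 else 0) else 0 := by
  fin_cases i <;> fin_cases j <;> simp [shearGen]

/-- The coframe `dp⁰, dp¹, dp² + t dp³, dp³`. -/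
def shear (t : ℝ) : Matrix (Fin 4) (Fin 4) ℝ :=
  1 + t • shearGen

theorem shear_mul_shear (s t : ℝ) : shear s * shear t = shear (s + t) := by
  simp only [shear, add_mul, mul_add, one_mul, mul_one, smul_mul_assoc, mul_smul_comm,
    shearGen_mul_self, smul_zero, add_zero, add_smul]
  abel

theorem shear_mul_shearGen (t : ℝ) : shear t * shearGen = shearGen := by
  simp [shear, add_mul, shearGen_mul_self]

theorem shearGen_mul_shear (t : ℝ) : shearGen * shear t = shearGen := by
  simp [shear, mul_add, shearGen_mul_self]

theorem shear_zero : shear 0 = 1 := by simp [shear]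

theorem shear_mul_shear_neg (t : ℝ) : shear t * shear (-t) = 1 := by
  rw [shear_mul_shear, add_neg_cancel, shear_zero]

/-- A torsion-free metric connection in the coframe `dp⁰, dp¹, dp² + q dp³, dp³`, in which the
metric has the matrix `η`; all coefficients are functions of `p⁰` and `p¹`. -/
structure ShearFrame (U : Set Pt) where
  (q qx qy qxx qxy qyy : Pt → ℝ)
  (η ηx ηy Ax Axx Axy Ay Ayx Ayy At Atx Aty Ap Apx Apy : Pt → Matrix (Fin 4) (Fin 4) ℝ)
  grad_q : ∀ p ∈ U, HasGrad q p (qx p) (qy p)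
  grad_qx : ∀ p ∈ U, HasGrad qx p (qxx p) (qxy p)
  grad_qy : ∀ p ∈ U, HasGrad qy p (qxy p) (qyy p)
  grad_η : ∀ p ∈ U, HasMGrad η p (ηx p) (ηy p)
  grad_Ax : ∀ p ∈ U, HasMGrad Ax p (Axx p) (Axy p)
  grad_Ay : ∀ p ∈ U, HasMGrad Ay p (Ayx p) (Ayy p)
  grad_At : ∀ p ∈ U, HasMGrad At p (Atx p) (Aty p)
  grad_Ap : ∀ p ∈ U, HasMGrad Ap p (Apx p) (Apy p)
  symm_η : ∀ p ∈ U, (η p)ᵀ = η p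
  unit_η : ∀ p ∈ U, IsUnit (η p).det
  compat_x : ∀ p ∈ U, ηx p = (η p * Ax p)ᵀ + η p * Ax p
  compat_y : ∀ p ∈ U, ηy p = (η p * Ay p)ᵀ + η p * Ay p
  compat_t : ∀ p ∈ U, (η p * At p)ᵀ + η p * At p = 0
  compat_p : ∀ p ∈ U, (η p * Ap p)ᵀ + η p * Ap p = 0
  tor_xy : ∀ p ∈ U, ∀ i, Ax p i 1 = Ay p i 0
  tor_xt : ∀ p ∈ U, ∀ i, Ax p i 2 = At p i 0
  tor_yt : ∀ p ∈ U, ∀ i, Ay p i 2 = At p i 1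
  tor_xp : ∀ p ∈ U, ∀ i, Ap p i 0 = Ax p i 3 + if i = 2 then qx p else 0
  tor_yp : ∀ p ∈ U, ∀ i, Ap p i 1 = Ay p i 3 + if i = 2 then qy p else 0
  tor_tp : ∀ p ∈ U, ∀ i, At p i 3 = Ap p i 2

namespace ShearFrame

variable {U : Set Pt} (Φ : ShearFrame U)

/-- The metric of the frame in coordinates. -/
def metric : MetricField := fun p => (shear (Φ.q p))ᵀ * Φ.η p * shear (Φ.q p)

/-- The connection matrices along the coordinate vectors, with respect to the frame. -/
def conn : Fin 4 → Pt → Matrix (Fin 4) (Fin 4) ℝ :=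
  ![Φ.Ax, Φ.Ay, Φ.At, fun p => Φ.Ap p + Φ.q p • Φ.At p]

/-- The partial derivatives of `q`. -/
def dq : Fin 4 → Pt → ℝ := ![Φ.qx, Φ.qy, 0, 0]

/-- The matrices of the Christoffel symbols. -/
def gamma (k : Fin 4) (p : Pt) : Matrix (Fin 4) (Fin 4) ℝ :=
  shear (-Φ.q p) * Φ.conn k p * shear (Φ.q p) + Φ.dq k p • shearGen

/-- `gamma` is the gauge transform e⁻¹ A e + e⁻¹ de for e = `shear q`, and e⁻¹ de = dq · `shearGen`
since `shearGen` squares to zero. Lowering the index with eᵀ η e removes e⁻¹. -/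
theorem metric_mul_gamma (k : Fin 4) (p : Pt) :
    Φ.metric p * Φ.gamma k p = (shear (Φ.q p))ᵀ * (Φ.η p * Φ.conn k p) * shear (Φ.q p)
      + Φ.dq k p • ((shear (Φ.q p))ᵀ * Φ.η p * shearGen) := by
  have h1 := shear_mul_shear_neg (Φ.q p)
  have h2 := shear_mul_shearGen (Φ.q p)
  simp only [metric, gamma, mul_add, Matrix.mul_smul, Matrix.mul_assoc, h2]
  rw [← Matrix.mul_assoc (shear (Φ.q p)) (shear (-Φ.q p)), h1, Matrix.one_mul]

theorem grad_shear {p : Pt} {u : Pt → ℝ} {a b : ℝ} (h : HasGrad u p a b) :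
    HasMGrad (fun r => shear (u r)) p (a • shearGen) (b • shearGen) := by
  have := (HasMGrad.const (p := p) 1).add
    (HasMGrad.smul h (HasMGrad.const (p := p) (shearGen)))
  exact this.congr_grad (by simp) (by simp)

theorem det_shear (t : ℝ) : (shear t).det = 1 := by
  have : (shear t).BlockTriangular id := by
    intro i j hij
    fin_cases i <;> fin_cases j <;> simp [shear, shearGen_apply] at hij ⊢
  rw [Matrix.det_of_isUpperTriangular this]
  simp [Fin.prod_univ_four, shear, shearGen_apply]

theorem metric_inv_mul {p : Pt} (hp : p ∈ U) : (Φ.metric p)⁻¹ * Φ.metric p = 1 := by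
  apply Matrix.nonsing_inv_mul
  simpa [metric, Matrix.det_mul, det_shear] using Φ.unit_η p hp

/-- The factor e⁻¹ acts on the upper index only, so the symmetry is checked for A e + dq ·
`shearGen`. The terms `qx` and `qy` in the torsion conditions are d(dτ + q dφ) = dq ∧ dφ; they
cancel against dq · `shearGen`. -/
theorem gamma_torsionFree {p : Pt} (hp : p ∈ U) (i j k : Fin 4) :
    Φ.gamma j p i k = Φ.gamma k p i j := by
  have h : ∀ j k i, (Φ.conn j p * shear (Φ.q p) + Φ.dq j p • shearGen : Matrix _ _ ℝ) i k
      = (Φ.conn k p * shear (Φ.q p) + Φ.dq k p • shearGen : Matrix _ _ ℝ) i j := by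
    intro j k i
    have h1 := Φ.tor_xy p hp i
    have h2 := Φ.tor_xt p hp i
    have h3 := Φ.tor_yt p hp i
    have h4 := Φ.tor_xp p hp i
    have h5 := Φ.tor_yp p hp i
    have h6 := Φ.tor_tp p hp i
    have hm : ∀ (M : Matrix (Fin 4) (Fin 4) ℝ) a,
        (M * shear (Φ.q p)) i a = M i a + if a = 3 then Φ.q p * M i 2 else 0 := by
      intro M a
      have : (M * shearGen) i a = if a = 3 then M i 2 else 0 := by
        simp [Matrix.mul_apply, shearGen_apply]
      simp only [shear, mul_add, mul_one, Matrix.mul_smul, Matrix.add_apply, Matrix.smul_apply,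
        this, smul_eq_mul, mul_ite, mul_zero]
    have c0 : Φ.conn 0 p = Φ.Ax p := rfl
    have c1 : Φ.conn 1 p = Φ.Ay p := rfl
    have c2 : Φ.conn 2 p = Φ.At p := rfl
    have c3 : Φ.conn 3 p = Φ.Ap p + Φ.q p • Φ.At p := rfl
    have d0 : Φ.dq 0 p = Φ.qx p := rfl
    have d1 : Φ.dq 1 p = Φ.qy p := rfl
    have d2 : Φ.dq 2 p = 0 := rfl
    have d3 : Φ.dq 3 p = 0 := rfl
    have n : ((2 : Fin 4) = 3) = False ∧ ((0 : Fin 4) = 3) = False ∧ ((1 : Fin 4) = 3) = False := by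
      decide
    simp only [Matrix.add_apply, Matrix.smul_apply, smul_eq_mul, hm, shearGen_apply]
    have e1 : ∀ t : ℝ, t * (if i = 2 then 1 else 0) = if i = 2 then t else 0 := fun t => by
      split_ifs <;> simp
    rcases (by decide +revert : j = 0 ∨ j = 1 ∨ j = 2 ∨ j = 3) with rfl | rfl | rfl | rfl <;>
    rcases (by decide +revert : k = 0 ∨ k = 1 ∨ k = 2 ∨ k = 3) with rfl | rfl | rfl | rfl <;>
    simp only [c0, c1, c2, c3, d0, d1, d2, d3, n.1, n.2.1, n.2.2, if_true, if_false,
      Matrix.add_apply, Matrix.smul_apply, smul_eq_mul, h1, h2, h3, h4, h5, h6, e1, ite_self] <;>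
    ring
  have h' : ∀ k, Φ.gamma k p
      = shear (-Φ.q p) * (Φ.conn k p * shear (Φ.q p) + Φ.dq k p • shearGen) := by
    intro k
    rw [gamma, mul_add, Matrix.mul_smul, shear_mul_shearGen, Matrix.mul_assoc]
  rw [h', h', Matrix.mul_apply, Matrix.mul_apply]
  exact Finset.sum_congr rfl fun m _ => by rw [h]

theorem grad_metric {p : Pt} (hp : p ∈ U) :
    HasMGrad Φ.metric p (Φ.metric p * Φ.gamma 0 p + (Φ.metric p * Φ.gamma 0 p)ᵀ)
      (Φ.metric p * Φ.gamma 1 p + (Φ.metric p * Φ.gamma 1 p)ᵀ) := by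
  have hs := grad_shear (Φ.grad_q p hp)
  refine ((hs.transpose.mul (Φ.grad_η p hp)).mul hs).congr_grad ?_ ?_ <;>
  · rw [metric_mul_gamma]
    simp only [conn, dq, Matrix.cons_val_zero, Matrix.cons_val_one, Φ.compat_x p hp,
      Φ.compat_y p hp, Matrix.transpose_add, Matrix.transpose_mul, Matrix.transpose_smul,
      Matrix.transpose_transpose, mul_add, add_mul, Matrix.mul_assoc, Matrix.smul_mul,
      Matrix.mul_smul, Φ.symm_η p hp]
    abel

/-- The uniqueness of the Levi-Civita connection. Nothing depends on `p 2` and `p 3`, so along these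
directions compatibility says that the lowered connection matrix is antisymmetric. -/
theorem christoffel_eq {p : Pt} (hp : p ∈ U) (i j k : Fin 4) :
    christoffel Φ.metric i j k p = Φ.gamma j p i k := by
  refine christoffel_eq_of_compatible _ p (fun k => Φ.gamma k p) (Φ.metric_inv_mul hp)
    (Φ.gamma_torsionFree hp) ?_ i j k
  have hg := Φ.grad_metric hp
  have h0 : ∀ k, (Φ.η p * Φ.conn k p)ᵀ + Φ.η p * Φ.conn k p = 0 → Φ.dq k p = 0 → ∀ l j,
      (Φ.metric p * Φ.gamma k p) l j + (Φ.metric p * Φ.gamma k p) j l = 0 := by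
    intro k hk hq l j
    have : Φ.metric p * Φ.gamma k p + (Φ.metric p * Φ.gamma k p)ᵀ = 0 := by
      rw [metric_mul_gamma, hq, zero_smul, add_zero]
      rw [Matrix.transpose_mul, Matrix.transpose_mul _ (Φ.η p * _), Matrix.transpose_transpose,
        Matrix.mul_assoc, ← mul_add, ← add_mul, add_comm, hk]
      simp
    exact congrFun (congrFun this l) j
  intro k l j
  fin_cases k
  · exact (hg l j).pd_zero
  · exact (hg l j).pd_one
  · refine ((hg l j).pd_two).trans (h0 2 (Φ.compat_t p hp) rfl l j).symm
  · refine ((hg l j).pd_three).trans (h0 3 ?_ rfl l j).symm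
    have h1 := Φ.compat_t p hp
    have h2 := Φ.compat_p p hp
    have : ∀ a b : Matrix (Fin 4) (Fin 4) ℝ, aᵀ + a = 0 → bᵀ + b = 0 →
      (a + Φ.q p • b)ᵀ + (a + Φ.q p • b) = 0 := by
      intro a b ha hb
      rw [Matrix.transpose_add, Matrix.transpose_smul, eq_neg_of_add_eq_zero_left ha,
        eq_neg_of_add_eq_zero_left hb, smul_neg]
      abel
    have := this _ _ h2 h1
    simpa [conn, mul_add] using this

/-- The partial derivatives of the connection matrices. -/
def dconn (k l : Fin 4) (p : Pt) : Matrix (Fin 4) (Fin 4) ℝ :=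
  ![![Φ.Axx p, Φ.Ayx p, Φ.Atx p, Φ.Apx p + Φ.qx p • Φ.At p + Φ.q p • Φ.Atx p],
    ![Φ.Axy p, Φ.Ayy p, Φ.Aty p, Φ.Apy p + Φ.qy p • Φ.At p + Φ.q p • Φ.Aty p], 0, 0] k l

/-- The partial derivatives of second order of `q`. -/
def ddq (k l : Fin 4) (p : Pt) : ℝ :=
  ![![Φ.qxx p, Φ.qxy p, 0, 0], ![Φ.qxy p, Φ.qyy p, 0, 0], 0, 0] k l

/-- The curvature matrices along the coordinate vectors, with respect to the frame. -/
def curv (k l : Fin 4) (p : Pt) : Matrix (Fin 4) (Fin 4) ℝ :=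
  Φ.dconn k l p - Φ.dconn l k p + (Φ.conn k p * Φ.conn l p - Φ.conn l p * Φ.conn k p)

theorem grad_conn {p : Pt} (hp : p ∈ U) (l : Fin 4) :
    HasMGrad (Φ.conn l) p (Φ.dconn 0 l p) (Φ.dconn 1 l p) := by
  fin_cases l
  · exact Φ.grad_Ax p hp
  · exact Φ.grad_Ay p hp
  · exact Φ.grad_At p hp
  · exact ((Φ.grad_Ap p hp).add (HasMGrad.smul (Φ.grad_q p hp) (Φ.grad_At p hp))).congr_grad
      (by simp [dconn, add_assoc]) (by simp [dconn, add_assoc])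

theorem grad_dq {p : Pt} (hp : p ∈ U) (l : Fin 4) :
    HasGrad (Φ.dq l) p (Φ.ddq 0 l p) (Φ.ddq 1 l p) := by
  fin_cases l
  · exact Φ.grad_qx p hp
  · exact Φ.grad_qy p hp
  · exact HasGrad.const 0
  · exact HasGrad.const 0

/-- The partial derivatives of the matrices of the Christoffel symbols. -/
def dgamma (k l : Fin 4) (p : Pt) : Matrix (Fin 4) (Fin 4) ℝ :=
  (-Φ.dq k p) • (shearGen * Φ.conn l p * shear (Φ.q p))
    + shear (-Φ.q p) * Φ.dconn k l p * shear (Φ.q p)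
    + Φ.dq k p • (shear (-Φ.q p) * Φ.conn l p * shearGen)
    + Φ.ddq k l p • shearGen

theorem grad_gamma {p : Pt} (hp : p ∈ U) (l : Fin 4) :
    HasMGrad (Φ.gamma l) p (Φ.dgamma 0 l p) (Φ.dgamma 1 l p) := by
  have h := (((grad_shear (Φ.grad_q p hp).neg).mul (Φ.grad_conn hp l)).mul
    (grad_shear (Φ.grad_q p hp))).add
    (HasMGrad.smul (Φ.grad_dq hp l) (HasMGrad.const (shearGen)))
  exact h.congr_grad
    (by simp [dgamma, dq, add_mul, add_assoc])
    (by simp [dgamma, dq, add_mul, add_assoc])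

/-- Curvature is tensorial: under the gauge transformation by e the first derivatives of e cancel
between dΓ and Γ ∧ Γ, and the second ones drop out by the symmetry of `ddq`. Only the conjugate of
the frame curvature is left. -/
theorem riemannUp_eq (hU : IsOpen U) {p : Pt} (hp : p ∈ U) (i j k l : Fin 4) :
    riemannUp Φ.metric p i j k l
      = (shear (-Φ.q p) * Φ.curv k l p * shear (Φ.q p)) i j := by
  rw [riemannUp_eq_of_christoffel Φ.metric p Φ.gamma (fun k l => Φ.dgamma k l p)]
  · have h1 : shear (Φ.q p) * shear (-Φ.q p) = 1 := shear_mul_shear_neg _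
    have hs : Φ.ddq k l p = Φ.ddq l k p := by
      fin_cases k <;> fin_cases l <;> rfl
    have e : ∀ k l, Φ.gamma k p * Φ.gamma l p
        = shear (-Φ.q p) * (Φ.conn k p * Φ.conn l p) * shear (Φ.q p)
          + Φ.dq l p • (shear (-Φ.q p) * Φ.conn k p * shearGen)
          + Φ.dq k p • (shearGen * Φ.conn l p * shear (Φ.q p)) := by
      intro k l
      simp only [gamma, add_mul, mul_add, Matrix.smul_mul, Matrix.mul_smul, shearGen_mul_self, smul_zero,
        add_zero, Matrix.mul_assoc, shear_mul_shearGen]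
      rw [← Matrix.mul_assoc (shear (Φ.q p)) (shear (-Φ.q p)), h1, Matrix.one_mul,
        ← Matrix.mul_assoc _ (shear (-Φ.q p)), shearGen_mul_shear]
      abel
    simp only [e, dgamma, curv, hs]
    refine congrFun (congrFun ?_ i) j
    simp only [mul_add, mul_sub, add_mul, sub_mul, neg_smul]
    abel
  · filter_upwards [hU.mem_nhds hp] with r hr i j k using Φ.christoffel_eq hr i j k
  · intro k l i j
    have h := Φ.grad_gamma hp l i j
    fin_cases k
    · exact h.pd_zero
    · exact h.pd_one
    · refine h.pd_two.trans ?_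
      simp [dgamma, dq, ddq, dconn]
    · refine h.pd_three.trans ?_
      simp [dgamma, dq, ddq, dconn]

/-- The Riemann tensor is `e ⊗ e` applied to the curvature matrices with lowered index. -/
theorem riemann_eq (hU : IsOpen U) {p : Pt} (hp : p ∈ U) (a b k l : Fin 4) :
    riemann Φ.metric p a b k l
      = ((shear (Φ.q p))ᵀ * (Φ.η p * Φ.curv k l p) * shear (Φ.q p)) a b := by
  simp only [riemann, Φ.riemannUp_eq hU hp]
  rw [← Matrix.mul_apply]
  have h1 : shear (Φ.q p) * shear (-Φ.q p) = 1 := shear_mul_shear_neg _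
  simp only [metric, Matrix.mul_assoc]
  rw [← Matrix.mul_assoc (shear (Φ.q p)) (shear (-Φ.q p)), h1, Matrix.one_mul]

end ShearFrame

/-! ### Arithmetic of functions that carry their derivatives -/

/-- A function of `p⁰` and `p¹` together with its partial derivatives on `U`. -/
structure JetFun (U : Set Pt) where
  (val dx dy : Pt → ℝ)
  grad : ∀ p ∈ U, HasGrad val p (dx p) (dy p)

namespace JetFun

variable {U : Set Pt}

instance : Zero (JetFun U) := ⟨⟨fun _ => 0, fun _ => 0, fun _ => 0, fun _ _ => HasGrad.const 0⟩⟩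

/-- A constant function. -/
def const (c : ℝ) : JetFun U := ⟨fun _ => c, fun _ => 0, fun _ => 0, fun _ _ => HasGrad.const c⟩

instance : Add (JetFun U) := ⟨fun u v => ⟨fun p => u.val p + v.val p, fun p => u.dx p + v.dx p,
  fun p => u.dy p + v.dy p, fun p hp => (u.grad p hp).add (v.grad p hp)⟩⟩

instance : Neg (JetFun U) := ⟨fun u => ⟨fun p => -u.val p, fun p => -u.dx p,
  fun p => -u.dy p, fun p hp => (u.grad p hp).neg⟩⟩

instance : Sub (JetFun U) := ⟨fun u v => ⟨fun p => u.val p - v.val p, fun p => u.dx p - v.dx p,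
  fun p => u.dy p - v.dy p, fun p hp => (u.grad p hp).sub (v.grad p hp)⟩⟩

instance : Mul (JetFun U) := ⟨fun u v => ⟨fun p => u.val p * v.val p,
  fun p => u.dx p * v.val p + u.val p * v.dx p, fun p => u.dy p * v.val p + u.val p * v.dy p,
  fun p hp => (u.grad p hp).mul (v.grad p hp)⟩⟩

/-- The inverse of a function without zeros on `U`. -/
def inv (u : JetFun U) (h : ∀ p ∈ U, u.val p ≠ 0) : JetFun U :=
  ⟨fun p => (u.val p)⁻¹, fun p => -u.dx p / u.val p ^ 2, fun p => -u.dy p / u.val p ^ 2,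
    fun p hp => (u.grad p hp).inv (h p hp)⟩

variable (u v : JetFun U) (p : Pt) (c : ℝ)

@[simp] theorem val_zero : (0 : JetFun U).val p = 0 := rfl
@[simp] theorem dx_zero : (0 : JetFun U).dx p = 0 := rfl
@[simp] theorem dy_zero : (0 : JetFun U).dy p = 0 := rfl
@[simp] theorem val_const : (const c : JetFun U).val p = c := rfl
@[simp] theorem dx_const : (const c : JetFun U).dx p = 0 := rfl
@[simp] theorem dy_const : (const c : JetFun U).dy p = 0 := rfl
@[simp] theorem val_add : (u + v).val p = u.val p + v.val p := rfl
@[simp] theorem dx_add : (u + v).dx p = u.dx p + v.dx p := rfl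
@[simp] theorem dy_add : (u + v).dy p = u.dy p + v.dy p := rfl
@[simp] theorem val_neg : (-u).val p = -u.val p := rfl
@[simp] theorem dx_neg : (-u).dx p = -u.dx p := rfl
@[simp] theorem dy_neg : (-u).dy p = -u.dy p := rfl
@[simp] theorem val_sub : (u - v).val p = u.val p - v.val p := rfl
@[simp] theorem dx_sub : (u - v).dx p = u.dx p - v.dx p := rfl
@[simp] theorem dy_sub : (u - v).dy p = u.dy p - v.dy p := rfl
@[simp] theorem val_mul : (u * v).val p = u.val p * v.val p := rfl
@[simp] theorem dx_mul : (u * v).dx p = u.dx p * v.val p + u.val p * v.dx p := rfl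
@[simp] theorem dy_mul : (u * v).dy p = u.dy p * v.val p + u.val p * v.dy p := rfl
@[simp] theorem val_inv (h) : (u.inv h).val p = (u.val p)⁻¹ := rfl
@[simp] theorem dx_inv (h) : (u.inv h).dx p = -u.dx p / u.val p ^ 2 := rfl
@[simp] theorem dy_inv (h) : (u.inv h).dy p = -u.dy p / u.val p ^ 2 := rfl

end JetFun

/-! ### Stationary axisymmetric metrics and their Levi-Civita connection -/

/-- The jets at a point of the functions that determine a stationary axisymmetric metric
`L (dx² / X - dy² / Y) + f (dτ + q dφ)² - X Y / (D⁴ f) dφ²` with twist potential `v`. Here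
`X` depends on `x` and `Y` on `y` only, `D = x - y`, and `lx`, `ly` are the logarithmic derivatives
of `L`. -/
structure StationaryJet where
  (D X X1 X2 Y Y1 Y2 L lx ly lxx lxy lyy f fx fy fxx fxy fyy v vx vy vxx vxy vyy : ℝ)

/-- The functions that determine a stationary axisymmetric metric, with their derivatives. -/
structure Stationary (U : Set Pt) where
  J : Pt → StationaryJet
  q : Pt → ℝ
  D_eq : ∀ p, (J p).D = p 0 - p 1
  D_pos : ∀ p ∈ U, 0 < (J p).D
  X_pos : ∀ p ∈ U, 0 < (J p).X
  Y_neg : ∀ p ∈ U, (J p).Y < 0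
  L_pos : ∀ p ∈ U, 0 < (J p).L
  f_pos : ∀ p ∈ U, 0 < (J p).f
  grad_X : ∀ p ∈ U, HasGrad (fun r => (J r).X) p (J p).X1 0
  grad_X1 : ∀ p ∈ U, HasGrad (fun r => (J r).X1) p (J p).X2 0
  grad_Y : ∀ p ∈ U, HasGrad (fun r => (J r).Y) p 0 (J p).Y1
  grad_Y1 : ∀ p ∈ U, HasGrad (fun r => (J r).Y1) p 0 (J p).Y2
  grad_L : ∀ p ∈ U, HasGrad (fun r => (J r).L) p ((J p).L * (J p).lx) ((J p).L * (J p).ly)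
  grad_lx : ∀ p ∈ U, HasGrad (fun r => (J r).lx) p (J p).lxx (J p).lxy
  grad_ly : ∀ p ∈ U, HasGrad (fun r => (J r).ly) p (J p).lxy (J p).lyy
  grad_f : ∀ p ∈ U, HasGrad (fun r => (J r).f) p (J p).fx (J p).fy
  grad_fx : ∀ p ∈ U, HasGrad (fun r => (J r).fx) p (J p).fxx (J p).fxy
  grad_fy : ∀ p ∈ U, HasGrad (fun r => (J r).fy) p (J p).fxy (J p).fyy
  grad_vx : ∀ p ∈ U, HasGrad (fun r => (J r).vx) p (J p).vxx (J p).vxy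
  grad_vy : ∀ p ∈ U, HasGrad (fun r => (J r).vy) p (J p).vxy (J p).vyy
  grad_q : ∀ p ∈ U, HasGrad q p (-(J p).Y * (J p).vy / ((J p).D ^ 2 * (J p).f ^ 2))
    (-(J p).X * (J p).vx / ((J p).D ^ 2 * (J p).f ^ 2))
  ernst_v : ∀ p ∈ U, (J p).f * ((J p).X * (J p).vxx - (J p).Y * (J p).vyy
      + ((J p).X1 - 2 * (J p).X / (J p).D) * (J p).vx
      - ((J p).Y1 + 2 * (J p).Y / (J p).D) * (J p).vy)
    = 2 * ((J p).X * (J p).fx * (J p).vx - (J p).Y * (J p).fy * (J p).vy)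

namespace Stationary

variable {U : Set Pt} (S : Stationary U)

/-- The metric in coordinates. -/
def metric : MetricField := fun p =>
  !![(S.J p).L / (S.J p).X, 0, 0, 0;
     0, -(S.J p).L / (S.J p).Y, 0, 0;
     0, 0, (S.J p).f, (S.J p).f * S.q p;
     0, 0, (S.J p).f * S.q p, (S.J p).f * S.q p ^ 2
       - (S.J p).X * (S.J p).Y / ((S.J p).D ^ 4 * (S.J p).f)]

def jX : JetFun U := ⟨_, _, _, S.grad_X⟩
def jX1 : JetFun U := ⟨_, _, _, S.grad_X1⟩
def jY : JetFun U := ⟨_, _, _, S.grad_Y⟩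
def jY1 : JetFun U := ⟨_, _, _, S.grad_Y1⟩
def jL : JetFun U := ⟨_, _, _, S.grad_L⟩
def jlx : JetFun U := ⟨_, _, _, S.grad_lx⟩
def jly : JetFun U := ⟨_, _, _, S.grad_ly⟩
def jf : JetFun U := ⟨_, _, _, S.grad_f⟩
def jfx : JetFun U := ⟨_, _, _, S.grad_fx⟩
def jfy : JetFun U := ⟨_, _, _, S.grad_fy⟩
def jvx : JetFun U := ⟨_, _, _, S.grad_vx⟩
def jvy : JetFun U := ⟨_, _, _, S.grad_vy⟩
def jD : JetFun U := ⟨fun p => (S.J p).D, fun _ => 1, fun _ => -1, fun p _ => by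
  simp only [S.D_eq]
  exact (HasGrad.coord_zero.sub HasGrad.coord_one).congr_grad (by ring) (by ring)⟩
def iX : JetFun U := S.jX.inv fun p hp => (S.X_pos p hp).ne'
def iY : JetFun U := S.jY.inv fun p hp => (S.Y_neg p hp).ne
def iL : JetFun U := S.jL.inv fun p hp => (S.L_pos p hp).ne'
def iF : JetFun U := S.jf.inv fun p hp => (S.f_pos p hp).ne'
def iD : JetFun U := S.jD.inv fun p hp => (S.D_pos p hp).ne'

open JetFun (const)

/-- Half of the logarithmic derivative of `-X Y / (D⁴ f)` along `x`. -/
def jmx : JetFun U :=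
  const (1 / 2) * (S.jX1 * S.iX) - const 2 * S.iD - const (1 / 2) * (S.jfx * S.iF)

/-- Half of the logarithmic derivative of `-X Y / (D⁴ f)` along `y`. -/
def jmy : JetFun U :=
  const (1 / 2) * (S.jY1 * S.iY) + const 2 * S.iD - const (1 / 2) * (S.jfy * S.iF)

/-- The derivative of `q` along `x`. -/
def jqx : JetFun U := -(S.jY * S.jvy) * (S.iD * S.iD * (S.iF * S.iF))

/-- The derivative of `q` along `y`. -/
def jqy : JetFun U := -(S.jX * S.jvx) * (S.iD * S.iD * (S.iF * S.iF))

/-- The metric in the frame. -/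
def mη : Matrix (Fin 4) (Fin 4) (JetFun U) :=
  !![S.jL * S.iX, 0, 0, 0;
     0, -(S.jL * S.iY), 0, 0;
     0, 0, S.jf, 0;
     0, 0, 0, -(S.jX * S.jY) * (S.iD * S.iD * (S.iD * S.iD) * S.iF)]

/-- The connection along `x`. -/
def mAx : Matrix (Fin 4) (Fin 4) (JetFun U) :=
  !![const (1 / 2) * (S.jlx - S.jX1 * S.iX), const (1 / 2) * S.jly, 0, 0;
     const (1 / 2) * (S.jY * S.iX * S.jly), const (1 / 2) * S.jlx, 0, 0;
     0, 0, const (1 / 2) * (S.jfx * S.iF), const (-1 / 2) * S.jqx;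
     0, 0, const (1 / 2) * (S.jvy * S.jD * S.jD * S.iX), S.jmx]

/-- The connection along `y`. -/
def mAy : Matrix (Fin 4) (Fin 4) (JetFun U) :=
  !![const (1 / 2) * S.jly, const (1 / 2) * (S.jX * S.iY * S.jlx), 0, 0;
     const (1 / 2) * S.jlx, const (1 / 2) * (S.jly - S.jY1 * S.iY), 0, 0;
     0, 0, const (1 / 2) * (S.jfy * S.iF), const (-1 / 2) * S.jqy;
     0, 0, const (1 / 2) * (S.jvx * S.jD * S.jD * S.iY), S.jmy]

/-- The connection along the unit of the frame dual to `dτ + q dφ`. -/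
def mAt : Matrix (Fin 4) (Fin 4) (JetFun U) :=
  !![0, 0, const (-1 / 2) * (S.jfx * S.jX * S.iL),
       const (1 / 2) * (S.jX * S.jY * S.jvy * (S.iL * S.iD * S.iD * S.iF));
     0, 0, const (1 / 2) * (S.jfy * S.jY * S.iL),
       const (-1 / 2) * (S.jX * S.jY * S.jvx * (S.iL * S.iD * S.iD * S.iF));
     const (1 / 2) * (S.jfx * S.iF), const (1 / 2) * (S.jfy * S.iF), 0, 0;
     const (1 / 2) * (S.jvy * S.jD * S.jD * S.iX), const (1 / 2) * (S.jvx * S.jD * S.jD * S.iY),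
       0, 0]

/-- The connection along the unit of the frame dual to `dφ`. -/
def mAp : Matrix (Fin 4) (Fin 4) (JetFun U) :=
  !![0, 0, const (1 / 2) * (S.jX * S.jY * S.jvy * (S.iL * S.iD * S.iD * S.iF)),
       S.jX * S.jX * S.jY * S.jmx * (S.iD * S.iD * (S.iD * S.iD) * S.iF * S.iL);
     0, 0, const (-1 / 2) * (S.jX * S.jY * S.jvx * (S.iL * S.iD * S.iD * S.iF)),
       -(S.jX * S.jY * S.jY * S.jmy) * (S.iD * S.iD * (S.iD * S.iD) * S.iF * S.iL);
     const (1 / 2) * S.jqx, const (1 / 2) * S.jqy, 0, 0;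
     S.jmx, S.jmy, 0, 0]

/-- The 1-form dq prescribed by the twist potential is closed because of the Ernst equation for v.
-/
theorem dy_jqx {p : Pt} (hp : p ∈ U) : S.jqx.dy p = S.jqy.dx p := by
  have hD := (S.D_pos p hp).ne'
  have hf := (S.f_pos p hp).ne'
  have hX := (S.X_pos p hp).ne'
  have h := S.ernst_v p hp
  simp only [jqx, jqy, JetFun.dy_mul, JetFun.dx_mul, JetFun.val_neg, JetFun.dy_neg, JetFun.dx_neg,
    JetFun.val_mul, iD, iF, JetFun.val_inv, JetFun.dx_inv, JetFun.dy_inv, jX, jY, jD, jf, jvx, jvy]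
  generalize S.J p = j at *
  field_simp at h ⊢
  linear_combination h

end Stationary

/-- The values of a matrix of jets. -/
def jval {U : Set Pt} (A : Matrix (Fin 4) (Fin 4) (JetFun U)) (p : Pt) :
    Matrix (Fin 4) (Fin 4) ℝ := A.map fun u => u.val p

/-- The `x`-derivatives of a matrix of jets. -/
def jdx {U : Set Pt} (A : Matrix (Fin 4) (Fin 4) (JetFun U)) (p : Pt) :
    Matrix (Fin 4) (Fin 4) ℝ := A.map fun u => u.dx p

/-- The `y`-derivatives of a matrix of jets. -/
def jdy {U : Set Pt} (A : Matrix (Fin 4) (Fin 4) (JetFun U)) (p : Pt) :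
    Matrix (Fin 4) (Fin 4) ℝ := A.map fun u => u.dy p

theorem hasMGrad_jval {U : Set Pt} (A : Matrix (Fin 4) (Fin 4) (JetFun U)) {p : Pt} (hp : p ∈ U) :
    HasMGrad (jval A) p (jdx A p) (jdy A p) :=
  fun i j => (A i j).grad p hp

namespace Stationary

variable {U : Set Pt} (S : Stationary U)

theorem compat_x {p : Pt} (hp : p ∈ U) :
    jdx S.mη p = (jval S.mη p * jval S.mAx p)ᵀ + jval S.mη p * jval S.mAx p := by
  have hX := (S.X_pos p hp).ne'
  have hY := (S.Y_neg p hp).ne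
  have hL := (S.L_pos p hp).ne'
  have hf := (S.f_pos p hp).ne'
  have hD := (S.D_pos p hp).ne'
  ext i j
  fin_cases i <;> fin_cases j <;>
  simp [jdx, jval, mη, mAx, Matrix.mul_apply, Fin.sum_univ_four, jmx, jqx, iX, iY, iL, iF, iD,
    jX, jX1, jY, jY1, jL, jlx, jly, jf, jfx, jfy, jvx, jvy, jD] <;>
  generalize S.J p = J at * <;>
  field_simp <;> ring

theorem compat_y {p : Pt} (hp : p ∈ U) :
    jdy S.mη p = (jval S.mη p * jval S.mAy p)ᵀ + jval S.mη p * jval S.mAy p := by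
  have hX := (S.X_pos p hp).ne'
  have hY := (S.Y_neg p hp).ne
  have hL := (S.L_pos p hp).ne'
  have hf := (S.f_pos p hp).ne'
  have hD := (S.D_pos p hp).ne'
  ext i j
  fin_cases i <;> fin_cases j <;>
  simp [jdy, jval, mη, mAy, Matrix.mul_apply, Fin.sum_univ_four, jmy, jqy, iX, iY, iL, iF, iD,
    jX, jX1, jY, jY1, jL, jlx, jly, jf, jfx, jfy, jvx, jvy, jD] <;>
  generalize S.J p = J at * <;>
  field_simp <;> ring

theorem compat_t {p : Pt} (hp : p ∈ U) :
    (jval S.mη p * jval S.mAt p)ᵀ + jval S.mη p * jval S.mAt p = 0 := by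
  have hX := (S.X_pos p hp).ne'
  have hY := (S.Y_neg p hp).ne
  have hL := (S.L_pos p hp).ne'
  have hf := (S.f_pos p hp).ne'
  have hD := (S.D_pos p hp).ne'
  ext i j
  fin_cases i <;> fin_cases j <;>
  simp [jval, mη, mAt, Matrix.mul_apply, Fin.sum_univ_four, iX, iY, iL, iF, iD,
    jX, jX1, jY, jY1, jL, jlx, jly, jf, jfx, jfy, jvx, jvy, jD] <;>
  generalize S.J p = J at * <;>
  field_simp <;> ring

theorem compat_p {p : Pt} (hp : p ∈ U) :
    (jval S.mη p * jval S.mAp p)ᵀ + jval S.mη p * jval S.mAp p = 0 := by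
  have hX := (S.X_pos p hp).ne'
  have hY := (S.Y_neg p hp).ne
  have hL := (S.L_pos p hp).ne'
  have hf := (S.f_pos p hp).ne'
  have hD := (S.D_pos p hp).ne'
  ext i j
  fin_cases i <;> fin_cases j <;>
  simp [jval, mη, mAp, Matrix.mul_apply, Fin.sum_univ_four, jmx, jmy, jqx, jqy, iX, iY, iL, iF, iD,
    jX, jX1, jY, jY1, jL, jlx, jly, jf, jfx, jfy, jvx, jvy, jD] <;>
  generalize S.J p = J at * <;>
  field_simp <;> ring

theorem jval_mη (p : Pt) : jval S.mη p = Matrix.diagonal ![(S.J p).L * (S.J p).X⁻¹,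
    -((S.J p).L * (S.J p).Y⁻¹), (S.J p).f, -((S.J p).X * (S.J p).Y)
      * ((S.J p).D⁻¹ * (S.J p).D⁻¹ * ((S.J p).D⁻¹ * (S.J p).D⁻¹) * (S.J p).f⁻¹)] := by
  ext i j
  fin_cases i <;> fin_cases j <;> rfl

/-- The frame `dx, dy, dτ + q dφ, dφ` with its Levi-Civita connection. -/
def frame : ShearFrame U where
  q := S.q
  qx := S.jqx.val
  qy := S.jqy.val
  qxx := S.jqx.dx
  qxy := S.jqx.dy
  qyy := S.jqy.dy
  η := jval S.mη
  ηx := jdx S.mη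
  ηy := jdy S.mη
  Ax := jval S.mAx
  Axx := jdx S.mAx
  Axy := jdy S.mAx
  Ay := jval S.mAy
  Ayx := jdx S.mAy
  Ayy := jdy S.mAy
  At := jval S.mAt
  Atx := jdx S.mAt
  Aty := jdy S.mAt
  Ap := jval S.mAp
  Apx := jdx S.mAp
  Apy := jdy S.mAp
  grad_q p hp := (S.grad_q p hp).congr_grad
    (by
      have hD := (S.D_pos p hp).ne'
      have hf := (S.f_pos p hp).ne'
      simp only [jqx, JetFun.val_mul, JetFun.val_neg, iD, iF, JetFun.val_inv, jY, jvy, jD, jf]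
      field_simp)
    (by
      have hD := (S.D_pos p hp).ne'
      have hf := (S.f_pos p hp).ne'
      simp only [jqy, JetFun.val_mul, JetFun.val_neg, iD, iF, JetFun.val_inv, jX, jvx, jD, jf]
      field_simp)
  grad_qx p hp := S.jqx.grad p hp
  grad_qy p hp := (S.jqy.grad p hp).congr_grad (S.dy_jqx hp).symm rfl
  grad_η _ hp := hasMGrad_jval _ hp
  grad_Ax _ hp := hasMGrad_jval _ hp
  grad_Ay _ hp := hasMGrad_jval _ hp
  grad_At _ hp := hasMGrad_jval _ hp
  grad_Ap _ hp := hasMGrad_jval _ hp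
  symm_η p _ := by rw [jval_mη, Matrix.diagonal_transpose]
  unit_η p hp := by
    have hX := (S.X_pos p hp).ne'
    have hY := (S.Y_neg p hp).ne
    have hL := (S.L_pos p hp).ne'
    have hf := (S.f_pos p hp).ne'
    have hD := (S.D_pos p hp).ne'
    rw [jval_mη, Matrix.det_diagonal, isUnit_iff_ne_zero]
    simp [Fin.prod_univ_four, hX, hY, hL, hf, hD]
  compat_x _ hp := S.compat_x hp
  compat_y _ hp := S.compat_y hp
  compat_t _ hp := S.compat_t hp
  compat_p _ hp := S.compat_p hp
  tor_xy p _ i := by fin_cases i <;> rfl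
  tor_xt p _ i := by fin_cases i <;> rfl
  tor_yt p _ i := by fin_cases i <;> rfl
  tor_xp p _ i := by fin_cases i <;> simp [jval, mAx, mAp]; ring
  tor_yp p _ i := by fin_cases i <;> simp [jval, mAy, mAp]; ring
  tor_tp p _ i := by fin_cases i <;> rfl

theorem frame_metric {p : Pt} (hp : p ∈ U) : S.frame.metric p = S.metric p := by
  have hX := (S.X_pos p hp).ne'
  have hY := (S.Y_neg p hp).ne
  have hf := (S.f_pos p hp).ne'
  have hD := (S.D_pos p hp).ne'
  ext i j
  fin_cases i <;> fin_cases j <;>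
  simp [ShearFrame.metric, frame, jval_mη, metric, shear, shearGen_apply, Matrix.mul_apply,
    Fin.sum_univ_four, Matrix.one_apply, Matrix.diagonal_apply] <;>
  field_simp <;> ring

end Stationary

/-! ### The curvature of a stationary vacuum metric through its Ernst potentials -/

/-- An antisymmetric matrix. -/
def skew (a b c d e f : ℝ) : Matrix (Fin 4) (Fin 4) ℝ :=
  !![0, a, b, c; -a, 0, d, e; -b, -d, 0, f; -c, -e, -f, 0]

namespace StationaryJet

variable (J : StationaryJet)

/-- The eigenvalue of the (anti-)self-dual Weyl tensor on the form of type
`dx ∧ dy ± dτ ∧ dφ`. -/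
def lam (s : ℝ) : ℝ :=
  ((J.X * (J.fx + s * J.vx) ^ 2 - J.Y * (J.fy + s * J.vy) ^ 2) / J.f ^ 2
    - 2 * ((J.X1 / 2 - 2 * J.X / J.D) * (J.fx + s * J.vx)
      - (J.Y1 / 2 + 2 * J.Y / J.D) * (J.fy + s * J.vy)) / J.f) / (4 * J.L)

/-- The real part of the trace-free Hessian of the Ernst potential `f ± v`. -/
def hessRe (s : ℝ) : ℝ :=
  J.X * (J.fxx + s * J.vxx) + J.X1 / 2 * (J.fx + s * J.vx) + J.Y * (J.fyy + s * J.vyy)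
    + J.Y1 / 2 * (J.fy + s * J.vy) - J.X * J.lx * (J.fx + s * J.vx)
    - J.Y * J.ly * (J.fy + s * J.vy)
    - (J.X * (J.fx ^ 2 - J.vx ^ 2) + J.Y * (J.fy ^ 2 - J.vy ^ 2)) / (2 * J.f)

/-- The imaginary part of the trace-free Hessian of the Ernst potential `f ± v`, divided by
`√(-X Y)`. -/
def hessIm (s : ℝ) : ℝ :=
  2 * (J.fxy + s * J.vxy) - J.lx * (J.fy + s * J.vy) - J.ly * (J.fx + s * J.vx)
    - (J.fx * J.fy - J.vx * J.vy) / J.f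

/-- The component of the (anti-)self-dual Weyl tensor on the forms of type `dx ∧ dτ`. -/
def wa (s : ℝ) : ℝ := -J.lam s / 2 - J.hessRe s / (4 * J.L * J.f)

/-- The component of the (anti-)self-dual Weyl tensor on the forms of type `dx ∧ dφ`. -/
def wb (s : ℝ) : ℝ := -J.lam s / 2 + J.hessRe s / (4 * J.L * J.f)

/-- The mixed component of the (anti-)self-dual Weyl tensor, divided by `√(-X Y)`. -/
def wc (s : ℝ) : ℝ := -s * J.hessIm s / (4 * J.L * J.f)

/-- The squared lengths of the frame vectors dual to dx, dy, dτ + q dφ, dφ. Their product is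
(L/D²)², the determinant of the metric. -/
def n1 : ℝ := J.L / J.X
def n2 : ℝ := -J.L / J.Y
def n3 : ℝ := J.f
def n4 : ℝ := -(J.X * J.Y) / (J.D ^ 4 * J.f)

/-- The vacuum field equations. -/
structure IsVacuum : Prop where
  ernst_f : J.f * (J.X * J.fxx - J.Y * J.fyy + (J.X1 - 2 * J.X / J.D) * J.fx
      - (J.Y1 + 2 * J.Y / J.D) * J.fy)
    = J.X * (J.fx ^ 2 + J.vx ^ 2) - J.Y * (J.fy ^ 2 + J.vy ^ 2)
  ernst_v : J.f * (J.X * J.vxx - J.Y * J.vyy + (J.X1 - 2 * J.X / J.D) * J.vx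
      - (J.Y1 + 2 * J.Y / J.D) * J.vy)
    = 2 * (J.X * J.fx * J.vx - J.Y * J.fy * J.vy)
  -- With ρ = √(-X Y)/D², this is Δρ = 0 for the flat Laplacian of dx²/X - dy²/Y.
  harmonic : J.X2 / 2 - 3 * J.X1 / J.D + 6 * J.X / J.D ^ 2
    = J.Y2 / 2 + 3 * J.Y1 / J.D + 6 * J.Y / J.D ^ 2
  -- For ∂ = √X ∂ₓ + i √(-Y) ∂_y, `conf_re` and `conf_im` are the real and imaginary parts of ∂ρ
  -- ∂log(L f) = ∂²ρ + ρ ∂(f + v) ∂(f - v)/(2 f²), in which `harmonic` has been used to write ∂²ρ.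
  conf_re : (J.X1 / 2 - 2 * J.X / J.D) * (J.lx + J.fx / J.f)
      + (J.Y1 / 2 + 2 * J.Y / J.D) * (J.ly + J.fy / J.f)
    = J.X2 - 6 * J.X1 / J.D + 12 * J.X / J.D ^ 2
      + (J.X * (J.fx ^ 2 - J.vx ^ 2) + J.Y * (J.fy ^ 2 - J.vy ^ 2)) / (2 * J.f ^ 2)
  conf_im : (J.X1 / 2 - 2 * J.X / J.D) * J.Y * (J.ly + J.fy / J.f)
      + (J.Y1 / 2 + 2 * J.Y / J.D) * J.X * (J.lx + J.fx / J.f)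
    = -4 * J.X * J.Y / J.D ^ 2
      + 2 * (J.X1 / 2 - 2 * J.X / J.D) * (J.Y1 / 2 + 2 * J.Y / J.D)
      + J.X * J.Y * (J.fx * J.fy - J.vx * J.vy) / J.f ^ 2
  gauss : -(J.X * J.lxx + J.X1 / 2 * J.lx - J.Y * J.lyy - J.Y1 / 2 * J.ly)
    = (J.X * (J.fx ^ 2 + J.vx ^ 2) - J.Y * (J.fy ^ 2 + J.vy ^ 2)) / (2 * J.f ^ 2)
      - ((J.X1 / 2 - 2 * J.X / J.D) * J.fx - (J.Y1 / 2 + 2 * J.Y / J.D) * J.fy) / J.f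

/-- Riemann components in the frame, with the indices 1 to 4 for x, y, τ, φ. Each comes from the
mean of the two duality parts: half sums where the two index pairs agree up to a common index, half
differences where the Hodge dual of one pair enters. -/
def r1212 : ℝ := J.n1 * J.n2 * ((J.lam 1 + J.lam (-1)) / 2)
def r3434 : ℝ := J.n3 * J.n4 * ((J.lam 1 + J.lam (-1)) / 2)
def r1234 : ℝ := J.L / J.D ^ 2 * ((J.lam 1 - J.lam (-1)) / 2)
def r1313 : ℝ := J.n1 * J.n3 * ((J.wa 1 + J.wa (-1)) / 2)
def r2424 : ℝ := J.n2 * J.n4 * ((J.wa 1 + J.wa (-1)) / 2)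
def r1324 : ℝ := J.L / J.D ^ 2 * ((J.wa (-1) - J.wa 1) / 2)
def r1414 : ℝ := J.n1 * J.n4 * ((J.wb 1 + J.wb (-1)) / 2)
def r2323 : ℝ := J.n2 * J.n3 * ((J.wb 1 + J.wb (-1)) / 2)
def r1423 : ℝ := J.L / J.D ^ 2 * ((J.wb 1 - J.wb (-1)) / 2)
def r1314 : ℝ := J.n1 * (-(J.X * J.Y) / J.D ^ 2) * ((J.wc 1 + J.wc (-1)) / 2)
def r1323 : ℝ := J.n3 * J.L * ((J.wc 1 - J.wc (-1)) / 2)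
def r2414 : ℝ := J.n4 * J.L * ((J.wc (-1) - J.wc 1) / 2)
def r2423 : ℝ := J.n2 * (J.X * J.Y / J.D ^ 2) * ((J.wc 1 + J.wc (-1)) / 2)

/-- The vacuum equations are solved for `fyy`, `vyy`, `X2`, `Y2` and `lyy`, so that these variables
can be eliminated by substitution; the components of the curvature then become identities between
rational functions of the remaining ones, apart from multiples of `conf_im`. -/
theorem IsVacuum.fyy_eq {J : StationaryJet} (h : J.IsVacuum) (hf : J.f ≠ 0) (hY : J.Y ≠ 0) :
    J.fyy = (J.X * J.fxx + (J.X1 - 2 * J.X / J.D) * J.fx - (J.Y1 + 2 * J.Y / J.D) * J.fy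
      - (J.X * (J.fx ^ 2 + J.vx ^ 2) - J.Y * (J.fy ^ 2 + J.vy ^ 2)) / J.f) / J.Y := by
  have := h.ernst_f
  field_simp at this ⊢
  linear_combination -this

theorem IsVacuum.vyy_eq {J : StationaryJet} (h : J.IsVacuum) (hf : J.f ≠ 0) (hY : J.Y ≠ 0) :
    J.vyy = (J.X * J.vxx + (J.X1 - 2 * J.X / J.D) * J.vx - (J.Y1 + 2 * J.Y / J.D) * J.vy
      - 2 * (J.X * J.fx * J.vx - J.Y * J.fy * J.vy) / J.f) / J.Y := by
  have := h.ernst_v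
  field_simp at this ⊢
  linear_combination -this

theorem IsVacuum.X2_eq {J : StationaryJet} (h : J.IsVacuum) :
    J.X2 = (J.X1 / 2 - 2 * J.X / J.D) * (J.lx + J.fx / J.f)
      + (J.Y1 / 2 + 2 * J.Y / J.D) * (J.ly + J.fy / J.f) + 6 * J.X1 / J.D - 12 * J.X / J.D ^ 2
      - (J.X * (J.fx ^ 2 - J.vx ^ 2) + J.Y * (J.fy ^ 2 - J.vy ^ 2)) / (2 * J.f ^ 2) := by
  linear_combination -h.conf_re

theorem IsVacuum.Y2_eq {J : StationaryJet} (h : J.IsVacuum) :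
    J.Y2 = (J.X1 / 2 - 2 * J.X / J.D) * (J.lx + J.fx / J.f)
      + (J.Y1 / 2 + 2 * J.Y / J.D) * (J.ly + J.fy / J.f) - 6 * J.Y1 / J.D - 12 * J.Y / J.D ^ 2
      - (J.X * (J.fx ^ 2 - J.vx ^ 2) + J.Y * (J.fy ^ 2 - J.vy ^ 2)) / (2 * J.f ^ 2) := by
  linear_combination -h.conf_re - 2 * h.harmonic

theorem IsVacuum.lyy_eq {J : StationaryJet} (h : J.IsVacuum) (hY : J.Y ≠ 0) :
    J.lyy = ((J.X * (J.fx ^ 2 + J.vx ^ 2) - J.Y * (J.fy ^ 2 + J.vy ^ 2)) / (2 * J.f ^ 2)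
      - ((J.X1 / 2 - 2 * J.X / J.D) * J.fx - (J.Y1 / 2 + 2 * J.Y / J.D) * J.fy) / J.f
      + (J.X * J.lxx + J.X1 / 2 * J.lx - J.Y1 / 2 * J.ly)) / J.Y := by
  have := h.gauss
  rw [eq_div_iff hY]
  linear_combination this

end StationaryJet

namespace Stationary

variable {U : Set Pt} (S : Stationary U)

-- The reflection (τ, φ) ↦ (-τ, -φ) is an isometry, so components with an odd number of indices τ, φ
-- vanish. Hence the curvature along (x, y) and (τ, φ) lives in the planes xy and τφ, and that along
-- the mixed pairs in the four mixed planes.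
set_option maxHeartbeats 4000000 in
theorem curvature_xy {p : Pt} (hp : p ∈ U) (hv : (S.J p).IsVacuum) :
    jval S.mη p * (jdx S.mAy p - jdy S.mAx p
        + (jval S.mAx p * jval S.mAy p - jval S.mAy p * jval S.mAx p))
      = skew (S.J p).r1212 0 0 0 0 (S.J p).r1234 := by
  have hX := (S.X_pos p hp).ne'
  have hY := (S.Y_neg p hp).ne
  have hL := (S.L_pos p hp).ne'
  have hf := (S.f_pos p hp).ne'
  have hD := (S.D_pos p hp).ne'
  have e1 := hv.fyy_eq hf hY
  have e2 := hv.vyy_eq hf hY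
  have e3 := hv.X2_eq
  have e4 := hv.Y2_eq
  have e5 := hv.lyy_eq hY
  have e6 := hv.conf_im
  rw [jval_mη]
  ext i j
  fin_cases i <;> fin_cases j <;>
  simp [jdx, jdy, jval, mAx, mAy, mAt, mAp, Matrix.diagonal_mul, Matrix.mul_apply,
    Fin.sum_univ_four, jmx, jmy, jqx, jqy, iX, iY, iL, iF, iD, jX, jX1, jY, jY1, jL, jlx, jly, jf, jfx, jfy, jvx, jvy, jD, skew,
    StationaryJet.r1212, StationaryJet.r3434, StationaryJet.r1234, StationaryJet.r1313,
    StationaryJet.r2424, StationaryJet.r1324, StationaryJet.r1414, StationaryJet.r2323,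
    StationaryJet.r1423, StationaryJet.r1314, StationaryJet.r1323, StationaryJet.r2414,
    StationaryJet.r2423, StationaryJet.n1, StationaryJet.n2, StationaryJet.n3, StationaryJet.n4,
    StationaryJet.wa, StationaryJet.wb, StationaryJet.wc, StationaryJet.lam, StationaryJet.hessRe,
    StationaryJet.hessIm, -mul_eq_zero, -mul_eq_mul_left_iff, -mul_eq_mul_right_iff] <;>
  generalize S.J p = J at * <;>
  clear hv <;>
  cases J <;> simp only at * <;>
  (try subst e1) <;> (try subst e2) <;> (try subst e3) <;> (try subst e4) <;> (try subst e5) <;>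
  field_simp <;> ring

set_option maxHeartbeats 4000000 in
theorem curvature_xt {p : Pt} (hp : p ∈ U) (hv : (S.J p).IsVacuum) :
    jval S.mη p * (jdx S.mAt p
        + (jval S.mAx p * jval S.mAt p - jval S.mAt p * jval S.mAx p))
      = skew 0 (S.J p).r1313 (S.J p).r1314 (S.J p).r1323 (S.J p).r1324 0 := by
  have hX := (S.X_pos p hp).ne'
  have hY := (S.Y_neg p hp).ne
  have hL := (S.L_pos p hp).ne'
  have hf := (S.f_pos p hp).ne'
  have hD := (S.D_pos p hp).ne'
  have e1 := hv.fyy_eq hf hY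
  have e2 := hv.vyy_eq hf hY
  have e3 := hv.X2_eq
  have e4 := hv.Y2_eq
  have e5 := hv.lyy_eq hY
  have e6 := hv.conf_im
  rw [jval_mη]
  ext i j
  fin_cases i <;> fin_cases j <;>
  simp [jdx, jdy, jval, mAx, mAy, mAt, mAp, Matrix.diagonal_mul, Matrix.mul_apply,
    Fin.sum_univ_four, jmx, jmy, jqx, jqy, iX, iY, iL, iF, iD, jX, jX1, jY, jY1, jL, jlx, jly, jf, jfx, jfy, jvx, jvy, jD, skew,
    StationaryJet.r1212, StationaryJet.r3434, StationaryJet.r1234, StationaryJet.r1313,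
    StationaryJet.r2424, StationaryJet.r1324, StationaryJet.r1414, StationaryJet.r2323,
    StationaryJet.r1423, StationaryJet.r1314, StationaryJet.r1323, StationaryJet.r2414,
    StationaryJet.r2423, StationaryJet.n1, StationaryJet.n2, StationaryJet.n3, StationaryJet.n4,
    StationaryJet.wa, StationaryJet.wb, StationaryJet.wc, StationaryJet.lam, StationaryJet.hessRe,
    StationaryJet.hessIm] <;>
  generalize S.J p = J at * <;>
  clear hv <;>
  cases J <;> simp only at * <;>
  (try subst e1) <;> (try subst e2) <;> (try subst e3) <;> (try subst e4) <;> (try subst e5) <;>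
  field_simp <;> ring

set_option maxHeartbeats 4000000 in
theorem curvature_yt {p : Pt} (hp : p ∈ U) (hv : (S.J p).IsVacuum) :
    jval S.mη p * (jdy S.mAt p
        + (jval S.mAy p * jval S.mAt p - jval S.mAt p * jval S.mAy p))
      = skew 0 (S.J p).r1323 (S.J p).r1423 (S.J p).r2323 (S.J p).r2423 0 := by
  have hX := (S.X_pos p hp).ne'
  have hY := (S.Y_neg p hp).ne
  have hL := (S.L_pos p hp).ne'
  have hf := (S.f_pos p hp).ne'
  have hD := (S.D_pos p hp).ne'
  have e1 := hv.fyy_eq hf hY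
  have e2 := hv.vyy_eq hf hY
  have e3 := hv.X2_eq
  have e4 := hv.Y2_eq
  have e5 := hv.lyy_eq hY
  have e6 := hv.conf_im
  rw [jval_mη]
  ext i j
  fin_cases i <;> fin_cases j <;>
  simp [jdx, jdy, jval, mAx, mAy, mAt, mAp, Matrix.diagonal_mul, Matrix.mul_apply,
    Fin.sum_univ_four, jmx, jmy, jqx, jqy, iX, iY, iL, iF, iD, jX, jX1, jY, jY1, jL, jlx, jly, jf, jfx, jfy, jvx, jvy, jD, skew,
    StationaryJet.r1212, StationaryJet.r3434, StationaryJet.r1234, StationaryJet.r1313,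
    StationaryJet.r2424, StationaryJet.r1324, StationaryJet.r1414, StationaryJet.r2323,
    StationaryJet.r1423, StationaryJet.r1314, StationaryJet.r1323, StationaryJet.r2414,
    StationaryJet.r2423, StationaryJet.n1, StationaryJet.n2, StationaryJet.n3, StationaryJet.n4,
    StationaryJet.wa, StationaryJet.wb, StationaryJet.wc, StationaryJet.lam, StationaryJet.hessRe,
    StationaryJet.hessIm] <;>
  generalize S.J p = J at * <;>
  clear hv <;>
  cases J <;> simp only at * <;>
  (try subst e1) <;> (try subst e2) <;> (try subst e3) <;> (try subst e4) <;> (try subst e5) <;>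
  field_simp <;> ring

set_option maxHeartbeats 4000000 in
theorem curvature_xp {p : Pt} (hp : p ∈ U) (hv : (S.J p).IsVacuum) :
    jval S.mη p * (jdx S.mAp p + S.jqx.val p • jval S.mAt p
        + (jval S.mAx p * jval S.mAp p - jval S.mAp p * jval S.mAx p))
      = skew 0 (S.J p).r1314 (S.J p).r1414 (S.J p).r1423 (S.J p).r2414 0 := by
  have hX := (S.X_pos p hp).ne'
  have hY := (S.Y_neg p hp).ne
  have hL := (S.L_pos p hp).ne'
  have hf := (S.f_pos p hp).ne'
  have hD := (S.D_pos p hp).ne'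
  have e1 := hv.fyy_eq hf hY
  have e2 := hv.vyy_eq hf hY
  have e3 := hv.X2_eq
  have e4 := hv.Y2_eq
  have e5 := hv.lyy_eq hY
  have e6 := hv.conf_im
  rw [jval_mη]
  ext i j
  fin_cases i <;> fin_cases j <;>
  simp [jdx, jdy, jval, mAx, mAy, mAt, mAp, Matrix.diagonal_mul, Matrix.mul_apply,
    Fin.sum_univ_four, jmx, jmy, jqx, jqy, iX, iY, iL, iF, iD, jX, jX1, jY, jY1, jL, jlx, jly, jf, jfx, jfy, jvx, jvy, jD, skew,
    StationaryJet.r1212, StationaryJet.r3434, StationaryJet.r1234, StationaryJet.r1313,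
    StationaryJet.r2424, StationaryJet.r1324, StationaryJet.r1414, StationaryJet.r2323,
    StationaryJet.r1423, StationaryJet.r1314, StationaryJet.r1323, StationaryJet.r2414,
    StationaryJet.r2423, StationaryJet.n1, StationaryJet.n2, StationaryJet.n3, StationaryJet.n4,
    StationaryJet.wa, StationaryJet.wb, StationaryJet.wc, StationaryJet.lam, StationaryJet.hessRe,
    StationaryJet.hessIm] <;>
  generalize S.J p = J at * <;>
  clear hv <;>
  cases J <;> simp only at * <;>
  (try subst e1) <;> (try subst e2) <;> (try subst e3) <;> (try subst e4) <;> (try subst e5) <;>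
  -- The components that are not identities after the substitutions are multiples of `conf_im`, the
  -- one equation used that has not been solved for a variable.
  first
  | (field_simp; ring; done)
  | (field_simp at e6 ⊢
     first
     | linear_combination 2 * e6
     | linear_combination 4 * e6
     | linear_combination -4 * e6)

set_option maxHeartbeats 4000000 in
theorem curvature_yp {p : Pt} (hp : p ∈ U) (hv : (S.J p).IsVacuum) :
    jval S.mη p * (jdy S.mAp p + S.jqy.val p • jval S.mAt p
        + (jval S.mAy p * jval S.mAp p - jval S.mAp p * jval S.mAy p))
      = skew 0 (S.J p).r1324 (S.J p).r2414 (S.J p).r2423 (S.J p).r2424 0 := by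
  have hX := (S.X_pos p hp).ne'
  have hY := (S.Y_neg p hp).ne
  have hL := (S.L_pos p hp).ne'
  have hf := (S.f_pos p hp).ne'
  have hD := (S.D_pos p hp).ne'
  have e1 := hv.fyy_eq hf hY
  have e2 := hv.vyy_eq hf hY
  have e3 := hv.X2_eq
  have e4 := hv.Y2_eq
  have e5 := hv.lyy_eq hY
  have e6 := hv.conf_im
  rw [jval_mη]
  ext i j
  fin_cases i <;> fin_cases j <;>
  simp [jdx, jdy, jval, mAx, mAy, mAt, mAp, Matrix.diagonal_mul, Matrix.mul_apply,
    Fin.sum_univ_four, jmx, jmy, jqx, jqy, iX, iY, iL, iF, iD, jX, jX1, jY, jY1, jL, jlx, jly, jf, jfx, jfy, jvx, jvy, jD, skew,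
    StationaryJet.r1212, StationaryJet.r3434, StationaryJet.r1234, StationaryJet.r1313,
    StationaryJet.r2424, StationaryJet.r1324, StationaryJet.r1414, StationaryJet.r2323,
    StationaryJet.r1423, StationaryJet.r1314, StationaryJet.r1323, StationaryJet.r2414,
    StationaryJet.r2423, StationaryJet.n1, StationaryJet.n2, StationaryJet.n3, StationaryJet.n4,
    StationaryJet.wa, StationaryJet.wb, StationaryJet.wc, StationaryJet.lam, StationaryJet.hessRe,
    StationaryJet.hessIm] <;>
  generalize S.J p = J at * <;>
  clear hv <;>
  cases J <;> simp only at * <;>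
  (try subst e1) <;> (try subst e2) <;> (try subst e3) <;> (try subst e4) <;> (try subst e5) <;>
  first
  | (field_simp; ring; done)
  | (field_simp at e6 ⊢
     first
     | linear_combination 2 * e6
     | linear_combination 4 * e6
     | linear_combination -4 * e6)

set_option maxHeartbeats 4000000 in
theorem curvature_tp {p : Pt} (hp : p ∈ U) (hv : (S.J p).IsVacuum) :
    jval S.mη p * (jval S.mAt p * jval S.mAp p - jval S.mAp p * jval S.mAt p)
      = skew (S.J p).r1234 0 0 0 0 (S.J p).r3434 := by
  have hX := (S.X_pos p hp).ne'
  have hY := (S.Y_neg p hp).ne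
  have hL := (S.L_pos p hp).ne'
  have hf := (S.f_pos p hp).ne'
  have hD := (S.D_pos p hp).ne'
  have e1 := hv.fyy_eq hf hY
  have e2 := hv.vyy_eq hf hY
  have e3 := hv.X2_eq
  have e4 := hv.Y2_eq
  have e5 := hv.lyy_eq hY
  have e6 := hv.conf_im
  rw [jval_mη]
  ext i j
  fin_cases i <;> fin_cases j <;>
  simp [jdx, jdy, jval, mAx, mAy, mAt, mAp, Matrix.diagonal_mul, Matrix.mul_apply,
    Fin.sum_univ_four, jmx, jmy, jqx, jqy, iX, iY, iL, iF, iD, jX, jX1, jY, jY1, jL, jlx, jly, jf, jfx, jfy, jvx, jvy, jD, skew,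
    StationaryJet.r1212, StationaryJet.r3434, StationaryJet.r1234, StationaryJet.r1313,
    StationaryJet.r2424, StationaryJet.r1324, StationaryJet.r1414, StationaryJet.r2323,
    StationaryJet.r1423, StationaryJet.r1314, StationaryJet.r1323, StationaryJet.r2414,
    StationaryJet.r2423, StationaryJet.n1, StationaryJet.n2, StationaryJet.n3, StationaryJet.n4,
    StationaryJet.wa, StationaryJet.wb, StationaryJet.wc, StationaryJet.lam, StationaryJet.hessRe,
    StationaryJet.hessIm, -mul_eq_zero, -mul_eq_mul_left_iff, -mul_eq_mul_right_iff] <;>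
  generalize S.J p = J at * <;>
  clear hv <;>
  cases J <;> simp only at * <;>
  (try subst e1) <;> (try subst e2) <;> (try subst e3) <;> (try subst e4) <;> (try subst e5) <;>
  field_simp <;> ring

end Stationary

/-! ### Weyl tensors in block form and the Hodge operator -/

/-- The Vandermonde product vanishes for repeated indices, is alternating, and equals 1! · 2! · 3! =
12 at (0, 1, 2, 3). This turns the Levi-Civita symbol into a polynomial that can be evaluated entry
by entry. -/
theorem leviCivita_eq (a b c d : Fin 4) :
    12 * leviCivita a b c d = ((b : ℤ) - a) * (c - a) * (d - a) * (c - b) * (d - b) * (d - c) := by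
  revert a b c d
  decide +kernel

/-- The components of the metric in which the coframe `dp⁰, dp¹, dp² + q dp³, dp³` is
orthogonal, with the squared norms `n₁, n₂, n₃, κ² / (n₁ n₂ n₃)` of its dual frame. -/
def shearMetric (n₁ n₂ n₃ κ q : ℝ) : Matrix (Fin 4) (Fin 4) ℝ :=
  !![n₁, 0, 0, 0; 0, n₂, 0, 0; 0, 0, n₃, n₃ * q;
     0, 0, n₃ * q, n₃ * q ^ 2 + κ ^ 2 / (n₁ * n₂ * n₃)]

/-- The orthogonal basis of the (anti-)self-dual forms of `shearMetric`. -/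
def sdForm₁ (n₁ n₂ κ s : ℝ) : Matrix (Fin 4) (Fin 4) ℝ := skew (n₁ * n₂) 0 0 0 0 (s * κ)

/-- The second form of the basis of `sdForm₁`. -/
def sdForm₂ (n₁ n₃ κ q s : ℝ) : Matrix (Fin 4) (Fin 4) ℝ :=
  skew 0 (n₁ * n₃) (q * (n₁ * n₃)) 0 (-(s * κ)) 0

/-- The third form of the basis of `sdForm₁`. -/
def sdForm₃ (n₂ n₃ κ q s : ℝ) : Matrix (Fin 4) (Fin 4) ℝ :=
  skew 0 0 (s * κ) (n₂ * n₃) (q * (n₂ * n₃)) 0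

/-- The norms of an adapted frame, and the components of a self-dual (`s = 1`) and an
anti-self-dual (`s = -1`) Weyl tensor in a block form. -/
structure PetrovData where
  (n₁ n₂ n₃ κ q : ℝ)
  (lam a b γ : ℝ → ℝ)

/-- The (anti-)self-dual Weyl tensor. -/
def PetrovData.part (Φ : PetrovData) (s : ℝ) (i j k l : Fin 4) : ℝ :=
  Φ.lam s / (Φ.n₁ * Φ.n₂) * (sdForm₁ Φ.n₁ Φ.n₂ Φ.κ s i j * sdForm₁ Φ.n₁ Φ.n₂ Φ.κ s k l)
  + Φ.a s / (Φ.n₁ * Φ.n₃)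
    * (sdForm₂ Φ.n₁ Φ.n₃ Φ.κ Φ.q s i j * sdForm₂ Φ.n₁ Φ.n₃ Φ.κ Φ.q s k l)
  + Φ.b s / (Φ.n₂ * Φ.n₃)
    * (sdForm₃ Φ.n₂ Φ.n₃ Φ.κ Φ.q s i j * sdForm₃ Φ.n₂ Φ.n₃ Φ.κ Φ.q s k l)
  + Φ.γ s * (sdForm₂ Φ.n₁ Φ.n₃ Φ.κ Φ.q s i j * sdForm₃ Φ.n₂ Φ.n₃ Φ.κ Φ.q s k l
    + sdForm₃ Φ.n₂ Φ.n₃ Φ.κ Φ.q s i j * sdForm₂ Φ.n₁ Φ.n₃ Φ.κ Φ.q s k l)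

/-- The Riemann tensor of `g` at `p` is the sum of a self-dual and an anti-self-dual Weyl tensor,
both in a block form with respect to the bases of forms above. -/
structure PetrovFrame (g : MetricField) (p : Pt) extends PetrovData where
  n₁_pos : 0 < n₁
  n₂_pos : 0 < n₂
  n₃_pos : 0 < n₃
  κ_pos : 0 < κ
  trace : ∀ s, lam s + a s + b s = 0
  metric_eq : g p = shearMetric n₁ n₂ n₃ κ q
  riemann_eq : ∀ i j k l, riemann g p i j k l
    = (toPetrovData.part 1 i j k l + toPetrovData.part (-1) i j k l) / 2

namespace PetrovFrame

variable {g : MetricField} {p : Pt}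

/-- The components of the inverse metric. -/
def gInv (Φ : PetrovFrame g p) : Matrix (Fin 4) (Fin 4) ℝ :=
  !![1 / Φ.n₁, 0, 0, 0; 0, 1 / Φ.n₂, 0, 0;
     0, 0, 1 / Φ.n₃ + Φ.q ^ 2 * (Φ.n₁ * Φ.n₂ * Φ.n₃) / Φ.κ ^ 2,
       -Φ.q * (Φ.n₁ * Φ.n₂ * Φ.n₃) / Φ.κ ^ 2;
     0, 0, -Φ.q * (Φ.n₁ * Φ.n₂ * Φ.n₃) / Φ.κ ^ 2, Φ.n₁ * Φ.n₂ * Φ.n₃ / Φ.κ ^ 2]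

theorem mul_gInv (Φ : PetrovFrame g p) : g p * Φ.gInv = 1 := by
  have h1 := Φ.n₁_pos.ne'
  have h2 := Φ.n₂_pos.ne'
  have h3 := Φ.n₃_pos.ne'
  have h4 := Φ.κ_pos.ne'
  rw [Φ.metric_eq]
  ext i j
  fin_cases i <;> fin_cases j <;>
    simp [shearMetric, gInv, Matrix.mul_apply, Fin.sum_univ_four] <;> field_simp <;> ring

theorem inv_eq (Φ : PetrovFrame g p) : (g p)⁻¹ = Φ.gInv := Matrix.inv_eq_right_inv Φ.mul_gInv

theorem det_eq (Φ : PetrovFrame g p) : (g p).det = Φ.κ ^ 2 := by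
  have h1 := Φ.n₁_pos.ne'
  have h2 := Φ.n₂_pos.ne'
  have h3 := Φ.n₃_pos.ne'
  rw [Φ.metric_eq, shearMetric, Matrix.det_succ_row_zero]
  simp [Fin.sum_univ_succ, Matrix.det_fin_three, Matrix.submatrix, Fin.succAbove]
  field_simp
  ring

theorem posDef (Φ : PetrovFrame g p) : (g p).PosDef := by
  have h1 := Φ.n₁_pos
  have h2 := Φ.n₂_pos
  have h3 := Φ.n₃_pos
  have h4 := Φ.κ_pos
  have hd : 0 < Φ.κ ^ 2 / (Φ.n₁ * Φ.n₂ * Φ.n₃) := by positivity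
  rw [Φ.metric_eq, Matrix.posDef_iff_dotProduct_mulVec]
  refine ⟨?_, fun v hv => ?_⟩
  · ext i j
    fin_cases i <;> fin_cases j <;> simp [shearMetric]
  · have e : star v ⬝ᵥ (shearMetric Φ.n₁ Φ.n₂ Φ.n₃ Φ.κ Φ.q *ᵥ v)
        = Φ.n₁ * v 0 ^ 2 + Φ.n₂ * v 1 ^ 2 + Φ.n₃ * (v 2 + Φ.q * v 3) ^ 2
          + Φ.κ ^ 2 / (Φ.n₁ * Φ.n₂ * Φ.n₃) * v 3 ^ 2 := by
      simp [shearMetric, Matrix.mulVec, dotProduct, Fin.sum_univ_four]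
      ring
    rw [e]
    by_contra hle
    have p1 : 0 ≤ Φ.n₁ * v 0 ^ 2 := by positivity
    have p2 : 0 ≤ Φ.n₂ * v 1 ^ 2 := by positivity
    have p3 : 0 ≤ Φ.n₃ * (v 2 + Φ.q * v 3) ^ 2 := by positivity
    have p4 : 0 ≤ Φ.κ ^ 2 / (Φ.n₁ * Φ.n₂ * Φ.n₃) * v 3 ^ 2 := by positivity
    have z0 : v 0 = 0 := by
      have : Φ.n₁ * v 0 ^ 2 = 0 := by linarith
      simpa [h1.ne'] using this
    have z1 : v 1 = 0 := by
      have : Φ.n₂ * v 1 ^ 2 = 0 := by linarith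
      simpa [h2.ne'] using this
    have z3 : v 3 = 0 := by
      have : Φ.κ ^ 2 / (Φ.n₁ * Φ.n₂ * Φ.n₃) * v 3 ^ 2 = 0 := by linarith
      simpa [hd.ne', h1.ne', h2.ne', h3.ne', h4.ne'] using this
    have z2 : v 2 = 0 := by
      have : Φ.n₃ * (v 2 + Φ.q * v 3) ^ 2 = 0 := by linarith
      simpa [h3.ne', z3] using this
    exact hv (funext fun i => by fin_cases i <;> simpa)

theorem riemannUp_eq (Φ : PetrovFrame g p) (i j k l : Fin 4) :
    riemannUp g p i j k l = ∑ m, Φ.gInv i m * riemann g p m j k l := by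
  have h : Φ.gInv * g p = 1 := mul_eq_one_comm.mp Φ.mul_gInv
  simp only [riemann, Finset.mul_sum]
  rw [Finset.sum_comm]
  calc riemannUp g p i j k l = ∑ n, (1 : Matrix (Fin 4) (Fin 4) ℝ) i n * riemannUp g p n j k l := by
        simp [Matrix.one_apply]
    _ = _ := by
        rw [← h]
        simp only [Matrix.mul_apply, Finset.sum_mul, mul_assoc]

/-- Up to scale the three basis forms of one duality multiply like the quaternion units, so the
Ricci contraction of a symmetric tensor in them is its trace times the metric. The field `trace`
makes it vanish. -/
theorem ricci_eq_zero (Φ : PetrovFrame g p) (j l : Fin 4) : ricci g p j l = 0 := by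
  have h1 := Φ.n₁_pos.ne'
  have h2 := Φ.n₂_pos.ne'
  have h3 := Φ.n₃_pos.ne'
  have h4 := Φ.κ_pos.ne'
  have t1 : Φ.b 1 = -Φ.lam 1 - Φ.a 1 := by linarith [Φ.trace 1]
  have t2 : Φ.b (-1) = -Φ.lam (-1) - Φ.a (-1) := by linarith [Φ.trace (-1)]
  simp only [ricci, Φ.riemannUp_eq, Φ.riemann_eq, PetrovData.part]
  fin_cases j <;> fin_cases l <;>
    simp [Fin.sum_univ_four, gInv, sdForm₁, sdForm₂, sdForm₃, skew] <;>
    rw [t1, t2] <;> field_simp <;> ring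

theorem weyl_eq (Φ : PetrovFrame g p) (i j k l : Fin 4) :
    weyl g p i j k l = riemann g p i j k l := by
  simp [weyl, scalarCurvature, Φ.ricci_eq_zero]

end PetrovFrame

theorem eq_skew {ω : Matrix (Fin 4) (Fin 4) ℝ} (h : ω.transpose = -ω) :
    ω = skew (ω 0 1) (ω 0 2) (ω 0 3) (ω 1 2) (ω 1 3) (ω 2 3) := by
  have h' : ∀ i j, ω j i = -ω i j := fun i j => congrFun (congrFun h i) j
  have hd : ∀ i, ω i i = 0 := fun i => by linarith [h' i i]
  ext i j
  fin_cases i <;> fin_cases j <;> simp [skew, hd] <;> exact h' _ _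

theorem skew_transpose (a b c d e f : ℝ) : (skew a b c d e f).transpose = -skew a b c d e f := by
  ext i j
  fin_cases i <;> fin_cases j <;> simp [skew]

namespace PetrovFrame

variable {g : MetricField} {p : Pt}

/-- Both indices of a 2-form are raised; the Hodge operator and the Weyl endomorphism both begin
with this. -/
theorem gInv_mul_skew_mul (Φ : PetrovFrame g p) (w₁ w₂ w₃ w₄ w₅ w₆ : ℝ) :
    Φ.gInv * skew w₁ w₂ w₃ w₄ w₅ w₆ * Φ.gInvᵀ
      = skew (w₁ / (Φ.n₁ * Φ.n₂))
        (w₂ / (Φ.n₁ * Φ.n₃) - Φ.q * ((w₃ - Φ.q * w₂) * (Φ.n₂ * Φ.n₃ / Φ.κ ^ 2)))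
        ((w₃ - Φ.q * w₂) * (Φ.n₂ * Φ.n₃ / Φ.κ ^ 2))
        (w₄ / (Φ.n₂ * Φ.n₃) - Φ.q * ((w₅ - Φ.q * w₄) * (Φ.n₁ * Φ.n₃ / Φ.κ ^ 2)))
        ((w₅ - Φ.q * w₄) * (Φ.n₁ * Φ.n₃ / Φ.κ ^ 2))
        (w₆ * (Φ.n₁ * Φ.n₂ / Φ.κ ^ 2)) := by
  have h1 := Φ.n₁_pos.ne'
  have h2 := Φ.n₂_pos.ne'
  have h3 := Φ.n₃_pos.ne'
  have h4 := Φ.κ_pos.ne'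
  ext i j
  fin_cases i <;> fin_cases j <;>
    simp [gInv, skew, Matrix.mul_apply, Fin.sum_univ_four] <;> field_simp <;> ring

theorem hodge_skew (Φ : PetrovFrame g p) (w₁ w₂ w₃ w₄ w₅ w₆ : ℝ) :
    hodge g p (skew w₁ w₂ w₃ w₄ w₅ w₆)
      = skew (w₆ * (Φ.n₁ * Φ.n₂ / Φ.κ)) (-((w₅ - Φ.q * w₄) * (Φ.n₁ * Φ.n₃ / Φ.κ)))
        (Φ.κ * w₄ / (Φ.n₂ * Φ.n₃) - Φ.q * ((w₅ - Φ.q * w₄) * (Φ.n₁ * Φ.n₃ / Φ.κ)))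
        ((w₃ - Φ.q * w₂) * (Φ.n₂ * Φ.n₃ / Φ.κ))
        (Φ.q * ((w₃ - Φ.q * w₂) * (Φ.n₂ * Φ.n₃ / Φ.κ)) - Φ.κ * w₂ / (Φ.n₁ * Φ.n₃))
        (Φ.κ * w₁ / (Φ.n₁ * Φ.n₂)) := by
  have h1 := Φ.n₁_pos.ne'
  have h2 := Φ.n₂_pos.ne'
  have h3 := Φ.n₃_pos.ne'
  have h4 := Φ.κ_pos.ne'
  have hε : ∀ a b c d, (leviCivita a b c d : ℝ)
      = ((b : ℝ) - a) * (c - a) * (d - a) * (c - b) * (d - b) * (d - c) / 12 := by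
    intro a b c d
    rw [eq_div_iff (by norm_num), mul_comm]
    exact_mod_cast leviCivita_eq a b c d
  have key : ∀ i j, hodge g p (skew w₁ w₂ w₃ w₄ w₅ w₆) i j
      = 1 / 2 * ∑ c, ∑ d, Φ.κ * (leviCivita i j c d : ℝ)
        * (Φ.gInv * skew w₁ w₂ w₃ w₄ w₅ w₆ * Φ.gInvᵀ) c d := by
    intro i j
    simp only [hodge, Matrix.of_apply, Φ.inv_eq, Φ.det_eq, Real.sqrt_sq Φ.κ_pos.le,
      Matrix.mul_apply, Matrix.transpose_apply, Finset.mul_sum, Finset.sum_mul]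
    refine Finset.sum_congr rfl fun c _ => Finset.sum_congr rfl fun d _ => ?_
    rw [Finset.sum_comm]
    exact Finset.sum_congr rfl fun e _ => Finset.sum_congr rfl fun f _ => by ring
  ext i j
  rw [key, Φ.gInv_mul_skew_mul]
  simp only [hε]
  fin_cases i <;> fin_cases j <;>
    simp [skew, Fin.sum_univ_four] <;> (try field_simp) <;> (try ring)

/-- The (anti-)self-dual form with the given components. -/
def sdForm (Φ : PetrovFrame g p) (s z₁ z₂ z₃ : ℝ) : Matrix (Fin 4) (Fin 4) ℝ :=
  skew (z₁ * (Φ.n₁ * Φ.n₂)) (z₂ * (Φ.n₁ * Φ.n₃))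
    (z₂ * (Φ.q * (Φ.n₁ * Φ.n₃)) + z₃ * (s * Φ.κ)) (z₃ * (Φ.n₂ * Φ.n₃))
    (z₃ * (Φ.q * (Φ.n₂ * Φ.n₃)) - z₂ * (s * Φ.κ)) (z₁ * (s * Φ.κ))

theorem hodge_sdForm (Φ : PetrovFrame g p) {s : ℝ} (hs : s ^ 2 = 1) (z₁ z₂ z₃ : ℝ) :
    hodge g p (Φ.sdForm s z₁ z₂ z₃) = s • Φ.sdForm s z₁ z₂ z₃ := by
  have h1 := Φ.n₁_pos.ne'
  have h2 := Φ.n₂_pos.ne'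
  have h3 := Φ.n₃_pos.ne'
  have h4 := Φ.κ_pos.ne'
  rw [sdForm, Φ.hodge_skew]
  ext i j
  fin_cases i <;> fin_cases j <;> simp [skew] <;> field_simp <;> grind

/-- The space of forms of one duality is three-dimensional: the duality equation recovers the
entries 03, 13, 23 from 01, 02, 12, which serve as coordinates. -/
theorem eq_sdForm (Φ : PetrovFrame g p) {s : ℝ} (hs : s ^ 2 = 1) {ω : Matrix (Fin 4) (Fin 4) ℝ}
    (hω : ω.transpose = -ω) (h : hodge g p ω = s • ω) :
    ω = Φ.sdForm s (ω 0 1 / (Φ.n₁ * Φ.n₂)) (ω 0 2 / (Φ.n₁ * Φ.n₃)) (ω 1 2 / (Φ.n₂ * Φ.n₃)) := by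
  have h1 := Φ.n₁_pos.ne'
  have h2 := Φ.n₂_pos.ne'
  have h3 := Φ.n₃_pos.ne'
  have h4 := Φ.κ_pos.ne'
  rw [eq_skew hω, Φ.hodge_skew] at h
  -- Three entries of the duality equation suffice; for s² = 1 the other three are equivalent to
  -- them.
  have e03 := congrFun (congrFun h 0) 2
  have e12 := congrFun (congrFun h 1) 2
  have e23 := congrFun (congrFun h 2) 3
  simp [skew] at e03 e12 e23
  field_simp at e03 e12 e23
  have r : ω = skew (ω 0 1) (ω 0 2) (ω 0 3) (ω 1 2) (ω 1 3) (ω 2 3) := eq_skew hω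
  rw [r]
  have t3 : ω 0 3 = ω 0 2 * Φ.q + ω 1 2 / (Φ.n₂ * Φ.n₃) * (s * Φ.κ) := by
    field_simp; linear_combination e12
  have t5 : ω 1 3 = ω 1 2 * Φ.q - ω 0 2 / (Φ.n₁ * Φ.n₃) * (s * Φ.κ) := by
    field_simp; linear_combination -e03
  have t6 : ω 2 3 = ω 0 1 / (Φ.n₁ * Φ.n₂) * (s * Φ.κ) := by
    field_simp
    linear_combination (-s) * e23 - ω 2 3 * (Φ.n₁ * Φ.n₂) * hs
  ext i j
  fin_cases i <;> fin_cases j <;> simp [skew, sdForm, t3, t5, t6] <;> field_simp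

theorem weylOp_sdForm (Φ : PetrovFrame g p) {s : ℝ} (hs : s = 1 ∨ s = -1) (z₁ z₂ z₃ : ℝ) :
    weylOp g p (Φ.sdForm s z₁ z₂ z₃) = Φ.sdForm s (2 * Φ.lam s * z₁)
      (2 * (Φ.a s * z₂ + Φ.γ s * (Φ.n₂ * Φ.n₃) * z₃))
      (2 * (Φ.b s * z₃ + Φ.γ s * (Φ.n₁ * Φ.n₃) * z₂)) := by
  have h1 := Φ.n₁_pos.ne'
  have h2 := Φ.n₂_pos.ne'
  have h3 := Φ.n₃_pos.ne'
  have h4 := Φ.κ_pos.ne'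
  have key : ∀ i j, weylOp g p (Φ.sdForm s z₁ z₂ z₃) i j
      = ∑ c, ∑ d, (Φ.part 1 i j c d + Φ.part (-1) i j c d) / 2
        * (Φ.gInv * Φ.sdForm s z₁ z₂ z₃ * Φ.gInvᵀ) c d := by
    intro i j
    simp only [weylOp, Matrix.of_apply, Φ.inv_eq, Φ.weyl_eq, Φ.riemann_eq, Matrix.mul_apply,
      Matrix.transpose_apply, Finset.mul_sum, Finset.sum_mul]
    refine Finset.sum_congr rfl fun c _ => Finset.sum_congr rfl fun d _ => ?_
    rw [Finset.sum_comm]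
    exact Finset.sum_congr rfl fun e _ => Finset.sum_congr rfl fun f _ => by ring
  have pair : ∀ M : Matrix (Fin 4) (Fin 4) ℝ, ∀ t i j, ∑ c, ∑ d, Φ.part t i j c d * M c d
      = Φ.lam t / (Φ.n₁ * Φ.n₂) * sdForm₁ Φ.n₁ Φ.n₂ Φ.κ t i j
          * (∑ c, ∑ d, sdForm₁ Φ.n₁ Φ.n₂ Φ.κ t c d * M c d)
        + Φ.a t / (Φ.n₁ * Φ.n₃) * sdForm₂ Φ.n₁ Φ.n₃ Φ.κ Φ.q t i j
          * (∑ c, ∑ d, sdForm₂ Φ.n₁ Φ.n₃ Φ.κ Φ.q t c d * M c d)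
        + Φ.b t / (Φ.n₂ * Φ.n₃) * sdForm₃ Φ.n₂ Φ.n₃ Φ.κ Φ.q t i j
          * (∑ c, ∑ d, sdForm₃ Φ.n₂ Φ.n₃ Φ.κ Φ.q t c d * M c d)
        + Φ.γ t * (sdForm₂ Φ.n₁ Φ.n₃ Φ.κ Φ.q t i j
            * (∑ c, ∑ d, sdForm₃ Φ.n₂ Φ.n₃ Φ.κ Φ.q t c d * M c d)
          + sdForm₃ Φ.n₂ Φ.n₃ Φ.κ Φ.q t i j
            * (∑ c, ∑ d, sdForm₂ Φ.n₁ Φ.n₃ Φ.κ Φ.q t c d * M c d)) := by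
    intro M t i j
    simp only [Finset.mul_sum, mul_add, ← Finset.sum_add_distrib]
    exact Finset.sum_congr rfl fun c _ => Finset.sum_congr rfl fun d _ => by
      simp only [PetrovData.part]; ring
  -- The pairing vanishes between opposite dualities (t = -s) and has the factor 4 for t = s. With
  -- the factor 1/2 in the decomposition of the Riemann tensor this leaves the 2 in the statement.
  have p1 : ∀ t, (∑ c, ∑ d, sdForm₁ Φ.n₁ Φ.n₂ Φ.κ t c d
      * (Φ.gInv * Φ.sdForm s z₁ z₂ z₃ * Φ.gInvᵀ) c d) = 2 * (1 + t * s) * (Φ.n₁ * Φ.n₂) * z₁ := by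
    intro t
    rw [sdForm, Φ.gInv_mul_skew_mul]
    simp [sdForm₁, skew, Fin.sum_univ_four]
    field_simp
    ring
  have p2 : ∀ t, (∑ c, ∑ d, sdForm₂ Φ.n₁ Φ.n₃ Φ.κ Φ.q t c d
      * (Φ.gInv * Φ.sdForm s z₁ z₂ z₃ * Φ.gInvᵀ) c d) = 2 * (1 + t * s) * (Φ.n₁ * Φ.n₃) * z₂ := by
    intro t
    rw [sdForm, Φ.gInv_mul_skew_mul]
    simp [sdForm₂, skew, Fin.sum_univ_four]
    field_simp
    ring
  have p3 : ∀ t, (∑ c, ∑ d, sdForm₃ Φ.n₂ Φ.n₃ Φ.κ Φ.q t c d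
      * (Φ.gInv * Φ.sdForm s z₁ z₂ z₃ * Φ.gInvᵀ) c d) = 2 * (1 + t * s) * (Φ.n₂ * Φ.n₃) * z₃ := by
    intro t
    rw [sdForm, Φ.gInv_mul_skew_mul]
    simp [sdForm₃, skew, Fin.sum_univ_four]
    field_simp
    ring
  ext i j
  rw [key]
  simp only [div_mul_eq_mul_div, add_mul, ← Finset.sum_div, Finset.sum_add_distrib, pair, p1,
    p2, p3]
  rcases hs with rfl | rfl <;> fin_cases i <;> fin_cases j <;>
    simp [sdForm, sdForm₁, sdForm₂, sdForm₃, skew] <;> field_simp <;> ring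

theorem mem_weylEigenvalues (Φ : PetrovFrame g p) {s : ℝ} (hs : s = 1 ∨ s = -1) (μ : ℝ) :
    μ ∈ weylEigenvalues g p s ↔ ∃ z₁ z₂ z₃ : ℝ, (z₁ ≠ 0 ∨ z₂ ≠ 0 ∨ z₃ ≠ 0) ∧
      2 * Φ.lam s * z₁ = μ * z₁ ∧
      2 * (Φ.a s * z₂ + Φ.γ s * (Φ.n₂ * Φ.n₃) * z₃) = μ * z₂ ∧
      2 * (Φ.b s * z₃ + Φ.γ s * (Φ.n₁ * Φ.n₃) * z₂) = μ * z₃ := by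
  have h1 := Φ.n₁_pos.ne'
  have h2 := Φ.n₂_pos.ne'
  have h3 := Φ.n₃_pos.ne'
  have hs2 : s ^ 2 = 1 := by rcases hs with rfl | rfl <;> norm_num
  constructor
  · rintro ⟨ω, h0, ht, hh, hw⟩
    have e := Φ.eq_sdForm hs2 ht hh
    generalize ω 0 1 / (Φ.n₁ * Φ.n₂) = z₁ at e
    generalize ω 0 2 / (Φ.n₁ * Φ.n₃) = z₂ at e
    generalize ω 1 2 / (Φ.n₂ * Φ.n₃) = z₃ at e
    subst e
    refine ⟨z₁, z₂, z₃, ?_, ?_⟩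
    · by_contra! hz
      obtain ⟨rfl, rfl, rfl⟩ := hz
      refine h0 ?_
      ext i j
      fin_cases i <;> fin_cases j <;> simp [sdForm, skew]
    · rw [Φ.weylOp_sdForm hs] at hw
      have e1 := congrFun (congrFun hw 0) 1
      have e2 := congrFun (congrFun hw 0) 2
      have e3 := congrFun (congrFun hw 1) 2
      simp only [sdForm, skew, Matrix.of_apply, Matrix.cons_val', Matrix.cons_val_zero,
        Matrix.cons_val_one, Matrix.cons_val, Matrix.smul_apply, smul_eq_mul] at e1 e2 e3
      refine ⟨?_, ?_, ?_⟩
      · exact mul_right_cancel₀ (mul_ne_zero h1 h2) (by linear_combination e1)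
      · exact mul_right_cancel₀ (mul_ne_zero h1 h3) (by linear_combination e2)
      · exact mul_right_cancel₀ (mul_ne_zero h2 h3) (by linear_combination e3)
  · rintro ⟨z₁, z₂, z₃, hz, e1, e2, e3⟩
    refine ⟨Φ.sdForm s z₁ z₂ z₃, ?_, skew_transpose _ _ _ _ _ _, Φ.hodge_sdForm hs2 _ _ _, ?_⟩
    · intro h0
      have e1 := congrFun (congrFun h0 0) 1
      have e2 := congrFun (congrFun h0 0) 2
      have e3 := congrFun (congrFun h0 1) 2
      simp [sdForm, skew, h1, h2, h3] at e1 e2 e3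
      simp [e1, e2, e3] at hz
    · rw [Φ.weylOp_sdForm hs, e1, e2, e3]
      ext i j
      fin_cases i <;> fin_cases j <;> simp [sdForm, skew] <;> ring

end PetrovFrame

/-! ### Eigenvalues and algebraic types -/

namespace PetrovFrame

variable {g : MetricField} {p : Pt}

/-- The square of half the difference of the two eigenvalues of the two-dimensional block of the
(anti-)self-dual Weyl tensor. -/
def disc (Φ : PetrovFrame g p) (s : ℝ) : ℝ :=
  ((Φ.a s - Φ.b s) / 2) ^ 2 + Φ.γ s ^ 2 * (Φ.n₁ * Φ.n₃ * (Φ.n₂ * Φ.n₃))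

theorem disc_nonneg (Φ : PetrovFrame g p) (s : ℝ) : 0 ≤ Φ.disc s := by
  have h1 := Φ.n₁_pos
  have h2 := Φ.n₂_pos
  have h3 := Φ.n₃_pos
  unfold disc
  positivity

/-- The first basis form is an eigenform for 2λ. The remaining block has the trace 2a + 2b = -2λ, so
its characteristic equation, completed to a square, is (μ + λ)² = 4 `disc`. -/
theorem mem_weylEigenvalues_iff (Φ : PetrovFrame g p) {s : ℝ} (hs : s = 1 ∨ s = -1) (μ : ℝ) :
    μ ∈ weylEigenvalues g p s ↔ μ = 2 * Φ.lam s ∨ (μ + Φ.lam s) ^ 2 = 4 * Φ.disc s := by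
  have hN1 := mul_pos Φ.n₁_pos Φ.n₃_pos
  have hN2 := mul_pos Φ.n₂_pos Φ.n₃_pos
  have hdet : (μ + Φ.lam s) ^ 2 - 4 * Φ.disc s = (2 * Φ.a s - μ) * (2 * Φ.b s - μ)
      - 4 * Φ.γ s ^ 2 * (Φ.n₁ * Φ.n₃ * (Φ.n₂ * Φ.n₃)) := by
    have h : Φ.lam s = -Φ.a s - Φ.b s := by linarith [Φ.trace s]
    rw [h, disc]
    ring
  rw [Φ.mem_weylEigenvalues hs, ← sub_eq_zero (a := (μ + Φ.lam s) ^ 2), hdet]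
  constructor
  · rintro ⟨z₁, z₂, z₃, hz, e1, e2, e3⟩
    by_cases h : z₁ = 0
    · right
      have d2 : ((2 * Φ.a s - μ) * (2 * Φ.b s - μ)
          - 4 * Φ.γ s ^ 2 * (Φ.n₁ * Φ.n₃ * (Φ.n₂ * Φ.n₃))) * z₂ = 0 := by
        linear_combination (2 * Φ.b s - μ) * e2 - 2 * Φ.γ s * (Φ.n₂ * Φ.n₃) * e3
      have d3 : ((2 * Φ.a s - μ) * (2 * Φ.b s - μ)
          - 4 * Φ.γ s ^ 2 * (Φ.n₁ * Φ.n₃ * (Φ.n₂ * Φ.n₃))) * z₃ = 0 := by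
        linear_combination (2 * Φ.a s - μ) * e3 - 2 * Φ.γ s * (Φ.n₁ * Φ.n₃) * e2
      rcases hz with hz | hz | hz
      · exact absurd h hz
      · exact (mul_eq_zero.mp d2).resolve_right hz
      · exact (mul_eq_zero.mp d3).resolve_right hz
    · left
      exact (mul_right_cancel₀ h e1).symm
  · rintro (rfl | h)
    · exact ⟨1, 0, 0, Or.inl one_ne_zero, by ring, by ring, by ring⟩
    · by_cases hγ : Φ.γ s = 0
      · rw [hγ] at h ⊢
        rcases mul_eq_zero.mp (by linear_combination h : (2 * Φ.a s - μ) * (2 * Φ.b s - μ) = 0)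
          with h | h
        · exact ⟨0, 1, 0, Or.inr (Or.inl one_ne_zero), by ring, by linear_combination h, by ring⟩
        · exact ⟨0, 0, 1, Or.inr (Or.inr one_ne_zero), by ring, by ring, by linear_combination h⟩
      -- This vector solves the first equation of the block identically and the second by the
      -- characteristic equation; γ ≠ 0 makes it nonzero.
      · refine ⟨0, 2 * Φ.γ s * (Φ.n₂ * Φ.n₃), μ - 2 * Φ.a s,
          Or.inr (Or.inl (mul_ne_zero (mul_ne_zero two_ne_zero hγ) hN2.ne')), by ring, by ring, ?_⟩
        linear_combination -h

theorem isTypeO (Φ : PetrovFrame g p) {s : ℝ} (hs : s = 1 ∨ s = -1) (hl : Φ.lam s = 0)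
    (hd : Φ.disc s = 0) : IsTypeO g p s := by
  rw [IsTypeO, Set.ncard_eq_one]
  refine ⟨0, Set.ext fun μ => ?_⟩
  rw [Φ.mem_weylEigenvalues_iff hs, hl, hd]
  simp

/-- The block has the eigenvalues -λ ± 3λ, and one of them repeats the simple eigenvalue 2λ. -/
theorem isTypeD (Φ : PetrovFrame g p) {s : ℝ} (hs : s = 1 ∨ s = -1) (hl : Φ.lam s ≠ 0)
    (hd : 4 * Φ.disc s = 9 * Φ.lam s ^ 2) : IsTypeD g p s := by
  have : weylEigenvalues g p s = {2 * Φ.lam s, -4 * Φ.lam s} := by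
    ext μ
    rw [Φ.mem_weylEigenvalues_iff hs, hd, Set.mem_insert_iff, Set.mem_singleton_iff]
    constructor
    · rintro (h | h)
      · exact Or.inl h
      · rcases mul_eq_zero.mp (by linear_combination h :
          (μ - 2 * Φ.lam s) * (μ + 4 * Φ.lam s) = 0) with h | h
        · exact Or.inl (by linarith)
        · exact Or.inr (by linarith)
    · rintro (rfl | rfl)
      · exact Or.inl rfl
      · exact Or.inr (by ring)
  rw [IsTypeD, this, Set.ncard_pair]
  intro h
  exact hl (by linarith)

/-- The eigenvalues -λ ± 2r with r² = `disc` are distinct for r ≠ 0, and one of them equals 2λ only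
if 2r = ±3λ. -/
theorem isTypeI (Φ : PetrovFrame g p) {s : ℝ} (hs : s = 1 ∨ s = -1) (h0 : Φ.disc s ≠ 0)
    (hd : 4 * Φ.disc s ≠ 9 * Φ.lam s ^ 2) : IsTypeI g p s := by
  have hpos : 0 < Φ.disc s := lt_of_le_of_ne (Φ.disc_nonneg s) h0.symm
  obtain ⟨r, hr, hr2⟩ : ∃ r, 0 < r ∧ Φ.disc s = r ^ 2 :=
    ⟨√(Φ.disc s), Real.sqrt_pos.mpr hpos, (Real.sq_sqrt hpos.le).symm⟩
  rw [hr2] at hd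
  have : weylEigenvalues g p s
      = {2 * Φ.lam s, -Φ.lam s + 2 * r, -Φ.lam s - 2 * r} := by
    ext μ
    rw [Φ.mem_weylEigenvalues_iff hs, hr2, Set.mem_insert_iff, Set.mem_insert_iff,
      Set.mem_singleton_iff]
    refine or_congr_right ⟨fun h => ?_, ?_⟩
    · rcases mul_eq_zero.mp (by linear_combination h :
        (μ + Φ.lam s - 2 * r) * (μ + Φ.lam s + 2 * r) = 0) with h | h
      · exact Or.inl (by linarith)
      · exact Or.inr (by linarith)
    · rintro (rfl | rfl) <;> ring
  rw [IsTypeI, this]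
  refine Set.ncard_eq_three.mpr ⟨_, _, _, ?_, ?_, ?_, rfl⟩
  · intro h
    exact hd (by rw [show Φ.lam s = 2 * r / 3 by linarith]; ring)
  · intro h
    exact hd (by rw [show Φ.lam s = -(2 * r / 3) by linarith]; ring)
  · intro h
    linarith

/-! ### Weyl scalars in a Killing tetrad -/

/-- The bilinear extension of a matrix to complex vectors. -/
def cform (B : Matrix (Fin 4) (Fin 4) ℝ) (u v : Fin 4 → ℂ) : ℂ := ∑ a, ∑ b, (B a b : ℂ) * u a * v b

theorem cform_mul_cform (B B' : Matrix (Fin 4) (Fin 4) ℝ) (u v w z : Fin 4 → ℂ) :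
    cform B u v * cform B' w z
      = ∑ a, ∑ b, ∑ c, ∑ d, (B a b : ℂ) * u a * v b * ((B' c d : ℂ) * w c * z d) := by
  rw [cform, Finset.sum_mul]
  refine Finset.sum_congr rfl fun a _ => ?_
  rw [Finset.sum_mul]
  refine Finset.sum_congr rfl fun b _ => ?_
  rw [cform, Finset.mul_sum]
  refine Finset.sum_congr rfl fun c _ => ?_
  rw [Finset.mul_sum]

/-- The (anti-)self-dual Weyl tensor on complex vectors. -/
def partC (Φ : PetrovFrame g p) (u v w z : Fin 4 → ℂ) (s : ℝ) : ℂ :=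
  ((Φ.lam s / (Φ.n₁ * Φ.n₂) : ℝ) : ℂ)
      * (cform (sdForm₁ Φ.n₁ Φ.n₂ Φ.κ s) u v * cform (sdForm₁ Φ.n₁ Φ.n₂ Φ.κ s) w z)
    + ((Φ.a s / (Φ.n₁ * Φ.n₃) : ℝ) : ℂ)
      * (cform (sdForm₂ Φ.n₁ Φ.n₃ Φ.κ Φ.q s) u v * cform (sdForm₂ Φ.n₁ Φ.n₃ Φ.κ Φ.q s) w z)
    + ((Φ.b s / (Φ.n₂ * Φ.n₃) : ℝ) : ℂ)
      * (cform (sdForm₃ Φ.n₂ Φ.n₃ Φ.κ Φ.q s) u v * cform (sdForm₃ Φ.n₂ Φ.n₃ Φ.κ Φ.q s) w z)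
    + (Φ.γ s : ℂ)
      * (cform (sdForm₂ Φ.n₁ Φ.n₃ Φ.κ Φ.q s) u v * cform (sdForm₃ Φ.n₂ Φ.n₃ Φ.κ Φ.q s) w z
        + cform (sdForm₃ Φ.n₂ Φ.n₃ Φ.κ Φ.q s) u v * cform (sdForm₂ Φ.n₁ Φ.n₃ Φ.κ Φ.q s) w z)

theorem weylC_eq (Φ : PetrovFrame g p) (u v w z : Fin 4 → ℂ) :
    weylC g p u v w z = (Φ.partC u v w z 1 + Φ.partC u v w z (-1)) / 2 := by
  have key : ∀ s, Φ.partC u v w z s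
      = ∑ a, ∑ b, ∑ c, ∑ d, (Φ.part s a b c d : ℂ) * u a * v b * w c * z d := by
    intro s
    simp only [partC, cform_mul_cform, Finset.mul_sum, ← Finset.sum_add_distrib]
    refine Finset.sum_congr rfl fun a _ => Finset.sum_congr rfl fun b _ =>
      Finset.sum_congr rfl fun c _ => Finset.sum_congr rfl fun d _ => ?_
    simp only [PetrovData.part]
    push_cast
    ring
  simp only [key, weylC, Φ.weyl_eq, Φ.riemann_eq, ← Finset.sum_add_distrib, Finset.sum_div]
  refine Finset.sum_congr rfl fun a _ => Finset.sum_congr rfl fun b _ =>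
    Finset.sum_congr rfl fun c _ => Finset.sum_congr rfl fun d _ => ?_
  push_cast
  ring

/-- The Weyl scalars in a Killing tetrad `L = (e₃ ± i e₄) / √2`, `M = (i e₁ - e₂) / √2`; the
vectors `eᵢ` of the orthonormal frame have the lengths `rᵢ` in the adapted frame. -/
theorem weylC_tetrad (Φ : PetrovFrame g p) {r₁ r₂ r₃ c : ℝ} (h₁ : Φ.n₁ = r₁ ^ 2)
    (h₂ : Φ.n₂ = r₂ ^ 2) (h₃ : Φ.n₃ = r₃ ^ 2) (hc : c ^ 2 = 1 / 2) {l m n k : Fin 4 → ℂ}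
    (hl : l = ![0, 0, (c : ℂ) * ((1 / r₃ : ℝ) - Complex.I * (r₁ * r₂ * r₃ / Φ.κ : ℝ) * Φ.q),
      c * (Complex.I * (r₁ * r₂ * r₃ / Φ.κ : ℝ))])
    (hn : n = ![0, 0, (c : ℂ) * ((1 / r₃ : ℝ) + Complex.I * (r₁ * r₂ * r₃ / Φ.κ : ℝ) * Φ.q),
      -c * (Complex.I * (r₁ * r₂ * r₃ / Φ.κ : ℝ))])
    (hm : m = ![Complex.I * (c / r₁ : ℝ), -(c / r₂ : ℝ), 0, 0])
    (hk : k = ![Complex.I * (c / r₁ : ℝ), (c / r₂ : ℝ), 0, 0]) :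
    weylC g p l m n k = ((Φ.lam 1 / 2 : ℝ) : ℂ) ∧
      weylC g p l m m l = (((Φ.a 1 - Φ.b 1) / 2 : ℝ) : ℂ)
        + Complex.I * (Φ.γ 1 * (r₁ * r₃ * (r₂ * r₃)) : ℝ) := by
  have p1 := Φ.n₁_pos
  have p2 := Φ.n₂_pos
  have p3 := Φ.n₃_pos
  have h4 := Φ.κ_pos.ne'
  have g1 : r₁ ≠ 0 := by rintro rfl; simp [h₁] at p1
  have g2 : r₂ ≠ 0 := by rintro rfl; simp [h₂] at p2
  have g3 : r₃ ≠ 0 := by rintro rfl; simp [h₃] at p3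
  have hcc : (c : ℂ) ^ 2 = 1 / 2 := by rw [← Complex.ofReal_pow, hc]; norm_num
  have g1c : (r₁ : ℂ) ≠ 0 := by exact_mod_cast g1
  have g2c : (r₂ : ℂ) ≠ 0 := by exact_mod_cast g2
  have g3c : (r₃ : ℂ) ≠ 0 := by exact_mod_cast g3
  have h4c : (Φ.κ : ℂ) ≠ 0 := by exact_mod_cast h4
  have hI : Complex.I ^ 2 = -1 := Complex.I_sq
  -- The first basis form has no components that mix the orbit space with the Killing directions, so
  -- it does not see the pairs l, m.
  have f1 : ∀ s u v, u 0 = 0 → u 1 = 0 → v 2 = 0 → v 3 = 0 →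
      cform (sdForm₁ Φ.n₁ Φ.n₂ Φ.κ s) u v = 0 ∧ cform (sdForm₁ Φ.n₁ Φ.n₂ Φ.κ s) v u = 0 := by
    intro s u v e0 e1 e2 e3
    constructor <;> simp [cform, Fin.sum_univ_four, sdForm₁, skew, e0, e1, e2, e3]
  -- The factor 1 + s shows that l ∧ m and n ∧ k are self-dual: only W⁺ enters these Weyl scalars.
  have f2 : ∀ s, cform (sdForm₂ Φ.n₁ Φ.n₃ Φ.κ Φ.q s) l m
      = -(Complex.I / 2) * (r₁ * r₃) * (1 + s) := by
    intro s
    simp [cform, Fin.sum_univ_four, sdForm₂, skew, hl, hm, h₁, h₃]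
    field_simp
    linear_combination (-2 * (Φ.κ : ℂ) * (1 + s)) * hcc
  have f3 : ∀ s, cform (sdForm₃ Φ.n₂ Φ.n₃ Φ.κ Φ.q s) l m = 1 / 2 * (r₂ * r₃) * (1 + s) := by
    intro s
    simp [cform, Fin.sum_univ_four, sdForm₃, skew, hl, hm, h₂, h₃]
    field_simp
    linear_combination (2 * (Φ.κ : ℂ) * (1 + s)) * hcc - 2 * (c : ℂ) ^ 2 * Φ.κ * s * hI
  have f2' : ∀ s, cform (sdForm₂ Φ.n₁ Φ.n₃ Φ.κ Φ.q s) n k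
      = -(Complex.I / 2) * (r₁ * r₃) * (1 + s) := by
    intro s
    simp [cform, Fin.sum_univ_four, sdForm₂, skew, hn, hk, h₁, h₃]
    field_simp
    linear_combination (-2 * (Φ.κ : ℂ) * (1 + s)) * hcc
  have f3' : ∀ s, cform (sdForm₃ Φ.n₂ Φ.n₃ Φ.κ Φ.q s) n k = -(1 / 2) * (r₂ * r₃) * (1 + s) := by
    intro s
    simp [cform, Fin.sum_univ_four, sdForm₃, skew, hn, hk, h₂, h₃]
    field_simp
    linear_combination (-2 * (Φ.κ : ℂ) * (1 + s)) * hcc + 2 * (c : ℂ) ^ 2 * Φ.κ * s * hI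
  have anti : ∀ a b c d e f u v, cform (skew a b c d e f) v u = -cform (skew a b c d e f) u v := by
    intro a b c d e f u v
    simp [cform, Fin.sum_univ_four, skew]
    ring
  have hb : Φ.b 1 = -Φ.lam 1 - Φ.a 1 := by linarith [Φ.trace 1]
  constructor
  · rw [Φ.weylC_eq]
    simp only [partC, f2, f3, f2', f3', (f1 _ l m (by simp [hl]) (by simp [hl]) (by simp [hm])
      (by simp [hm])).1]
    rw [h₁, h₂, h₃, hb]
    push_cast
    field_simp
    linear_combination 4 * (r₁ : ℂ) ^ 2 * r₂ ^ 2 * Φ.a 1 * hI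
  · have f2'' : ∀ s, cform (sdForm₂ Φ.n₁ Φ.n₃ Φ.κ Φ.q s) m l
        = -(-(Complex.I / 2) * (r₁ * r₃) * (1 + s)) := fun s => by rw [← f2, sdForm₂, anti]
    have f3'' : ∀ s, cform (sdForm₃ Φ.n₂ Φ.n₃ Φ.κ Φ.q s) m l
        = -(1 / 2 * (r₂ * r₃) * (1 + s)) := fun s => by rw [← f3, sdForm₃, anti]
    rw [Φ.weylC_eq]
    simp only [partC, f2, f3, f2'', f3'', (f1 _ l m (by simp [hl]) (by simp [hl]) (by simp [hm])
      (by simp [hm])).1]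
    rw [h₁, h₂, h₃]
    push_cast
    field_simp
    linear_combination -4 * (r₁ : ℂ) ^ 2 * r₂ ^ 2 * Φ.a 1 * hI

end PetrovFrame

/-! ### From a stationary vacuum metric to its Petrov frame -/

theorem christoffel_congr {g g' : MetricField} {p : Pt} (h : g =ᶠ[nhds p] g') (i j k : Fin 4) :
    christoffel g i j k p = christoffel g' i j k p := by
  have e : ∀ m a b, pd m (fun q => g q a b) p = pd m (fun q => g' q a b) p := fun m a b => by
    refine Filter.EventuallyEq.lineDeriv_eq ?_
    filter_upwards [h] with q hq using by rw [hq]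
  simp only [christoffel, e, h.self_of_nhds]

/-- The coordinate metric agrees with the metric of the frame only on the open set `U`; curvature is
local. -/
theorem riemann_congr {g g' : MetricField} {p : Pt} (h : g =ᶠ[nhds p] g') (i j k l : Fin 4) :
    riemann g p i j k l = riemann g' p i j k l := by
  have e : ∀ m a b c, pd m (christoffel g a b c) p = pd m (christoffel g' a b c) p :=
    fun m a b c => by
      refine Filter.EventuallyEq.lineDeriv_eq ?_
      filter_upwards [eventually_eventually_nhds.mpr h] with q hq using christoffel_congr hq a b c
  simp only [riemann, riemannUp, e, h.self_of_nhds, fun a b c => christoffel_congr h a b c]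

theorem shear_skew (q a b c d e f : ℝ) :
    (shear q)ᵀ * skew a b c d e f * shear q = skew a b (c + q * b) d (e + q * d) f := by
  ext i j
  fin_cases i <;> fin_cases j <;>
    simp [skew, shear, shearGen_apply, Matrix.mul_apply, Fin.sum_univ_four, Matrix.one_apply] <;>
    ring

theorem skew_add_smul (q a b c d e f a' b' c' d' e' f' : ℝ) :
    skew a b c d e f + q • skew a' b' c' d' e' f' = skew (a + q * a') (b + q * b') (c + q * c')
      (d + q * d') (e + q * e') (f + q * f') := by
  ext i j
  fin_cases i <;> fin_cases j <;> simp [skew] <;> ring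

/-- With the second index pair fixed, the tensor is a 2-form in the first pair and can be compared
with one curvature matrix at a time. -/
theorem PetrovData.part_eq_skew (Φ : PetrovData) (s : ℝ) (hn : Φ.n₁ ≠ 0) (hn2 : Φ.n₂ ≠ 0)
    (hn3 : Φ.n₃ ≠ 0) {β₁ β₂ β₃ : ℝ} (k l : Fin 4)
    (h₁ : sdForm₁ Φ.n₁ Φ.n₂ Φ.κ s k l = β₁) (h₂ : sdForm₂ Φ.n₁ Φ.n₃ Φ.κ Φ.q s k l = β₂)
    (h₃ : sdForm₃ Φ.n₂ Φ.n₃ Φ.κ Φ.q s k l = β₃) (i j : Fin 4) :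
    Φ.part s i j k l = skew (Φ.lam s * β₁) (Φ.a s * β₂ + Φ.γ s * (Φ.n₁ * Φ.n₃) * β₃)
      (Φ.q * (Φ.a s * β₂ + Φ.γ s * (Φ.n₁ * Φ.n₃) * β₃)
        + s * Φ.κ * (Φ.b s / (Φ.n₂ * Φ.n₃) * β₃ + Φ.γ s * β₂))
      (Φ.b s * β₃ + Φ.γ s * (Φ.n₂ * Φ.n₃) * β₂)
      (Φ.q * (Φ.b s * β₃ + Φ.γ s * (Φ.n₂ * Φ.n₃) * β₂)
        - s * Φ.κ * (Φ.a s / (Φ.n₁ * Φ.n₃) * β₂ + Φ.γ s * β₃))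
      (s * Φ.κ * (Φ.lam s / (Φ.n₁ * Φ.n₂) * β₁)) i j := by
  rw [PetrovData.part, h₁, h₂, h₃]
  fin_cases i <;> fin_cases j <;> simp [sdForm₁, sdForm₂, sdForm₃, skew] <;> field_simp <;> ring

theorem PetrovData.part_swap (Φ : PetrovData) (s : ℝ) (i j k l : Fin 4) :
    Φ.part s i j l k = -Φ.part s i j k l := by
  have h : ∀ a b c d e f, skew a b c d e f l k = -skew a b c d e f k l := by
    intro a b c d e f
    fin_cases k <;> fin_cases l <;> simp [skew]
  simp only [PetrovData.part, sdForm₁, sdForm₂, sdForm₃, h]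
  ring

namespace ShearFrame

variable {U : Set Pt} (Φ : ShearFrame U)

theorem curv_swap (k l : Fin 4) (p : Pt) : Φ.curv l k p = -Φ.curv k l p := by
  unfold curv
  abel

theorem curv_zero_one (p : Pt) : Φ.curv 0 1 p
    = Φ.Ayx p - Φ.Axy p + (Φ.Ax p * Φ.Ay p - Φ.Ay p * Φ.Ax p) := rfl

theorem curv_zero_two (p : Pt) : Φ.curv 0 2 p
    = Φ.Atx p + (Φ.Ax p * Φ.At p - Φ.At p * Φ.Ax p) := by
  change Φ.Atx p - 0 + _ = _
  rw [sub_zero]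
  rfl

theorem curv_one_two (p : Pt) : Φ.curv 1 2 p
    = Φ.Aty p + (Φ.Ay p * Φ.At p - Φ.At p * Φ.Ay p) := by
  change Φ.Aty p - 0 + _ = _
  rw [sub_zero]
  rfl

theorem curv_zero_three (p : Pt) : Φ.curv 0 3 p
    = Φ.Apx p + Φ.qx p • Φ.At p + (Φ.Ax p * Φ.Ap p - Φ.Ap p * Φ.Ax p)
      + Φ.q p • (Φ.Atx p + (Φ.Ax p * Φ.At p - Φ.At p * Φ.Ax p)) := by
  change (Φ.Apx p + Φ.qx p • Φ.At p + Φ.q p • Φ.Atx p) - 0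
    + (Φ.Ax p * (Φ.Ap p + Φ.q p • Φ.At p) - (Φ.Ap p + Φ.q p • Φ.At p) * Φ.Ax p) = _
  simp only [mul_add, add_mul, Matrix.mul_smul, Matrix.smul_mul, smul_add, smul_sub, sub_zero]
  abel

theorem curv_one_three (p : Pt) : Φ.curv 1 3 p
    = Φ.Apy p + Φ.qy p • Φ.At p + (Φ.Ay p * Φ.Ap p - Φ.Ap p * Φ.Ay p)
      + Φ.q p • (Φ.Aty p + (Φ.Ay p * Φ.At p - Φ.At p * Φ.Ay p)) := by
  change (Φ.Apy p + Φ.qy p • Φ.At p + Φ.q p • Φ.Aty p) - 0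
    + (Φ.Ay p * (Φ.Ap p + Φ.q p • Φ.At p) - (Φ.Ap p + Φ.q p • Φ.At p) * Φ.Ay p) = _
  simp only [mul_add, add_mul, Matrix.mul_smul, Matrix.smul_mul, smul_add, smul_sub, sub_zero]
  abel

theorem curv_two_three (p : Pt) : Φ.curv 2 3 p = Φ.At p * Φ.Ap p - Φ.Ap p * Φ.At p := by
  change (0 : Matrix (Fin 4) (Fin 4) ℝ) - 0
    + (Φ.At p * (Φ.Ap p + Φ.q p • Φ.At p) - (Φ.Ap p + Φ.q p • Φ.At p) * Φ.At p) = _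
  simp only [mul_add, add_mul, Matrix.mul_smul, Matrix.smul_mul, sub_zero]
  abel

end ShearFrame

namespace Stationary

variable {U : Set Pt} (S : Stationary U)

/-- The Weyl tensor of a vacuum metric in the adapted frame. -/
def petrovData (p : Pt) : PetrovData where
  n₁ := (S.J p).L / (S.J p).X
  n₂ := -(S.J p).L / (S.J p).Y
  n₃ := (S.J p).f
  κ := (S.J p).L / (S.J p).D ^ 2
  q := S.q p
  lam := (S.J p).lam
  a := (S.J p).wa
  b := (S.J p).wb
  γ s := s * (S.J p).wc s * (-((S.J p).X * (S.J p).Y)) / ((S.J p).L * (S.J p).f)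

theorem riemann_metric (hU : IsOpen U) {p : Pt} (hp : p ∈ U) (i j k l : Fin 4) :
    riemann S.metric p i j k l = ((shear (S.q p))ᵀ * (jval S.mη p * S.frame.curv k l p)
      * shear (S.q p)) i j := by
  rw [← riemann_congr (g := S.frame.metric)]
  · exact S.frame.riemann_eq hU hp i j k l
  · filter_upwards [hU.mem_nhds hp] with r hr using S.frame_metric hr

/-- By antisymmetry six pairs k < l suffice. As ∂_φ is the fourth frame vector plus q ∂_τ, the pairs
(x, φ) and (y, φ) add q times the τ curvature to the frame curvature. -/
theorem riemann_eq_part (hU : IsOpen U) {p : Pt} (hp : p ∈ U) (hv : (S.J p).IsVacuum)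
    (i j k l : Fin 4) : riemann S.metric p i j k l
      = ((S.petrovData p).part 1 i j k l + (S.petrovData p).part (-1) i j k l) / 2 := by
  rw [S.riemann_metric hU hp]
  have hX := (S.X_pos p hp).ne'
  have hY := (S.Y_neg p hp).ne
  have hL := (S.L_pos p hp).ne'
  have hf := (S.f_pos p hp).ne'
  have hD := (S.D_pos p hp).ne'
  have hn1 : (S.petrovData p).n₁ ≠ 0 := div_ne_zero hL hX
  have hn2 : (S.petrovData p).n₂ ≠ 0 := div_ne_zero (neg_ne_zero.mpr hL) hY
  have hn3 : (S.petrovData p).n₃ ≠ 0 := hf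
  suffices H : ∀ k l, k < l → ∀ i j, ((shear (S.q p))ᵀ * (jval S.mη p * S.frame.curv k l p)
      * shear (S.q p)) i j
      = ((S.petrovData p).part 1 i j k l + (S.petrovData p).part (-1) i j k l) / 2 by
    rcases lt_trichotomy k l with h | rfl | h
    · exact H k l h i j
    · have e1 : S.frame.curv k k p = 0 := by simp [ShearFrame.curv]
      have e2 : ∀ s, (S.petrovData p).part s i j k k = 0 := fun s => by
        linarith [(S.petrovData p).part_swap s i j k k]
      rw [e1, e2, e2]
      simp
    · rw [ShearFrame.curv_swap, PetrovData.part_swap, PetrovData.part_swap _ _ _ _ l k, Matrix.mul_neg,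
        Matrix.mul_neg, Matrix.neg_mul, Matrix.neg_apply, H l k h]
      ring
  have hxt := S.curvature_xt hp hv
  have hyt := S.curvature_yt hp hv
  intro k l hkl i j
  rw [(S.petrovData p).part_eq_skew 1 hn1 hn2 hn3 k l rfl rfl rfl,
    (S.petrovData p).part_eq_skew (-1) hn1 hn2 hn3 k l rfl rfl rfl]
  have fin : ∀ {a b c d e f a₁ b₁ c₁ d₁ e₁ f₁ a₂ b₂ c₂ d₂ e₂ f₂ : ℝ}, a = (a₁ + a₂) / 2 →
      b = (b₁ + b₂) / 2 → c = (c₁ + c₂) / 2 → d = (d₁ + d₂) / 2 → e = (e₁ + e₂) / 2 →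
      f = (f₁ + f₂) / 2 → skew a b c d e f i j
        = (skew a₁ b₁ c₁ d₁ e₁ f₁ i j + skew a₂ b₂ c₂ d₂ e₂ f₂ i j) / 2 := by
    rintro a b c d e f a₁ b₁ c₁ d₁ e₁ f₁ a₂ b₂ c₂ d₂ e₂ f₂ rfl rfl rfl rfl rfl rfl
    fin_cases i <;> fin_cases j <;> simp [skew] <;> ring
  have cases6 : (k = 0 ∧ l = 1) ∨ (k = 0 ∧ l = 2) ∨ (k = 0 ∧ l = 3) ∨ (k = 1 ∧ l = 2)
      ∨ (k = 1 ∧ l = 3) ∨ (k = 2 ∧ l = 3) := by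
    decide +revert
  rcases cases6 with ⟨rfl, rfl⟩ | ⟨rfl, rfl⟩ | ⟨rfl, rfl⟩ | ⟨rfl, rfl⟩ | ⟨rfl, rfl⟩ | ⟨rfl, rfl⟩
  · rw [ShearFrame.curv_zero_one]
    change ((shear (S.q p))ᵀ * (jval S.mη p * (jdx S.mAy p - jdy S.mAx p
      + (jval S.mAx p * jval S.mAy p - jval S.mAy p * jval S.mAx p))) * shear (S.q p)) i j = _
    rw [S.curvature_xy hp hv, shear_skew]
    apply fin <;> simp [sdForm₁, sdForm₂, sdForm₃, skew, petrovData, StationaryJet.r1212,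
      StationaryJet.r1234, StationaryJet.n1, StationaryJet.n2] <;> field_simp <;> ring
  · rw [ShearFrame.curv_zero_two]
    change ((shear (S.q p))ᵀ * (jval S.mη p * (jdx S.mAt p
      + (jval S.mAx p * jval S.mAt p - jval S.mAt p * jval S.mAx p))) * shear (S.q p)) i j = _
    rw [hxt, shear_skew]
    apply fin <;> simp [sdForm₁, sdForm₂, sdForm₃, skew, petrovData, StationaryJet.r1313,
      StationaryJet.r1314, StationaryJet.r1323, StationaryJet.r1324, StationaryJet.n1,
      StationaryJet.n2, StationaryJet.n3] <;> field_simp <;> ring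
  · rw [ShearFrame.curv_zero_three, Matrix.mul_add (jval S.mη p), Matrix.mul_smul]
    change ((shear (S.q p))ᵀ * (jval S.mη p * (jdx S.mAp p + S.jqx.val p • jval S.mAt p
      + (jval S.mAx p * jval S.mAp p - jval S.mAp p * jval S.mAx p)) + S.q p •
      (jval S.mη p * (jdx S.mAt p
      + (jval S.mAx p * jval S.mAt p - jval S.mAt p * jval S.mAx p)))) * shear (S.q p)) i j = _
    rw [hxt, S.curvature_xp hp hv, skew_add_smul, shear_skew]
    apply fin <;> simp [sdForm₁, sdForm₂, sdForm₃, skew, petrovData, StationaryJet.r1313,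
      StationaryJet.r1314, StationaryJet.r1323, StationaryJet.r1324, StationaryJet.r1414,
      StationaryJet.r1423, StationaryJet.r2414, StationaryJet.n1,
      StationaryJet.n2, StationaryJet.n3, StationaryJet.n4] <;> field_simp <;> ring
  · rw [ShearFrame.curv_one_two]
    change ((shear (S.q p))ᵀ * (jval S.mη p * (jdy S.mAt p
      + (jval S.mAy p * jval S.mAt p - jval S.mAt p * jval S.mAy p))) * shear (S.q p)) i j = _
    rw [hyt, shear_skew]
    apply fin <;> simp [sdForm₁, sdForm₂, sdForm₃, skew, petrovData, StationaryJet.r1323,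
      StationaryJet.r1423, StationaryJet.r2323, StationaryJet.r2423, StationaryJet.n1,
      StationaryJet.n2, StationaryJet.n3] <;> field_simp <;> ring
  · rw [ShearFrame.curv_one_three, Matrix.mul_add (jval S.mη p), Matrix.mul_smul]
    change ((shear (S.q p))ᵀ * (jval S.mη p * (jdy S.mAp p + S.jqy.val p • jval S.mAt p
      + (jval S.mAy p * jval S.mAp p - jval S.mAp p * jval S.mAy p)) + S.q p •
      (jval S.mη p * (jdy S.mAt p
      + (jval S.mAy p * jval S.mAt p - jval S.mAt p * jval S.mAy p)))) * shear (S.q p)) i j = _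
    rw [hyt, S.curvature_yp hp hv, skew_add_smul, shear_skew]
    apply fin <;> simp [sdForm₁, sdForm₂, sdForm₃, skew, petrovData, StationaryJet.r1323,
      StationaryJet.r1324, StationaryJet.r2323, StationaryJet.r2424, StationaryJet.r2414,
      StationaryJet.r1423, StationaryJet.r2423, StationaryJet.n1,
      StationaryJet.n2, StationaryJet.n3, StationaryJet.n4] <;> field_simp <;> ring
  · rw [ShearFrame.curv_two_three]
    change ((shear (S.q p))ᵀ * (jval S.mη p * (jval S.mAt p * jval S.mAp p
      - jval S.mAp p * jval S.mAt p)) * shear (S.q p)) i j = _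
    rw [S.curvature_tp hp hv, shear_skew]
    apply fin <;> simp [sdForm₁, sdForm₂, sdForm₃, skew, petrovData, StationaryJet.r3434,
      StationaryJet.r1234, StationaryJet.n3, StationaryJet.n4] <;> field_simp <;> ring

/-- A metric which agrees with a stationary vacuum metric near a point has the Petrov frame of
the latter. -/
def petrovFrame {g : MetricField} (hU : IsOpen U) (hg : ∀ r ∈ U, g r = S.metric r) {p : Pt}
    (hp : p ∈ U) (hv : (S.J p).IsVacuum) : PetrovFrame g p where
  toPetrovData := S.petrovData p
  n₁_pos := div_pos (S.L_pos p hp) (S.X_pos p hp)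
  n₂_pos := div_pos_of_neg_of_neg (neg_neg_of_pos (S.L_pos p hp)) (S.Y_neg p hp)
  n₃_pos := S.f_pos p hp
  κ_pos := div_pos (S.L_pos p hp) (pow_pos (S.D_pos p hp) 2)
  trace s := by
    simp only [petrovData, StationaryJet.wa, StationaryJet.wb]
    ring
  metric_eq := by
    have hX := (S.X_pos p hp).ne'
    have hY := (S.Y_neg p hp).ne
    have hL := (S.L_pos p hp).ne'
    have hf := (S.f_pos p hp).ne'
    have hD := (S.D_pos p hp).ne'
    rw [hg p hp]
    simp only [metric, shearMetric, petrovData]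
    congr! 6
    field_simp
    ring
  riemann_eq i j k l := by
    rw [← S.riemann_eq_part hU hp hv, riemann_congr]
    filter_upwards [hU.mem_nhds hp] with r hr using hg r hr

end Stationary

/-! ### Polynomial identities behind the Chen–Teo metric -/

/-- A point `(x, y)` together with the symmetric coefficients of the quartic there: the quartic is
`T + x S + b x²` at `x` and `T + y S + b y²` at `y`. -/
structure QuarticPoint where
  (k ν x y S T b c a₄ : ℝ)

namespace QuarticPoint

variable (Q : QuarticPoint)

/-- At a given point, (S, T, b, c, a₄) is a linear change of the five coefficients of the quartic.
In it X and Y are linear in S, T, b and arise from each other by exchanging x and y, which keeps the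
identities below small. The suffixes 1, 2 and x, y denote derivatives. -/
def a₃ : ℝ := Q.c - 2 * Q.a₄ * (Q.x + Q.y)
def a₁ : ℝ := Q.S + Q.a₃ * Q.x * Q.y
def a₀ : ℝ := Q.T + Q.a₄ * Q.x ^ 2 * Q.y ^ 2
def D : ℝ := Q.x - Q.y
def X : ℝ := Q.T + Q.x * Q.S + Q.b * Q.x ^ 2
def Y : ℝ := Q.T + Q.y * Q.S + Q.b * Q.y ^ 2
def X1 : ℝ := Q.S + 2 * Q.b * Q.x + Q.x * (Q.x - Q.y) * Q.c
def Y1 : ℝ := Q.S + 2 * Q.b * Q.y - Q.y * (Q.x - Q.y) * Q.c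
def X2 : ℝ := 2 * Q.b + (4 * Q.x - 2 * Q.y) * Q.c + 2 * Q.a₄ * (Q.x - Q.y) ^ 2
def Y2 : ℝ := 2 * Q.b + (4 * Q.y - 2 * Q.x) * Q.c + 2 * Q.a₄ * (Q.x - Q.y) ^ 2
def F : ℝ := Q.X * Q.y ^ 2 - Q.x ^ 2 * Q.Y
def Fx : ℝ := Q.X1 * Q.y ^ 2 - 2 * Q.x * Q.Y
def Fy : ℝ := 2 * Q.X * Q.y - Q.x ^ 2 * Q.Y1
-- `N` and `h` are the two factors of H, and the denominators of the two Ernst potentials.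
def N : ℝ := Q.ν * Q.x + Q.y
def h : ℝ := (Q.ν * Q.x - Q.y) * Q.S - 2 * (1 - Q.ν) * Q.T
def hx : ℝ := Q.ν * Q.S - (Q.ν * Q.x - Q.y) * (Q.a₃ * Q.y)
  + 4 * (1 - Q.ν) * Q.a₄ * Q.x * Q.y ^ 2
def hy : ℝ := -Q.S - (Q.ν * Q.x - Q.y) * (Q.a₃ * Q.x) + 4 * (1 - Q.ν) * Q.a₄ * Q.x ^ 2 * Q.y
def hxx : ℝ := -2 * Q.ν * Q.a₃ * Q.y + 4 * (1 - Q.ν) * Q.a₄ * Q.y ^ 2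
def hxy : ℝ := -2 * (Q.ν * Q.x - Q.y) * Q.a₃ + 8 * (1 - Q.ν) * Q.a₄ * Q.x * Q.y
def hyy : ℝ := 2 * Q.a₃ * Q.x + 4 * (1 - Q.ν) * Q.a₄ * Q.x ^ 2
def A : ℝ := 2 * Q.T + Q.x * Q.S
def Ax : ℝ := Q.S - Q.a₃ * Q.x * Q.y - 4 * Q.a₄ * Q.x * Q.y ^ 2
def Ay : ℝ := -Q.a₃ * Q.x ^ 2 - 4 * Q.a₄ * Q.x ^ 2 * Q.y
def Axx : ℝ := -2 * Q.a₃ * Q.y - 4 * Q.a₄ * Q.y ^ 2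
def Axy : ℝ := -2 * Q.a₃ * Q.x - 8 * Q.a₄ * Q.x * Q.y
def Ayy : ℝ := -4 * Q.a₄ * Q.x ^ 2

/-- The numerators of the derivatives of the Ernst potentials `x / N` and `-A / h`. -/
def m1 : ℝ := Q.A * Q.hx - Q.Ax * Q.h
def m2 : ℝ := Q.A * Q.hy - Q.Ay * Q.h
def m11 : ℝ := (Q.A * Q.hxx - Q.Axx * Q.h) * Q.h - 2 * Q.m1 * Q.hx
def m12 : ℝ := (Q.Ay * Q.hx + Q.A * Q.hxy - Q.Axy * Q.h - Q.Ax * Q.hy) * Q.h - 2 * Q.m1 * Q.hy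
def m22 : ℝ := (Q.A * Q.hyy - Q.Ayy * Q.h) * Q.h - 2 * Q.m2 * Q.hy

def V : ℝ := Q.T * Q.a₃ - 2 * (Q.x * Q.y) * Q.S * Q.a₄
def J : ℝ := Q.T * Q.a₃ ^ 2 - Q.S ^ 2 * Q.a₄ - 2 * Q.S * Q.a₃ * Q.a₄ * (Q.x * Q.y)
def F' : ℝ := (Q.x + Q.y) * Q.T + Q.x * Q.y * Q.S

/-- The quotient by `F` of the numerator of the squared gradient of the potential `-A / h`. -/
def K : ℝ := 4 * Q.D ^ 2 * Q.V ^ 2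
  + 4 * Q.S * Q.V * (2 * (Q.x * Q.y) * Q.b + (Q.x + Q.y) * Q.S + 2 * Q.T) + Q.S ^ 4
  - 4 * Q.S ^ 2 * Q.T * Q.b

/-- The numerator of the simple eigenvalue of the anti-self-dual Weyl tensor. -/
def P : ℝ := (1 - Q.ν) * (4 * (Q.x * Q.y) * Q.V
      * (Q.D ^ 2 * Q.a₄ + (Q.x + Q.y) * Q.a₃ - Q.b)
    + 2 * Q.S * Q.T * (Q.b - (Q.x ^ 2 - 6 * Q.x * Q.y + Q.y ^ 2) * Q.a₄ - (Q.x + Q.y) * Q.a₃)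
    - Q.S ^ 3 / 2 - 4 * Q.T ^ 2 * Q.a₃)
  + Q.J * (Q.y ^ 3 - 6 * Q.x * Q.y ^ 2 - 3 * Q.x ^ 2 * Q.y
    + Q.ν * (3 * Q.x * Q.y ^ 2 + 6 * Q.x ^ 2 * Q.y - Q.x ^ 3))

def B : ℝ := Q.S * Q.T - 2 * (Q.x * Q.y) * Q.V
def g : ℝ := 2 * (Q.x * Q.y) * Q.b * Q.B - 2 * Q.V * ((Q.x + Q.y) * (Q.x * Q.y) * Q.S
    + (Q.x ^ 2 + Q.y ^ 2) * Q.T)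
  - Q.S * (Q.x * Q.y * Q.S ^ 2 + (Q.x + Q.y) * Q.S * Q.T + 2 * Q.T ^ 2)

/-- The numerators of the trace-free Hessian of the potential `-A / h`. -/
def u : ℝ := -3 / 2 * Q.P * (Q.x ^ 2 * Q.Y + Q.y ^ 2 * Q.X)
  + 6 * (1 - Q.ν) * (Q.X * Q.Y * Q.B)
def w : ℝ := -3 * (Q.x * Q.y) * Q.P + 3 * (1 - Q.ν) * Q.g

theorem F_eq : Q.F = -(Q.D * Q.F') := by
  simp only [F, D, F', X, Y]; ring

theorem numerator_sub : Q.x * Q.h - Q.A * Q.N = -2 * Q.F' := by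
  simp only [F', N, h, A]; ring

/-- The squared gradient of -A/h is divisible by F, which compensates for a factor F in the
denominator 1/f² of `lam`. -/
theorem normSq_m : Q.X * Q.m1 ^ 2 - Q.Y * Q.m2 ^ 2 = Q.F * Q.K := by
  simp only [F_eq, F', D, K, X, Y, m1, m2, V, A, Ax, Ay, hx, hy, h, a₃]; ring

theorem ernst_m : (Q.X * Q.m11 - Q.Y * Q.m22) * Q.D
    + Q.h * ((Q.X1 * Q.D - 2 * Q.X) * Q.m1 - (Q.Y1 * Q.D + 2 * Q.Y) * Q.m2)
    = Q.K * Q.N * Q.D ^ 2 := by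
  simp only [N, D, K, X, Y, X1, Y1, m11, m22, m1, m2, V, A, Ax, Ay, hx, hy, h, a₃, hxx, hyy, Axx,
    Ayy]
  ring

theorem ernst_e : (Q.X * (-2 * Q.ν * Q.y) - Q.Y * (2 * Q.x)) * Q.D
    + Q.N * ((Q.X1 * Q.D - 2 * Q.X) * Q.y + (Q.Y1 * Q.D + 2 * Q.Y) * Q.x)
    = Q.h * Q.D ^ 2 := by
  simp only [N, D, X, Y, X1, Y1, h]
  ring

theorem lam_e : Q.h * Q.D ^ 2 - Q.N * ((Q.X1 * Q.D - 4 * Q.X) * Q.y + (Q.Y1 * Q.D + 4 * Q.Y) * Q.x)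
    = 2 * (1 + Q.ν) * Q.F := by
  simp only [N, D, X, Y, X1, Y1, h, F]
  ring

theorem lam_m : Q.N * Q.D ^ 2 * Q.K
    - Q.h * ((Q.X1 * Q.D - 4 * Q.X) * Q.m1 - (Q.Y1 * Q.D + 4 * Q.Y) * Q.m2)
    = 4 * Q.P * Q.F := by
  simp only [F_eq, F', N, D, K, X, Y, X1, Y1, m1, m2, V, A, Ax, Ay, hx, hy, h, P, J, a₃]
  ring

theorem harmonic : Q.X2 * Q.D ^ 2 - 6 * Q.X1 * Q.D + 12 * Q.X
    = Q.Y2 * Q.D ^ 2 + 6 * Q.Y1 * Q.D + 12 * Q.Y := by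
  simp only [D, X, Y, X1, Y1, X2, Y2]
  ring

theorem conf_re : (Q.X1 * Q.D - 4 * Q.X) * (Q.Fx * Q.D - 4 * Q.F) * Q.F
    + (Q.Y1 * Q.D + 4 * Q.Y) * (Q.Fy * Q.D + 4 * Q.F) * Q.F
    = 2 * Q.F ^ 2 * (Q.X2 * Q.D ^ 2 - 6 * Q.X1 * Q.D + 12 * Q.X)
      + (Q.X * Q.y * Q.m1 - Q.Y * Q.x * Q.m2) * Q.D ^ 4 := by
  simp only [F_eq, F', Fx, Fy, D, X, Y, X1, Y1, X2, m1, m2, A, Ax, Ay, hx, hy, h, a₃]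
  ring

theorem conf_im : (Q.X1 * Q.D - 4 * Q.X) * Q.Y * (Q.Fy * Q.D + 4 * Q.F) * Q.F
    + (Q.Y1 * Q.D + 4 * Q.Y) * Q.X * (Q.Fx * Q.D - 4 * Q.F) * Q.F
    = -8 * Q.X * Q.Y * Q.F ^ 2
      + Q.F ^ 2 * (Q.X1 * Q.D - 4 * Q.X) * (Q.Y1 * Q.D + 4 * Q.Y)
      + Q.X * Q.Y * (Q.y * Q.m2 - Q.x * Q.m1) * Q.D ^ 4 := by
  simp only [F_eq, F', Fx, Fy, D, X, Y, X1, Y1, m1, m2, A, Ax, Ay, hx, hy, h, a₃]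
  ring

theorem gauss : 2 * Q.X * (-Q.ν ^ 2 * Q.h ^ 2 * Q.D ^ 2 + Q.hxx * Q.h * Q.N ^ 2 * Q.D ^ 2
      - Q.hx ^ 2 * Q.N ^ 2 * Q.D ^ 2 + 3 * Q.N ^ 2 * Q.h ^ 2)
    + Q.X1 * Q.D * Q.N * Q.h * (Q.ν * Q.h * Q.D + Q.hx * Q.N * Q.D - 3 * Q.N * Q.h)
    - 2 * Q.Y * (-Q.h ^ 2 * Q.D ^ 2 + Q.hyy * Q.h * Q.N ^ 2 * Q.D ^ 2
      - Q.hy ^ 2 * Q.N ^ 2 * Q.D ^ 2 + 3 * Q.N ^ 2 * Q.h ^ 2)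
    - Q.Y1 * Q.D * Q.N * Q.h * (Q.h * Q.D + Q.hy * Q.N * Q.D + 3 * Q.N * Q.h)
    = -((1 + Q.ν) * Q.h ^ 3 * Q.D ^ 2 + 2 * Q.P * Q.N ^ 3 * Q.D ^ 2) := by
  simp only [N, D, X, Y, X1, Y1, hxx, hyy, hx, hy, h, P, J, V, a₃]
  ring

theorem hessRe_e : 2 * Q.D * Q.F * (Q.X * (-2 * Q.ν * Q.y) + Q.Y * (2 * Q.x))
    + Q.D * Q.F * Q.N * (Q.X1 * Q.y - Q.Y1 * Q.x)
    - 2 * Q.N * (Q.X * (Q.Fx * Q.D - 4 * Q.F) * Q.y - Q.Y * (Q.Fy * Q.D + 4 * Q.F) * Q.x)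
    + (Q.X * Q.y ^ 2 + Q.Y * Q.x ^ 2) * Q.h * Q.D ^ 2
    = 6 * (1 + Q.ν) * Q.F * (Q.x ^ 2 * Q.Y + Q.y ^ 2 * Q.X) := by
  simp only [F, Fx, Fy, N, D, X, Y, X1, Y1, h]
  ring

theorem hessIm_e : 2 * Q.D * Q.F * (Q.ν * Q.x - Q.y)
    - Q.N * (-(Q.Fx * Q.D - 4 * Q.F) * Q.x + (Q.Fy * Q.D + 4 * Q.F) * Q.y)
    - Q.x * Q.y * Q.h * Q.D ^ 2 = -6 * (1 + Q.ν) * (Q.x * Q.y) * Q.F := by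
  simp only [F, Fx, Fy, N, D, X, Y, X1, Y1, h]
  ring

theorem hessRe_m : 2 * Q.D * Q.F * (Q.X * Q.m11 + Q.Y * Q.m22)
    + Q.D * Q.F * Q.h * (Q.X1 * Q.m1 + Q.Y1 * Q.m2)
    - 2 * Q.h * (Q.X * (Q.Fx * Q.D - 4 * Q.F) * Q.m1 + Q.Y * (Q.Fy * Q.D + 4 * Q.F) * Q.m2)
    + (Q.X * Q.m1 ^ 2 + Q.Y * Q.m2 ^ 2) * Q.N * Q.D ^ 2
    = -8 * Q.F * Q.u := by
  simp only [F_eq, F', Fx, Fy, N, D, X, Y, X1, Y1, m11, m22, m1, m2, V, A, Ax, Ay, hx, hy, h, a₃,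
    hxx, hyy, Axx, Ayy, u, P, B, J]
  ring

theorem hessIm_m : 2 * Q.D * Q.F * Q.m12
    - Q.h * ((Q.Fx * Q.D - 4 * Q.F) * Q.m2 + (Q.Fy * Q.D + 4 * Q.F) * Q.m1)
    + Q.m1 * Q.m2 * Q.N * Q.D ^ 2 = -4 * Q.F * Q.w := by
  simp only [F_eq, F', Fx, Fy, N, D, X, Y, X1, Y1, m12, m1, m2, V, A, Ax, Ay, hx, hy, h, a₃,
    hxy, Axy, w, P, g, B, J]
  ring

theorem mul_g : Q.x * Q.y * Q.g - (Q.x ^ 2 * Q.Y + Q.y ^ 2 * Q.X) * Q.B = -(Q.S * Q.F' ^ 2) := by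
  simp only [F', X, Y, g, B, V, a₃]
  ring

theorem sq_g : Q.g ^ 2 - 4 * (Q.X * Q.Y) * Q.B ^ 2 = Q.F' ^ 2 * Q.K := by
  simp only [F', D, X, Y, g, B, K, V, a₃]
  ring

theorem K_eq : (1 - Q.ν) * Q.K = -2 * (Q.P * Q.S + Q.J * Q.h * Q.D ^ 2) := by
  simp only [D, K, P, J, V, h, a₃]
  ring

/-- The discriminant of the trace-free Hessian of the potential `-A / h`. -/
theorem sq_u_add_sq_w : 4 * (Q.u ^ 2 - Q.X * Q.Y * Q.w ^ 2)
    = Q.F ^ 2 * (9 * Q.P ^ 2 + 72 * (1 - Q.ν) * (Q.X * Q.Y) * Q.J * Q.h) := by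
  have e : (Q.x ^ 2 * Q.Y + Q.y ^ 2 * Q.X) ^ 2 - 4 * (Q.x * Q.y) ^ 2 * (Q.X * Q.Y) = Q.F ^ 2 := by
    rw [F]; ring
  have e2 : Q.F ^ 2 = Q.D ^ 2 * Q.F' ^ 2 := by rw [F_eq]; ring
  rw [u, w]
  -- As a quadratic form in P and 1 - ν, the left side has the P² coefficient given by `e`, the
  -- mixed one by `mul_g` and the (1 - ν)² one by `sq_g`. Then `K_eq` replaces (1 - ν) K; its part
  -- with P S cancels the mixed term and its part with J h D² is what remains.
  linear_combination 9 * Q.P ^ 2 * e + 72 * Q.P * (1 - Q.ν) * (Q.X * Q.Y) * Q.mul_g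
    - 36 * (1 - Q.ν) ^ 2 * (Q.X * Q.Y) * Q.sq_g
    - 36 * (1 - Q.ν) * (Q.X * Q.Y) * Q.F' ^ 2 * Q.K_eq
    - 72 * (1 - Q.ν) * (Q.X * Q.Y) * Q.J * Q.h * e2

end QuarticPoint

/-! ### The Chen–Teo functions satisfy the vacuum equations -/

namespace QuarticPoint

variable (Q : QuarticPoint)

/-- The jets of the functions that determine the Chen–Teo metric. The Ernst potentials are
`x / N = f + v` and `-A / h = f - v`. -/
def jet : StationaryJet where
  D := Q.D
  X := Q.X
  X1 := Q.X1
  X2 := Q.X2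
  Y := Q.Y
  Y1 := Q.Y1
  Y2 := Q.Y2
  L := Q.k * Q.N * Q.h / Q.D ^ 3
  lx := Q.ν / Q.N + Q.hx / Q.h - 3 / Q.D
  ly := 1 / Q.N + Q.hy / Q.h + 3 / Q.D
  lxx := -(Q.ν / Q.N) ^ 2 + Q.hxx / Q.h - (Q.hx / Q.h) ^ 2 + 3 / Q.D ^ 2
  lxy := -Q.ν / Q.N ^ 2 + Q.hxy / Q.h - Q.hx * Q.hy / Q.h ^ 2 - 3 / Q.D ^ 2
  lyy := -(1 / Q.N) ^ 2 + Q.hyy / Q.h - (Q.hy / Q.h) ^ 2 + 3 / Q.D ^ 2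
  f := (Q.x / Q.N - Q.A / Q.h) / 2
  fx := (Q.y / Q.N ^ 2 + Q.m1 / Q.h ^ 2) / 2
  fy := (-Q.x / Q.N ^ 2 + Q.m2 / Q.h ^ 2) / 2
  fxx := (-2 * Q.ν * Q.y / Q.N ^ 3 + Q.m11 / Q.h ^ 3) / 2
  fxy := ((Q.ν * Q.x - Q.y) / Q.N ^ 3 + Q.m12 / Q.h ^ 3) / 2
  fyy := (2 * Q.x / Q.N ^ 3 + Q.m22 / Q.h ^ 3) / 2
  v := (Q.x / Q.N + Q.A / Q.h) / 2
  vx := (Q.y / Q.N ^ 2 - Q.m1 / Q.h ^ 2) / 2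
  vy := (-Q.x / Q.N ^ 2 - Q.m2 / Q.h ^ 2) / 2
  vxx := (-2 * Q.ν * Q.y / Q.N ^ 3 - Q.m11 / Q.h ^ 3) / 2
  vxy := ((Q.ν * Q.x - Q.y) / Q.N ^ 3 - Q.m12 / Q.h ^ 3) / 2
  vyy := (2 * Q.x / Q.N ^ 3 - Q.m22 / Q.h ^ 3) / 2

/-- None of the denominators of the Chen–Teo metric vanishes. -/
structure Regular : Prop where
  k : Q.k ≠ 0
  D : Q.D ≠ 0
  N : Q.N ≠ 0
  h : Q.h ≠ 0
  F : Q.F ≠ 0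

/-- Since L f = k F/D⁴, the logarithmic derivatives satisfy lx + fx/f = Fx/F - 4/D; this is that
relation without denominators. -/
theorem log_x_num : (Q.ν * Q.h + Q.hx * Q.N) * Q.D * Q.F + Q.N * Q.h * Q.F
    + (Q.y * Q.h ^ 2 + Q.m1 * Q.N ^ 2) * Q.D ^ 2 / 2 = Q.N * Q.h * Q.D * Q.Fx := by
  simp only [N, D, X, Y, X1, m1, A, Ax, hx, h, a₃, F, Fx]
  ring

theorem log_y_num : (Q.h + Q.hy * Q.N) * Q.D * Q.F - Q.N * Q.h * Q.F
    + (-Q.x * Q.h ^ 2 + Q.m2 * Q.N ^ 2) * Q.D ^ 2 / 2 = Q.N * Q.h * Q.D * Q.Fy := by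
  simp only [N, D, X, Y, Y1, m2, A, Ay, hy, h, a₃, F, Fy]
  ring

variable {Q}

namespace Regular

variable (r : Q.Regular)
include r

theorem f_eq : Q.jet.f = Q.F / (Q.N * Q.h * Q.D) := by
  obtain ⟨hk, hD, hN, hh, hF⟩ := r
  simp only [jet]
  field_simp
  rw [F_eq]
  linear_combination Q.D * Q.numerator_sub

/-- The conformal equations contain L only through the logarithmic derivatives of L f, which this
form makes explicit in F and D. -/
theorem lx_eq : Q.jet.lx = Q.Fx / Q.F - 4 / Q.D - Q.jet.fx / Q.jet.f := by
  rw [r.f_eq]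
  obtain ⟨hk, hD, hN, hh, hF⟩ := r
  simp only [jet]
  field_simp
  linear_combination 2 * Q.log_x_num

theorem ly_eq : Q.jet.ly = Q.Fy / Q.F + 4 / Q.D - Q.jet.fy / Q.jet.f := by
  rw [r.f_eq]
  obtain ⟨hk, hD, hN, hh, hF⟩ := r
  simp only [jet]
  field_simp
  linear_combination 2 * Q.log_y_num

/-- Only the gradient (y/N², -x/N²) of x/N enters, and `lam_e` extracts the factor F that cancels
against f. -/
theorem lam_one : Q.jet.lam 1 = (1 + Q.ν) * Q.D ^ 3 / (2 * Q.k * Q.N ^ 3) := by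
  have e1 : Q.jet.fx + 1 * Q.jet.vx = Q.y / Q.N ^ 2 := by simp only [jet]; ring
  have e2 : Q.jet.fy + 1 * Q.jet.vy = -Q.x / Q.N ^ 2 := by simp only [jet]; ring
  rw [StationaryJet.lam, e1, e2, r.f_eq]
  obtain ⟨hk, hD, hN, hh, hF⟩ := r
  simp only [jet]
  field_simp
  have hF' : Q.F = Q.X * Q.y ^ 2 - Q.x ^ 2 * Q.Y := rfl
  linear_combination 2 * Q.F * Q.lam_e - 2 * Q.h * Q.D ^ 2 * hF'

theorem lam_neg_one : Q.jet.lam (-1) = Q.P * Q.D ^ 3 / (Q.k * Q.h ^ 3) := by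
  have e1 : Q.jet.fx + (-1) * Q.jet.vx = Q.m1 / Q.h ^ 2 := by simp only [jet]; ring
  have e2 : Q.jet.fy + (-1) * Q.jet.vy = Q.m2 / Q.h ^ 2 := by simp only [jet]; ring
  rw [StationaryJet.lam, e1, e2, r.f_eq]
  obtain ⟨hk, hD, hN, hh, hF⟩ := r
  simp only [jet]
  field_simp
  linear_combination Q.F * Q.lam_m + Q.N * Q.D ^ 2 * Q.normSq_m

theorem hessRe_one : Q.jet.hessRe 1
    = 3 * (1 + Q.ν) * (Q.x ^ 2 * Q.Y + Q.y ^ 2 * Q.X) / (Q.D * Q.N ^ 3) := by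
  rw [StationaryJet.hessRe, r.lx_eq, r.ly_eq, r.f_eq]
  obtain ⟨hk, hD, hN, hh, hF⟩ := r
  simp only [jet]
  field_simp
  linear_combination 4 * Q.h ^ 3 * Q.hessRe_e

theorem hessIm_one : Q.jet.hessIm 1
    = -6 * (1 + Q.ν) * (Q.x * Q.y) / (Q.D * Q.N ^ 3) := by
  rw [StationaryJet.hessIm, r.lx_eq, r.ly_eq, r.f_eq]
  obtain ⟨hk, hD, hN, hh, hF⟩ := r
  simp only [jet]
  field_simp
  linear_combination 4 * Q.h ^ 3 * Q.hessIm_e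

theorem hessRe_neg_one : Q.jet.hessRe (-1) = -4 * Q.u / (Q.D * Q.h ^ 3) := by
  rw [StationaryJet.hessRe, r.lx_eq, r.ly_eq, r.f_eq]
  obtain ⟨hk, hD, hN, hh, hF⟩ := r
  simp only [jet]
  field_simp
  linear_combination 4 * Q.N ^ 3 * Q.hessRe_m

theorem hessIm_neg_one : Q.jet.hessIm (-1) = -4 * Q.w / (Q.D * Q.h ^ 3) := by
  rw [StationaryJet.hessIm, r.lx_eq, r.ly_eq, r.f_eq]
  obtain ⟨hk, hD, hN, hh, hF⟩ := r
  simp only [jet]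
  field_simp
  linear_combination 4 * Q.N ^ 3 * Q.hessIm_m

/-- Without denominators each equation is a combination of the polynomial identities above. The
Ernst equations for f and v are the sum and the difference of those for x/N and -A/h. -/
theorem isVacuum : Q.jet.IsVacuum where
  ernst_f := by
    rw [r.f_eq]
    obtain ⟨hk, hD, hN, hh, hF⟩ := r
    have hF' : Q.F = Q.X * Q.y ^ 2 - Q.x ^ 2 * Q.Y := rfl
    simp only [jet]
    field_simp
    linear_combination 2 * Q.F * Q.h ^ 3 * Q.ernst_e + 2 * Q.F * Q.N ^ 3 * Q.ernst_m
      + 2 * Q.D ^ 2 * Q.h ^ 4 * hF' - 2 * Q.D ^ 2 * Q.N ^ 4 * Q.normSq_m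
  ernst_v := by
    rw [r.f_eq]
    obtain ⟨hk, hD, hN, hh, hF⟩ := r
    have hF' : Q.F = Q.X * Q.y ^ 2 - Q.x ^ 2 * Q.Y := rfl
    simp only [jet]
    field_simp
    linear_combination Q.F * Q.h ^ 3 * Q.ernst_e - Q.F * Q.N ^ 3 * Q.ernst_m
      + Q.D ^ 2 * Q.h ^ 4 * hF' + Q.D ^ 2 * Q.N ^ 4 * Q.normSq_m
  harmonic := by
    have hD := r.D
    simp only [jet]
    field_simp
    linear_combination Q.harmonic
  conf_re := by
    rw [show Q.jet.lx + Q.jet.fx / Q.jet.f = Q.Fx / Q.F - 4 / Q.D by rw [r.lx_eq]; ring,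
      show Q.jet.ly + Q.jet.fy / Q.jet.f = Q.Fy / Q.F + 4 / Q.D by rw [r.ly_eq]; ring, r.f_eq]
    obtain ⟨hk, hD, hN, hh, hF⟩ := r
    simp only [jet]
    field_simp
    linear_combination 4 * Q.N ^ 2 * Q.h ^ 2 * Q.conf_re
  conf_im := by
    rw [show Q.jet.lx + Q.jet.fx / Q.jet.f = Q.Fx / Q.F - 4 / Q.D by rw [r.lx_eq]; ring,
      show Q.jet.ly + Q.jet.fy / Q.jet.f = Q.Fy / Q.F + 4 / Q.D by rw [r.ly_eq]; ring, r.f_eq]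
    obtain ⟨hk, hD, hN, hh, hF⟩ := r
    simp only [jet]
    field_simp
    linear_combination 2 * Q.N ^ 2 * Q.h ^ 2 * Q.conf_im
  gauss := by
    have hL : Q.jet.L ≠ 0 :=
      div_ne_zero (mul_ne_zero (mul_ne_zero r.k r.N) r.h) (pow_ne_zero 3 r.D)
    -- The right side of `gauss` is L (λ⁺ + λ⁻), and both eigenvalues are known already.
    have e : Q.jet.L * (Q.jet.lam 1 + Q.jet.lam (-1))
        = (Q.jet.X * (Q.jet.fx ^ 2 + Q.jet.vx ^ 2) - Q.jet.Y * (Q.jet.fy ^ 2 + Q.jet.vy ^ 2))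
            / (2 * Q.jet.f ^ 2)
          - ((Q.jet.X1 / 2 - 2 * Q.jet.X / Q.jet.D) * Q.jet.fx
            - (Q.jet.Y1 / 2 + 2 * Q.jet.Y / Q.jet.D) * Q.jet.fy) / Q.jet.f := by
      simp only [StationaryJet.lam]
      field_simp
      ring
    rw [← e, r.lam_one, r.lam_neg_one]
    obtain ⟨hk, hD, hN, hh, hF⟩ := r
    simp only [jet]
    field_simp
    linear_combination -Q.gauss

end Regular

end QuarticPoint

/-! ### Derivatives of the Chen–Teo functions -/

namespace JetFun

/-- A power of a function. -/
def pow {U : Set Pt} (u : JetFun U) (n : ℕ) : JetFun U :=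
  ⟨fun p => u.val p ^ n, fun p => n * u.val p ^ (n - 1) * u.dx p,
    fun p => n * u.val p ^ (n - 1) * u.dy p, fun p hp => (u.grad p hp).pow n⟩

variable {U : Set Pt} (u : JetFun U) (n : ℕ) (p : Pt)

@[simp] theorem val_pow : (u.pow n).val p = u.val p ^ n := rfl
@[simp] theorem dx_pow : (u.pow n).dx p = n * u.val p ^ (n - 1) * u.dx p := rfl
@[simp] theorem dy_pow : (u.pow n).dy p = n * u.val p ^ (n - 1) * u.dy p := rfl

/-- The coordinate `p⁰`. -/
def fst : JetFun U := ⟨fun p => p 0, fun _ => 1, fun _ => 0, fun _ _ => HasGrad.coord_zero⟩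

/-- The coordinate `p¹`. -/
def snd : JetFun U := ⟨fun p => p 1, fun _ => 0, fun _ => 1, fun _ _ => HasGrad.coord_one⟩

@[simp] theorem val_fst : (fst : JetFun U).val p = p 0 := rfl
@[simp] theorem dx_fst : (fst : JetFun U).dx p = 1 := rfl
@[simp] theorem dy_fst : (fst : JetFun U).dy p = 0 := rfl
@[simp] theorem val_snd : (snd : JetFun U).val p = p 1 := rfl
@[simp] theorem dx_snd : (snd : JetFun U).dx p = 0 := rfl
@[simp] theorem dy_snd : (snd : JetFun U).dy p = 1 := rfl

end JetFun

namespace QuarticPoint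

variable (Q : QuarticPoint)

def G : ℝ := Q.X * (Q.a₀ * Q.ν ^ 2 + 2 * Q.a₃ * Q.ν * Q.y ^ 3 - Q.a₄ * Q.y ^ 4
    + 2 * Q.a₄ * Q.ν * Q.y ^ 4)
  + (Q.a₀ - 2 * Q.a₀ * Q.ν - 2 * Q.a₁ * Q.ν * Q.x - Q.a₄ * Q.ν ^ 2 * Q.x ^ 4) * Q.Y
def Gx : ℝ := Q.X1 * (Q.a₀ * Q.ν ^ 2 + 2 * Q.a₃ * Q.ν * Q.y ^ 3 - Q.a₄ * Q.y ^ 4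
    + 2 * Q.a₄ * Q.ν * Q.y ^ 4)
  + (-2 * Q.a₁ * Q.ν - 4 * Q.a₄ * Q.ν ^ 2 * Q.x ^ 3) * Q.Y
def Gy : ℝ := Q.X * (6 * Q.a₃ * Q.ν * Q.y ^ 2 - 4 * Q.a₄ * Q.y ^ 3 + 8 * Q.a₄ * Q.ν * Q.y ^ 3)
  + (Q.a₀ - 2 * Q.a₀ * Q.ν - 2 * Q.a₁ * Q.ν * Q.x - Q.a₄ * Q.ν ^ 2 * Q.x ^ 4) * Q.Y1

/-- The numerators of the derivatives of q = G/F. After substitution of f = F/(N h D), the right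
sides are the duality relations between dq and dv; they tie G to the Ernst potentials. -/
theorem wronskian_x : Q.Gx * Q.F - Q.G * Q.Fx = Q.Y * (Q.x * Q.h ^ 2 + Q.m2 * Q.N ^ 2) / 2 := by
  simp only [F, Fx, G, Gx, N, X, Y, X1, m2, A, Ay, hy, h, a₀, a₁, a₃]
  ring

theorem wronskian_y : Q.Gy * Q.F - Q.G * Q.Fy = Q.X * (-Q.y * Q.h ^ 2 + Q.m1 * Q.N ^ 2) / 2 := by
  simp only [F, Fy, G, Gy, N, X, Y, Y1, m1, A, Ax, hx, h, a₀, a₁, a₃]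
  ring

end QuarticPoint

namespace Params

variable (P : Params)

/-- The coefficients of the quartic at a point. -/
def pt (p : Pt) : QuarticPoint where
  k := P.k
  ν := P.ν
  x := p 0
  y := p 1
  S := P.a₁ - P.a₃ * p 0 * p 1
  T := P.a₀ - P.a₄ * p 0 ^ 2 * p 1 ^ 2
  b := P.a₂ + P.a₃ * (p 0 + p 1) + P.a₄ * (p 0 ^ 2 + p 1 ^ 2)
  c := P.a₃ + 2 * P.a₄ * (p 0 + p 1)
  a₄ := P.a₄

theorem pt_a₃ (p : Pt) : (P.pt p).a₃ = P.a₃ := by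
  simp only [QuarticPoint.a₃, Params.pt]; ring

theorem pt_a₁ (p : Pt) : (P.pt p).a₁ = P.a₁ := by
  rw [QuarticPoint.a₁, pt_a₃]; simp only [Params.pt]; ring

theorem pt_a₀ (p : Pt) : (P.pt p).a₀ = P.a₀ := by
  simp only [QuarticPoint.a₀, Params.pt]; ring

theorem pt_X (p : Pt) : (P.pt p).X = P.quartic (p 0) := by
  simp only [QuarticPoint.X, Params.pt, quartic]; ring

theorem pt_Y (p : Pt) : (P.pt p).Y = P.quartic (p 1) := by
  simp only [QuarticPoint.Y, Params.pt, quartic]; ring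

theorem pt_F (p : Pt) : (P.pt p).F = P.F (p 0) (p 1) := by
  rw [QuarticPoint.F, pt_X, pt_Y, F]; rfl

theorem pt_G (p : Pt) : (P.pt p).G = P.G (p 0) (p 1) := by
  rw [QuarticPoint.G, pt_X, pt_Y, pt_a₀, pt_a₁, pt_a₃, G]; rfl

theorem pt_N_mul_h (p : Pt) : (P.pt p).N * (P.pt p).h = P.H (p 0) (p 1) := by
  simp only [QuarticPoint.N, QuarticPoint.h, Params.pt, H]

section Gradients

open JetFun (const fst snd)

variable (U : Set Pt)

/-- The values of these jets unfold to the functions of `P.pt`, so each gradient below is `grad` of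
such a jet, up to a comparison of polynomials. Here S, T, b and c vary with the point. -/
def jS : JetFun U := const P.a₁ - const P.a₃ * fst * snd
def jT : JetFun U := const P.a₀ - const P.a₄ * fst.pow 2 * snd.pow 2
def jb : JetFun U := const P.a₂ + const P.a₃ * (fst + snd) + const P.a₄ * (fst.pow 2 + snd.pow 2)
def jc : JetFun U := const P.a₃ + const 2 * const P.a₄ * (fst + snd)
def ja₃ : JetFun U := P.jc U - const 2 * const P.a₄ * (fst + snd)
def jX : JetFun U := P.jT U + fst * P.jS U + P.jb U * fst.pow 2
def jY : JetFun U := P.jT U + snd * P.jS U + P.jb U * snd.pow 2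
def jX1 : JetFun U := P.jS U + const 2 * P.jb U * fst + fst * (fst - snd) * P.jc U
def jY1 : JetFun U := P.jS U + const 2 * P.jb U * snd - snd * (fst - snd) * P.jc U
def jN : JetFun U := const P.ν * fst + snd
def jh : JetFun U := (const P.ν * fst - snd) * P.jS U - const 2 * (const 1 - const P.ν) * P.jT U
def jhx : JetFun U := const P.ν * P.jS U - (const P.ν * fst - snd) * (P.ja₃ U * snd)
  + const 4 * (const 1 - const P.ν) * const P.a₄ * fst * snd.pow 2
def jhy : JetFun U := -P.jS U - (const P.ν * fst - snd) * (P.ja₃ U * fst)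
  + const 4 * (const 1 - const P.ν) * const P.a₄ * fst.pow 2 * snd
def jA : JetFun U := const 2 * P.jT U + fst * P.jS U
def jAx : JetFun U := P.jS U - P.ja₃ U * fst * snd - const 4 * const P.a₄ * fst * snd.pow 2
def jAy : JetFun U := -P.ja₃ U * fst.pow 2 - const 4 * const P.a₄ * fst.pow 2 * snd

variable {U} {p : Pt}

theorem grad_X : HasGrad (fun r => (P.pt r).X) p (P.pt p).X1 0 :=
  ((P.jX Set.univ).grad p trivial).congr_grad
    (by simp [jX, jT, jS, jb, QuarticPoint.X1, Params.pt]; ring)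
    (by simp [jX, jT, jS, jb]; ring)

theorem grad_Y : HasGrad (fun r => (P.pt r).Y) p 0 (P.pt p).Y1 :=
  ((P.jY Set.univ).grad p trivial).congr_grad
    (by simp [jY, jT, jS, jb]; ring)
    (by simp [jY, jT, jS, jb, QuarticPoint.Y1, Params.pt]; ring)

theorem grad_X1 : HasGrad (fun r => (P.pt r).X1) p (P.pt p).X2 0 :=
  ((P.jX1 Set.univ).grad p trivial).congr_grad
    (by simp [jX1, jc, jS, jb, QuarticPoint.X2, Params.pt]; ring)
    (by simp [jX1, jc, jS, jb]; ring)

theorem grad_Y1 : HasGrad (fun r => (P.pt r).Y1) p 0 (P.pt p).Y2 :=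
  ((P.jY1 Set.univ).grad p trivial).congr_grad
    (by simp [jY1, jc, jS, jb]; ring)
    (by simp [jY1, jc, jS, jb, QuarticPoint.Y2, Params.pt]; ring)

theorem grad_D : HasGrad (fun r => (P.pt r).D) p 1 (-1) :=
  (((fst - snd : JetFun Set.univ)).grad p trivial).congr_grad (by simp) (by simp)

theorem grad_N : HasGrad (fun r => (P.pt r).N) p P.ν 1 :=
  ((P.jN Set.univ).grad p trivial).congr_grad (by simp [jN]) (by simp [jN])

theorem grad_h : HasGrad (fun r => (P.pt r).h) p (P.pt p).hx (P.pt p).hy :=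
  ((P.jh Set.univ).grad p trivial).congr_grad
    (by simp [jh, jT, jS, QuarticPoint.hx, pt_a₃]; simp [Params.pt]; ring)
    (by simp [jh, jT, jS, QuarticPoint.hy, pt_a₃]; simp [Params.pt]; ring)

theorem grad_hx : HasGrad (fun r => (P.pt r).hx) p (P.pt p).hxx (P.pt p).hxy :=
  ((P.jhx Set.univ).grad p trivial).congr_grad
    (by simp [jhx, jS, ja₃, jc, QuarticPoint.hxx, pt_a₃]; simp [Params.pt]; ring)
    (by simp [jhx, jS, ja₃, jc, QuarticPoint.hxy, pt_a₃]; simp [Params.pt]; ring)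

theorem grad_hy : HasGrad (fun r => (P.pt r).hy) p (P.pt p).hxy (P.pt p).hyy :=
  ((P.jhy Set.univ).grad p trivial).congr_grad
    (by simp [jhy, jS, ja₃, jc, QuarticPoint.hxy, pt_a₃]; simp [Params.pt]; ring)
    (by simp [jhy, jS, ja₃, jc, QuarticPoint.hyy, pt_a₃]; simp [Params.pt]; ring)

theorem grad_A : HasGrad (fun r => (P.pt r).A) p (P.pt p).Ax (P.pt p).Ay :=
  ((P.jA Set.univ).grad p trivial).congr_grad
    (by simp [jA, jT, jS, QuarticPoint.Ax, pt_a₃]; simp [Params.pt]; ring)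
    (by simp [jA, jT, jS, QuarticPoint.Ay, pt_a₃]; simp [Params.pt]; ring)

theorem grad_Ax : HasGrad (fun r => (P.pt r).Ax) p (P.pt p).Axx (P.pt p).Axy :=
  ((P.jAx Set.univ).grad p trivial).congr_grad
    (by simp [jAx, jS, ja₃, jc, QuarticPoint.Axx, pt_a₃]; simp [Params.pt]; ring)
    (by simp [jAx, jS, ja₃, jc, QuarticPoint.Axy, pt_a₃]; simp [Params.pt]; ring)

theorem grad_Ay : HasGrad (fun r => (P.pt r).Ay) p (P.pt p).Axy (P.pt p).Ayy :=
  ((P.jAy Set.univ).grad p trivial).congr_grad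
    (by simp [jAy, ja₃, jc, QuarticPoint.Axy, pt_a₃]; simp [Params.pt]; ring)
    (by simp [jAy, ja₃, jc, QuarticPoint.Ayy]; simp [Params.pt])

theorem grad_m1 : HasGrad (fun r => (P.pt r).m1) p
    ((P.pt p).A * (P.pt p).hxx - (P.pt p).Axx * (P.pt p).h)
    ((P.pt p).Ay * (P.pt p).hx + (P.pt p).A * (P.pt p).hxy - (P.pt p).Axy * (P.pt p).h
      - (P.pt p).Ax * (P.pt p).hy) :=
  ((P.grad_A.mul P.grad_hx).sub (P.grad_Ax.mul P.grad_h)).congr_grad (by ring) (by ring)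

theorem grad_m2 : HasGrad (fun r => (P.pt r).m2) p
    ((P.pt p).Ax * (P.pt p).hy + (P.pt p).A * (P.pt p).hxy - (P.pt p).Axy * (P.pt p).h
      - (P.pt p).Ay * (P.pt p).hx)
    ((P.pt p).A * (P.pt p).hyy - (P.pt p).Ayy * (P.pt p).h) :=
  ((P.grad_A.mul P.grad_hy).sub (P.grad_Ay.mul P.grad_h)).congr_grad (by ring) (by ring)

theorem grad_F : HasGrad (fun r => (P.pt r).F) p (P.pt p).Fx (P.pt p).Fy :=
  ((P.grad_X.mul (HasGrad.coord_one.pow 2)).sub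
    ((HasGrad.coord_zero.pow 2).mul P.grad_Y)).congr_grad
    (by simp [QuarticPoint.Fx, Params.pt]) (by simp [QuarticPoint.Fy, Params.pt]; ring)

theorem grad_G : HasGrad (fun r => (P.pt r).G) p (P.pt p).Gx (P.pt p).Gy := by
  have h1 : HasGrad (fun r : Pt => P.a₀ * P.ν ^ 2 + 2 * P.a₃ * P.ν * r 1 ^ 3 - P.a₄ * r 1 ^ 4
      + 2 * P.a₄ * P.ν * r 1 ^ 4) p 0
      (6 * P.a₃ * P.ν * p 1 ^ 2 - 4 * P.a₄ * p 1 ^ 3 + 8 * P.a₄ * P.ν * p 1 ^ 3) :=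
    (((const (P.a₀ * P.ν ^ 2) + const (2 * P.a₃ * P.ν) * snd.pow 3 - const P.a₄ * snd.pow 4
      + const (2 * P.a₄ * P.ν) * snd.pow 4 : JetFun Set.univ)).grad p trivial).congr_grad
      (by simp) (by simp; ring)
  have h2 : HasGrad (fun r : Pt => P.a₀ - 2 * P.a₀ * P.ν - 2 * P.a₁ * P.ν * r 0
      - P.a₄ * P.ν ^ 2 * r 0 ^ 4) p (-2 * P.a₁ * P.ν - 4 * P.a₄ * P.ν ^ 2 * p 0 ^ 3) 0 :=
    (((const (P.a₀ - 2 * P.a₀ * P.ν) - const (2 * P.a₁ * P.ν) * fst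
      - const (P.a₄ * P.ν ^ 2) * fst.pow 4 : JetFun Set.univ)).grad p trivial).congr_grad
      (by simp; ring) (by simp)
  simp only [QuarticPoint.G, pt_a₀, pt_a₁, pt_a₃]
  refine ((P.grad_X.mul h1).add (h2.mul P.grad_Y)).congr_grad ?_ ?_ <;>
    simp only [QuarticPoint.Gx, QuarticPoint.Gy, pt_a₁, pt_a₃, pt_a₀] <;> simp [Params.pt]

end Gradients

end Params

/-! ### The Chen–Teo metric as a stationary vacuum metric -/

namespace Params

variable (P : Params)

/-- The open set on which the metric is Riemannian. -/
def regular : Set Pt :=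
  {p | p 1 < p 0 ∧ 0 < P.quartic (p 0) ∧ P.quartic (p 1) < 0 ∧ 0 < P.H (p 0) (p 1)}

theorem isOpen_regular : IsOpen P.regular := by
  have h0 : Continuous fun p : Pt => p 0 := continuous_apply 0
  have h1 : Continuous fun p : Pt => p 1 := continuous_apply 1
  have h2 : Continuous fun p : Pt => P.quartic (p 0) := by simp only [quartic]; fun_prop
  have h3 : Continuous fun p : Pt => P.quartic (p 1) := by simp only [quartic]; fun_prop
  have h4 : Continuous fun p : Pt => P.H (p 0) (p 1) := by simp only [H]; fun_prop
  exact (isOpen_lt h1 h0).and ((isOpen_lt continuous_const h2).and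
    ((isOpen_lt h3 continuous_const).and (isOpen_lt continuous_const h4)))

variable {P} {p : Pt}

theorem D_pos (hp : p ∈ P.regular) : 0 < (P.pt p).D := sub_pos.mpr hp.1

theorem X_pos (hp : p ∈ P.regular) : 0 < (P.pt p).X := by
  rw [pt_X]; exact hp.2.1

theorem Y_neg (hp : p ∈ P.regular) : (P.pt p).Y < 0 := by
  rw [pt_Y]; exact hp.2.2.1

theorem N_mul_h_pos (hp : p ∈ P.regular) : 0 < (P.pt p).N * (P.pt p).h := by
  rw [pt_N_mul_h]; exact hp.2.2.2

/-- Both terms of y²X - x²Y are nonnegative, and x > y keeps x and y from vanishing together. -/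
theorem F_pos (hp : p ∈ P.regular) : 0 < (P.pt p).F := by
  have hX := X_pos hp
  have hY := Y_neg hp
  have hD := D_pos hp
  rw [QuarticPoint.F]
  rcases eq_or_ne (P.pt p).y 0 with h | h
  · have hx : (P.pt p).x ≠ 0 := by
      intro h'
      rw [QuarticPoint.D, h, h', sub_zero] at hD
      exact hD.false
    nlinarith [mul_pos (pow_pos (abs_pos.mpr hx) 2) (neg_pos.mpr hY), sq_abs (P.pt p).x]
  · have h2 : 0 < (P.pt p).y ^ 2 := by positivity
    nlinarith [mul_pos hX h2, mul_nonneg (sq_nonneg (P.pt p).x) (neg_pos.mpr hY).le]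

theorem regular_pt (hk : 0 < P.k) (hp : p ∈ P.regular) : (P.pt p).Regular where
  k := hk.ne'
  D := (D_pos hp).ne'
  N := left_ne_zero_of_mul (N_mul_h_pos hp).ne'
  h := right_ne_zero_of_mul (N_mul_h_pos hp).ne'
  F := (F_pos hp).ne'

/-- A quotient of the form of the first derivatives of the Ernst potentials. -/
theorem _root_.ChenTeo.HasGrad.div_sq {m n : Pt → ℝ} {a b c d : ℝ} (hm : HasGrad m p a b)
    (hn : HasGrad n p c d) (h0 : n p ≠ 0) : HasGrad (fun r => m r / n r ^ 2) p
      ((a * n p - 2 * m p * c) / n p ^ 3) ((b * n p - 2 * m p * d) / n p ^ 3) :=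
  (hm.div (hn.pow 2) (pow_ne_zero 2 h0)).congr_grad (by simp; field_simp) (by simp; field_simp)

theorem grad_half_add {u v : Pt → ℝ} {a b c d : ℝ} (hu : HasGrad u p a b) (hv : HasGrad v p c d) :
    HasGrad (fun r => (u r + v r) / 2) p ((a + c) / 2) ((b + d) / 2) := by
  simpa [div_eq_mul_inv] using (hu.add hv).mul (HasGrad.const (2 : ℝ)⁻¹)

theorem grad_half_sub {u v : Pt → ℝ} {a b c d : ℝ} (hu : HasGrad u p a b) (hv : HasGrad v p c d) :
    HasGrad (fun r => (u r - v r) / 2) p ((a - c) / 2) ((b - d) / 2) := by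
  simpa [div_eq_mul_inv] using (hu.sub hv).mul (HasGrad.const (2 : ℝ)⁻¹)

section

variable (hN : (P.pt p).N ≠ 0) (hh : (P.pt p).h ≠ 0)

include hN in
theorem grad_e : HasGrad (fun r => (P.pt r).x / (P.pt r).N) p ((P.pt p).y / (P.pt p).N ^ 2)
    (-(P.pt p).x / (P.pt p).N ^ 2) :=
  ((HasGrad.coord_zero.div P.grad_N hN)).congr_grad
    (by simp only [QuarticPoint.N, Params.pt]; ring)
    (by simp only [QuarticPoint.N, Params.pt]; ring)

include hN in
theorem grad_ex : HasGrad (fun r => (P.pt r).y / (P.pt r).N ^ 2) p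
    (-2 * (P.pt p).ν * (P.pt p).y / (P.pt p).N ^ 3)
    (((P.pt p).ν * (P.pt p).x - (P.pt p).y) / (P.pt p).N ^ 3) :=
  ((HasGrad.coord_one.div_sq P.grad_N hN)).congr_grad
    (by simp only [QuarticPoint.N, Params.pt]; ring)
    (by simp only [QuarticPoint.N, Params.pt]; ring)

include hN in
theorem grad_ey : HasGrad (fun r => -(P.pt r).x / (P.pt r).N ^ 2) p
    (((P.pt p).ν * (P.pt p).x - (P.pt p).y) / (P.pt p).N ^ 3)
    (2 * (P.pt p).x / (P.pt p).N ^ 3) :=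
  ((HasGrad.coord_zero.neg.div_sq P.grad_N hN)).congr_grad
    (by simp only [QuarticPoint.N, Params.pt]; ring)
    (by simp only [QuarticPoint.N, Params.pt]; ring)

include hh in
theorem grad_A_div : HasGrad (fun r => (P.pt r).A / (P.pt r).h) p
    (-((P.pt p).m1 / (P.pt p).h ^ 2)) (-((P.pt p).m2 / (P.pt p).h ^ 2)) :=
  ((P.grad_A.div P.grad_h hh)).congr_grad
    (by simp only [QuarticPoint.m1]; ring) (by simp only [QuarticPoint.m2]; ring)

include hh in
theorem grad_mx : HasGrad (fun r => (P.pt r).m1 / (P.pt r).h ^ 2) p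
    ((P.pt p).m11 / (P.pt p).h ^ 3) ((P.pt p).m12 / (P.pt p).h ^ 3) :=
  ((P.grad_m1.div_sq P.grad_h hh)).congr_grad
    (by simp only [QuarticPoint.m11]) (by simp only [QuarticPoint.m12])

include hh in
theorem grad_my : HasGrad (fun r => (P.pt r).m2 / (P.pt r).h ^ 2) p
    ((P.pt p).m12 / (P.pt p).h ^ 3) ((P.pt p).m22 / (P.pt p).h ^ 3) :=
  ((P.grad_m2.div_sq P.grad_h hh)).congr_grad
    (by simp only [QuarticPoint.m12, QuarticPoint.m1, QuarticPoint.m2]; ring)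
    (by simp only [QuarticPoint.m22])

end

variable (P) in
/-- The Chen–Teo metric as a stationary axisymmetric metric. -/
def stationary (hk : 0 < P.k) : Stationary P.regular where
  J p := (P.pt p).jet
  q p := (P.pt p).G / (P.pt p).F
  D_eq _ := rfl
  D_pos _ hp := D_pos hp
  X_pos _ hp := X_pos hp
  Y_neg _ hp := Y_neg hp
  L_pos p hp := by
    have h := N_mul_h_pos hp
    have hD := D_pos hp
    simp only [QuarticPoint.jet, mul_assoc]
    exact div_pos (mul_pos hk h) (pow_pos hD 3)
  f_pos p hp := by
    rw [(regular_pt hk hp).f_eq]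
    exact div_pos (F_pos hp) (mul_pos (N_mul_h_pos hp) (D_pos hp))
  grad_X _ _ := P.grad_X
  grad_X1 _ _ := P.grad_X1
  grad_Y _ _ := P.grad_Y
  grad_Y1 _ _ := P.grad_Y1
  grad_L p hp := by
    obtain ⟨-, hD, hN, hh, -⟩ := regular_pt hk hp
    refine ((((HasGrad.const P.k).mul P.grad_N).mul P.grad_h).div (P.grad_D.pow 3)
      (pow_ne_zero 3 hD)).congr_grad ?_ ?_ <;>
    · simp only [QuarticPoint.jet, show (P.pt p).k = P.k from rfl,
        show (P.pt p).ν = P.ν from rfl]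
      push_cast
      field_simp
      ring
  grad_lx p hp := by
    obtain ⟨-, hD, hN, hh, -⟩ := regular_pt hk hp
    refine ((((HasGrad.const P.ν).div P.grad_N hN).add (P.grad_hx.div P.grad_h hh)).sub
      ((HasGrad.const 3).div P.grad_D hD)).congr_grad ?_ ?_ <;>
    · simp only [QuarticPoint.jet, show (P.pt p).ν = P.ν from rfl]
      field_simp
      ring
  grad_ly p hp := by
    obtain ⟨-, hD, hN, hh, -⟩ := regular_pt hk hp
    refine ((((HasGrad.const 1).div P.grad_N hN).add (P.grad_hy.div P.grad_h hh)).add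
      ((HasGrad.const 3).div P.grad_D hD)).congr_grad ?_ ?_ <;>
    · simp only [QuarticPoint.jet, show (P.pt p).ν = P.ν from rfl]
      field_simp
      ring
  grad_f p hp := (grad_half_sub (grad_e (regular_pt hk hp).N)
    (grad_A_div (regular_pt hk hp).h)).congr_grad
      (by simp only [QuarticPoint.jet, sub_neg_eq_add])
      (by simp only [QuarticPoint.jet, sub_neg_eq_add])
  grad_fx p hp := grad_half_add (grad_ex (regular_pt hk hp).N) (grad_mx (regular_pt hk hp).h)
  grad_fy p hp := grad_half_add (grad_ey (regular_pt hk hp).N) (grad_my (regular_pt hk hp).h)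
  grad_vx p hp := grad_half_sub (grad_ex (regular_pt hk hp).N) (grad_mx (regular_pt hk hp).h)
  grad_vy p hp := grad_half_sub (grad_ey (regular_pt hk hp).N) (grad_my (regular_pt hk hp).h)
  grad_q p hp := by
    rw [(regular_pt hk hp).f_eq]
    obtain ⟨-, hD, hN, hh, hF⟩ := regular_pt hk hp
    refine (P.grad_G.div P.grad_F hF).congr_grad ?_ ?_
    · rw [(P.pt p).wronskian_x]
      simp only [QuarticPoint.jet]
      field_simp
      ring
    · rw [(P.pt p).wronskian_y]
      simp only [QuarticPoint.jet]
      field_simp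
      ring
  ernst_v p hp := (regular_pt hk hp).isVacuum.ernst_v

theorem metric_eq (hk : 0 < P.k) (hp : p ∈ P.regular) :
    P.metric p = (P.stationary hk).metric p := by
  have hf := (regular_pt hk hp).f_eq
  obtain ⟨-, hD, hN, hh, hF⟩ := regular_pt hk hp
  have hX := (X_pos hp).ne'
  have hY := (Y_neg hp).ne
  have e : (P.stationary hk).J p = (P.pt p).jet := rfl
  have e2 : (P.stationary hk).q p = (P.pt p).G / (P.pt p).F := rfl
  have e3 : p 0 - p 1 = (P.pt p).D := rfl
  have e4 : (P.pt p).jet.L = P.k * ((P.pt p).N * (P.pt p).h) / (P.pt p).D ^ 3 := by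
    simp only [QuarticPoint.jet, mul_assoc]; rfl
  have e5 : (P.pt p).jet.X = (P.pt p).X := rfl
  have e6 : (P.pt p).jet.Y = (P.pt p).Y := rfl
  have e7 : (P.pt p).jet.D = (P.pt p).D := rfl
  simp only [metric, Stationary.metric, e, e2, e3, e4, e5, e6, e7, hf, ← pt_X, ← pt_Y, ← pt_F,
    ← pt_G, ← pt_N_mul_h]
  generalize P.pt p = Q at *
  have hk' := hk.ne'
  have block : ∀ {a b c d e a' b' c' d' e' : ℝ}, a = a' → b = b' → c = c' → d = d' → e = e' →
      !![a, 0, 0, 0; 0, b, 0, 0; 0, 0, c, d; 0, 0, d, e]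
        = !![a', 0, 0, 0; 0, b', 0, 0; 0, 0, c', d'; 0, 0, d', e'] := by
    rintro a b c d e _ _ _ _ _ rfl rfl rfl rfl rfl
    rfl
  apply block
  · field_simp
  · field_simp
  · field_simp
  · field_simp
  · field_simp
    ring

/-- The Petrov frame of the Chen–Teo metric. -/
def petrovFrame (hk : 0 < P.k) (hp : p ∈ P.regular) : PetrovFrame P.metric p :=
  (P.stationary hk).petrovFrame P.isOpen_regular (fun _ hr => metric_eq hk hr) hp
    (regular_pt hk hp).isVacuum

end Params

/-! ### The Weyl tensor of the Chen–Teo metric -/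

namespace Params

variable {P : Params} {p : Pt}

theorem jet_Lf (hk : 0 < P.k) (hp : p ∈ P.regular) :
    (P.pt p).jet.L * (P.pt p).jet.f = P.k * (P.pt p).F / (P.pt p).D ^ 4 := by
  have hf := (regular_pt hk hp).f_eq
  obtain ⟨-, hD, hN, hh, hF⟩ := regular_pt hk hp
  rw [hf]
  simp only [QuarticPoint.jet, show (P.pt p).k = P.k from rfl]
  field_simp

/-- `disc` is the squared modulus of the trace-free Hessian `hessRe` + i √(-X Y) `hessIm`, divided
by (4 L f)², and L f = k F/D⁴. -/
theorem petrovFrame_disc (hk : 0 < P.k) (hp : p ∈ P.regular) {s : ℝ} (hs : s = 1 ∨ s = -1) :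
    (petrovFrame hk hp).disc s = ((P.pt p).jet.hessRe s ^ 2
      - (P.pt p).X * (P.pt p).Y * (P.pt p).jet.hessIm s ^ 2)
      * (P.pt p).D ^ 8 / (16 * P.k ^ 2 * (P.pt p).F ^ 2) := by
  have hs2 : s ^ 2 = 1 := by rcases hs with rfl | rfl <;> norm_num
  have hL : (P.pt p).jet.L ≠ 0 := ((P.stationary hk).L_pos p hp).ne'
  have hf : (P.pt p).jet.f ≠ 0 := ((P.stationary hk).f_pos p hp).ne'
  have hX := (X_pos hp).ne'
  have hY := (Y_neg hp).ne
  obtain ⟨-, hD, hN, hh, hF⟩ := regular_pt hk hp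
  have e : (P.pt p).D ^ 8 / (16 * P.k ^ 2 * (P.pt p).F ^ 2)
      = 1 / (4 * (P.pt p).jet.L * (P.pt p).jet.f) ^ 2 := by
    rw [mul_assoc 4, jet_Lf hk hp]
    have := hk.ne'
    field_simp
    norm_num
  rw [mul_div_assoc, e]
  have eJ : (P.stationary hk).J p = (P.pt p).jet := rfl
  have e6 : (P.pt p).jet.X = (P.pt p).X := rfl
  have e7 : (P.pt p).jet.Y = (P.pt p).Y := rfl
  simp only [PetrovFrame.disc, petrovFrame, Stationary.petrovFrame, Stationary.petrovData,
    StationaryJet.wa, StationaryJet.wb, StationaryJet.wc, eJ, e6, e7]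
  generalize (P.pt p).jet = j at *
  generalize P.pt p = Q at *
  field_simp
  rw [show s ^ 4 = 1 by rw [show s ^ 4 = (s ^ 2) ^ 2 by ring, hs2]; norm_num]
  ring

theorem petrovFrame_lam_one (hk : 0 < P.k) (hp : p ∈ P.regular) : (petrovFrame hk hp).lam 1
    = (1 + P.ν) * (P.pt p).D ^ 3 / (2 * P.k * (P.pt p).N ^ 3) :=
  (regular_pt hk hp).lam_one

theorem petrovFrame_lam_neg_one (hk : 0 < P.k) (hp : p ∈ P.regular) :
    (petrovFrame hk hp).lam (-1) = (P.pt p).P * (P.pt p).D ^ 3 / (P.k * (P.pt p).h ^ 3) :=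
  (regular_pt hk hp).lam_neg_one

/-- The Hessian of x/N is a real multiple of x²Y + y²X - 2i x y √(-X Y), which has the modulus F. -/
theorem petrovFrame_disc_one (hk : 0 < P.k) (hp : p ∈ P.regular) :
    4 * (petrovFrame hk hp).disc 1 = 9 * (petrovFrame hk hp).lam 1 ^ 2 := by
  rw [petrovFrame_disc hk hp (Or.inl rfl), petrovFrame_lam_one, (regular_pt hk hp).hessRe_one,
    (regular_pt hk hp).hessIm_one, show (P.pt p).ν = P.ν from rfl]
  obtain ⟨-, hD, hN, hh, hF⟩ := regular_pt hk hp
  have := hk.ne'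
  have e : ((P.pt p).x ^ 2 * (P.pt p).Y + (P.pt p).y ^ 2 * (P.pt p).X) ^ 2
      - 4 * ((P.pt p).x * (P.pt p).y) ^ 2 * ((P.pt p).X * (P.pt p).Y) = (P.pt p).F ^ 2 := by
    rw [QuarticPoint.F]; ring
  generalize P.pt p = Q at *
  field_simp
  linear_combination 144 * (1 + P.ν) ^ 2 * e

theorem petrovFrame_disc_neg_one (hk : 0 < P.k) (hp : p ∈ P.regular) :
    4 * (petrovFrame hk hp).disc (-1)
      = (9 * (P.pt p).P ^ 2 + 72 * (1 - P.ν) * ((P.pt p).X * (P.pt p).Y) * (P.pt p).J * (P.pt p).h)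
        * (P.pt p).D ^ 6 / (P.k ^ 2 * (P.pt p).h ^ 6) := by
  rw [petrovFrame_disc hk hp (Or.inr rfl), (regular_pt hk hp).hessRe_neg_one,
    (regular_pt hk hp).hessIm_neg_one]
  obtain ⟨-, hD, hN, hh, hF⟩ := regular_pt hk hp
  have := hk.ne'
  have e := (P.pt p).sq_u_add_sq_w
  rw [show (P.pt p).ν = P.ν from rfl] at e
  generalize P.pt p = Q at *
  field_simp
  linear_combination 16 * e

theorem isTypeO_one (hk : 0 < P.k) (hν : P.ν = -1) (hp : p ∈ P.regular) :
    IsTypeO P.metric p 1 := by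
  have hl : (petrovFrame hk hp).lam 1 = 0 := by rw [petrovFrame_lam_one, hν]; simp
  refine (petrovFrame hk hp).isTypeO (Or.inl rfl) hl ?_
  have := petrovFrame_disc_one hk hp
  rw [hl] at this
  linarith

theorem isTypeD_one (hk : 0 < P.k) (hν : -1 < P.ν) (hp : p ∈ P.regular) :
    IsTypeD P.metric p 1 := by
  refine (petrovFrame hk hp).isTypeD (Or.inl rfl) ?_ (petrovFrame_disc_one hk hp)
  rw [petrovFrame_lam_one]
  obtain ⟨-, hD, hN, hh, hF⟩ := regular_pt hk hp
  have := hk.ne'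
  have h1 : 1 + P.ν ≠ 0 := by linarith
  positivity

/-- The difference 4 `disc` - 9 `lam`² is 72 (1 - ν) X Y J h D⁶/(k² h⁶), which has no zeros on the
regular set; the other condition, `disc` ≠ 0, is `h0`. -/
theorem isTypeI_neg_one (hk : 0 < P.k) (hν : P.ν ≠ 1) (hp : p ∈ P.regular) (hJ : (P.pt p).J ≠ 0)
    (h0 : 9 * (P.pt p).P ^ 2 + 72 * (1 - P.ν) * ((P.pt p).X * (P.pt p).Y) * (P.pt p).J * (P.pt p).h
      ≠ 0) : IsTypeI P.metric p (-1) := by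
  have hX := (X_pos hp).ne'
  have hY := (Y_neg hp).ne
  have hd := petrovFrame_disc_neg_one hk hp
  have hl := petrovFrame_lam_neg_one hk hp
  obtain ⟨-, hD, hN, hh, hF⟩ := regular_pt hk hp
  have hk' := hk.ne'
  refine (petrovFrame hk hp).isTypeI (Or.inr rfl) ?_ ?_
  · intro h
    rw [h, mul_zero, eq_comm, div_eq_zero_iff] at hd
    rcases hd with hd | hd
    · exact (mul_ne_zero h0 (pow_ne_zero 6 hD)) hd
    · exact (mul_ne_zero (pow_ne_zero 2 hk') (pow_ne_zero 6 hh)) hd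
  · rw [hd, hl]
    intro h
    field_simp at h
    have : 72 * (1 - P.ν) * ((P.pt p).X * (P.pt p).Y) * (P.pt p).J * (P.pt p).h = 0 := by
      linear_combination h
    have h1 : 1 - P.ν ≠ 0 := sub_ne_zero.mpr hν.symm
    exact mul_ne_zero (mul_ne_zero (mul_ne_zero (mul_ne_zero (by norm_num) h1) (mul_ne_zero hX hY))
      hJ) hh this

theorem isTypeD_neg_one (hk : 0 < P.k) (hν : P.ν = 1) (hp : p ∈ P.regular) (hJ : (P.pt p).J ≠ 0) :
    IsTypeD P.metric p (-1) := by
  have hd := petrovFrame_disc_neg_one hk hp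
  have hl := petrovFrame_lam_neg_one hk hp
  obtain ⟨-, hD, hN, hh, hF⟩ := regular_pt hk hp
  have hk' := hk.ne'
  refine (petrovFrame hk hp).isTypeD (Or.inr rfl) ?_ ?_
  -- For ν = 1 only the term with J survives in P, and its cubic factor becomes (y - x)³.
  · have e : (P.pt p).P = -(P.pt p).J * (P.pt p).D ^ 3 := by
      simp only [QuarticPoint.P, QuarticPoint.D, show (P.pt p).ν = P.ν from rfl, hν]
      ring
    rw [hl, e]
    exact div_ne_zero (mul_ne_zero (mul_ne_zero (neg_ne_zero.mpr hJ) (pow_ne_zero 3 hD))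
      (pow_ne_zero 3 hD)) (mul_ne_zero hk' (pow_ne_zero 3 hh))
  · rw [hd, hl, hν]
    field_simp
    ring

/-- The given tetrad is the one of `weylC_tetrad` for r₁ = √L/√X, r₂ = √L/√(-Y), r₃ = √f; in these
terms γ r₁ r₂ r₃² is `wc` √X √(-Y). -/
theorem psi (hk : 0 < P.k) (hp : p ∈ P.regular) :
    P.Psi2 p = (((petrovFrame hk hp).lam 1 / 2 : ℝ) : ℂ) ∧
    P.Psi0 p = ((((petrovFrame hk hp).a 1 - (petrovFrame hk hp).b 1) / 2 : ℝ) : ℂ)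
      + Complex.I * (((P.pt p).jet.wc 1 * (√(P.pt p).X * √(-(P.pt p).Y)) : ℝ) : ℂ) := by
  have hX := X_pos hp
  have hY := neg_pos.mpr (Y_neg hp)
  have hD := D_pos hp
  have hF := F_pos hp
  have hH := N_mul_h_pos hp
  have hf := (regular_pt hk hp).f_eq
  set Q := P.pt p with hQ
  set X := Q.X with hX'
  set Y := -Q.Y with hY'
  set H := Q.N * Q.h with hH'
  have hL : Q.jet.L = P.k * H / Q.D ^ 3 := by simp only [QuarticPoint.jet, hH', mul_assoc]; rfl
  have hL0 : 0 < Q.jet.L := by rw [hL]; positivity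
  have hf0 : 0 < Q.jet.f := by rw [hf]; positivity
  have s2 : (0 : ℝ) < √2 := by positivity
  have sX : 0 < √X := Real.sqrt_pos.mpr hX
  have sY : 0 < √Y := Real.sqrt_pos.mpr hY
  have sL : 0 < √Q.jet.L := Real.sqrt_pos.mpr hL0
  have sf : 0 < √Q.jet.f := Real.sqrt_pos.mpr hf0
  have qX := Real.sq_sqrt hX.le
  have qY := Real.sq_sqrt hY.le
  have qL := Real.sq_sqrt hL0.le
  have qf := Real.sq_sqrt hf0.le
  -- The square roots in the tetrad are rewritten through L = k H/D³ and f = F/(H D).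
  have eM : √(Q.D ^ 3) / √(2 * P.k * H) = 1 / √2 / √Q.jet.L := by
    rw [hL, div_div, ← Real.sqrt_mul (by norm_num), ← Real.sqrt_div (by positivity),
      ← Real.sqrt_one, ← Real.sqrt_div (by positivity)]
    congr 1
    field_simp
  have eα : √(H * Q.D / Q.F) = 1 / √Q.jet.f := by
    rw [hf, ← Real.sqrt_one, ← Real.sqrt_div (by positivity)]
    congr 1
    field_simp
  have eβ : √(Q.F * Q.D ^ 3 / (H * X * Y))
      = (√Q.jet.L / √X) * (√Q.jet.L / √Y) * √Q.jet.f / (Q.jet.L / Q.D ^ 2) := by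
    rw [Real.sqrt_eq_iff_mul_self_eq_of_pos (by positivity)]
    have : (√Q.jet.L / √X * (√Q.jet.L / √Y) * √Q.jet.f / (Q.jet.L / Q.D ^ 2))
        * (√Q.jet.L / √X * (√Q.jet.L / √Y) * √Q.jet.f / (Q.jet.L / Q.D ^ 2))
        = (√Q.jet.L ^ 2) ^ 2 * √Q.jet.f ^ 2 / (√X ^ 2 * √Y ^ 2) / (Q.jet.L / Q.D ^ 2) ^ 2 := by
      field_simp
    rw [this, qX, qY, qL, qf, hf]
    field_simp
  have hc : ((1 / √2 : ℝ)) ^ 2 = 1 / 2 := by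
    rw [div_pow, one_pow, Real.sq_sqrt (by norm_num)]
  have tX : P.quartic (p 0) = X := (P.pt_X p).symm
  have tY : -P.quartic (p 1) = Y := by rw [hY', hQ, pt_Y]
  have tH : P.H (p 0) (p 1) = H := (P.pt_N_mul_h p).symm
  have tF : P.F (p 0) (p 1) = Q.F := (P.pt_F p).symm
  have tG : P.G (p 0) (p 1) = Q.G := (P.pt_G p).symm
  have tD : p 0 - p 1 = Q.D := rfl
  have hκ : (petrovFrame hk hp).κ = Q.jet.L / Q.D ^ 2 := rfl
  have hq : (petrovFrame hk hp).q = Q.G / Q.F := rfl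
  have mX : √(Q.D ^ 3) / √(2 * P.k * H) * √X = 1 / √2 / (√Q.jet.L / √X) := by
    rw [eM]; field_simp
  have mY : √(Q.D ^ 3) / √(2 * P.k * H) * √Y = 1 / √2 / (√Q.jet.L / √Y) := by
    rw [eM]; field_simp
  have key := (petrovFrame hk hp).weylC_tetrad (r₁ := √Q.jet.L / √X) (r₂ := √Q.jet.L / √Y)
    (r₃ := √Q.jet.f) (c := 1 / √2) (l := P.tetradL p) (m := P.tetradM p) (n := P.tetradN p)
    (k := P.tetradP p)
    (by rw [div_pow, qL, qX]; rfl)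
    (by rw [div_pow, qL, qY, hY', div_neg, ← neg_div]; rfl)
    qf.symm hc
    (by
      simp only [tetradL, tX, tY, tH, tF, tG, tD, hκ, hq, eα, eβ]
      ext i
      fin_cases i <;> simp)
    (by
      simp only [tetradN, tX, tY, tH, tF, tG, tD, hκ, hq, eα, eβ]
      ext i
      fin_cases i <;> simp)
    (by
      simp only [tetradM, tX, tY, tH, tD, ← mX, ← mY]
      ext i
      fin_cases i <;> simp
      · ring
      · linear_combination ((√(Q.D ^ 3) : ℝ) : ℂ) / (√(2 * P.k * H) : ℝ) * (√Y : ℝ) * Complex.I_sq)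
    (by
      simp only [tetradP, tX, tY, tH, tD, ← mX, ← mY]
      ext i
      fin_cases i <;> simp
      · ring
      · linear_combination -((√(Q.D ^ 3) : ℝ) : ℂ) / (√(2 * P.k * H) : ℝ) * (√Y : ℝ) * Complex.I_sq)
  refine ⟨key.1, key.2.trans ?_⟩
  congr 3
  have : (petrovFrame hk hp).γ 1 = Q.jet.wc 1 * (X * Y) / (Q.jet.L * Q.jet.f) := by
    change 1 * Q.jet.wc 1 * (-(X * Q.Y)) / (Q.jet.L * Q.jet.f) = _
    rw [hY']; ring
  rw [this]
  field_simp
  rw [qX, qY, qL, qf]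
  ring

theorem f_mul_conj (hX : 0 ≤ P.quartic (p 0)) (hY : P.quartic (p 1) ≤ 0) :
    P.f (p 0) (p 1) * (starRingEnd ℂ) (P.f (p 0) (p 1)) = (P.F (p 0) (p 1) : ℂ) := by
  have qX : ((√(P.quartic (p 0)) : ℝ) : ℂ) ^ 2 = P.quartic (p 0) := by
    exact_mod_cast Real.sq_sqrt hX
  have qY : ((√(-P.quartic (p 1)) : ℝ) : ℂ) ^ 2 = -P.quartic (p 1) := by
    exact_mod_cast Real.sq_sqrt (neg_nonneg.mpr hY)
  simp only [f, F, map_add, map_mul, Complex.conj_ofReal, Complex.conj_I]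
  push_cast
  linear_combination (p 0 : ℂ) ^ 2 * qY + (p 1 : ℂ) ^ 2 * qX
    - (p 1 : ℂ) ^ 2 * (√(P.quartic (p 0)) : ℝ) ^ 2 * Complex.I_sq

theorem psi2_eq (hk : 0 < P.k) (hp : p ∈ P.regular) : P.Psi2 p
    = (((1 + P.ν) * (p 0 - p 1) ^ 3 / (4 * P.k * (P.ν * p 0 + p 1) ^ 3) : ℝ) : ℂ) := by
  rw [(psi hk hp).1, petrovFrame_lam_one]
  congr 1
  rw [div_div, mul_right_comm, mul_right_comm 2]
  congr 2
  norm_num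

/-- As f f̄ = F, the claim is Ψ₀ F = 3 Ψ₂ f², where f² = -(x²Y + y²X) + 2i x y √(-X Y). -/
theorem psi0_eq (hk : 0 < P.k) (hp : p ∈ P.regular) : P.Psi0 p
    = 3 * P.f (p 0) (p 1) * P.Psi2 p / (starRingEnd ℂ) (P.f (p 0) (p 1)) := by
  have hF := (F_pos hp).ne'
  have hff := f_mul_conj (p := p) hp.2.1.le hp.2.2.1.le
  have hF' : ((P.F (p 0) (p 1) : ℝ) : ℂ) ≠ 0 := by
    rw [← pt_F]; exact_mod_cast hF
  have hc : (starRingEnd ℂ) (P.f (p 0) (p 1)) ≠ 0 := by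
    intro h
    rw [h, mul_zero] at hff
    exact hF' hff.symm
  rw [eq_div_iff hc]
  have hf0 : P.f (p 0) (p 1) ≠ 0 := by
    intro h
    rw [h, zero_mul] at hff
    exact hF' hff.symm
  apply mul_right_cancel₀ hf0
  rw [mul_assoc, mul_comm _ (P.f _ _), hff, (psi hk hp).1, (psi hk hp).2]
  have hLf := jet_Lf hk hp
  have hL : (P.pt p).jet.L ≠ 0 := ((P.stationary hk).L_pos p hp).ne'
  have hjf : (P.pt p).jet.f ≠ 0 := ((P.stationary hk).f_pos p hp).ne'
  have hRe := (regular_pt hk hp).hessRe_one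
  have hIm := (regular_pt hk hp).hessIm_one
  have hlam := petrovFrame_lam_one hk hp
  obtain ⟨-, hD, hN, hh, -⟩ := regular_pt hk hp
  have hk' := hk.ne'
  -- `h1` is the real part of Ψ₀ F = 3 Ψ₂ f²; `h2` is its imaginary part divided by √X √(-Y).
  have h1 : ((petrovFrame hk hp).a 1 - (petrovFrame hk hp).b 1) / 2 * (P.pt p).F
      = -3 * ((petrovFrame hk hp).lam 1 / 2)
        * ((P.pt p).x ^ 2 * (P.pt p).Y + (P.pt p).y ^ 2 * (P.pt p).X) := by
    have : ((petrovFrame hk hp).a 1 - (petrovFrame hk hp).b 1) / 2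
        = -(P.pt p).jet.hessRe 1 / (4 * ((P.pt p).jet.L * (P.pt p).jet.f)) := by
      change ((P.pt p).jet.wa 1 - (P.pt p).jet.wb 1) / 2 = _
      simp only [StationaryJet.wa, StationaryJet.wb]
      field_simp
      ring
    rw [this, hLf, hRe, hlam, show (P.pt p).ν = P.ν from rfl]
    field_simp
    norm_num
  have h2 : (P.pt p).jet.wc 1 * (P.pt p).F
      = 6 * ((petrovFrame hk hp).lam 1 / 2) * ((P.pt p).x * (P.pt p).y) := by
    rw [StationaryJet.wc, mul_assoc 4, hLf, hIm, hlam, show (P.pt p).ν = P.ν from rfl]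
    field_simp
    norm_num
  have qX : ((√(P.quartic (p 0)) : ℝ) : ℂ) ^ 2 = P.quartic (p 0) := by
    exact_mod_cast Real.sq_sqrt hp.2.1.le
  have qY : ((√(-P.quartic (p 1)) : ℝ) : ℂ) ^ 2 = -P.quartic (p 1) := by
    exact_mod_cast Real.sq_sqrt (neg_nonneg.mpr hp.2.2.1.le)
  rw [pt_F, pt_X, pt_Y] at h1
  rw [pt_F] at h2
  rw [pt_X, pt_Y]
  have h1' := congrArg (Complex.ofReal) h1
  have h2' := congrArg (Complex.ofReal) h2
  simp only [f]
  simp only [show (P.pt p).x = p 0 from rfl, show (P.pt p).y = p 1 from rfl] at h1' h2'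
  push_cast at h1' h2' ⊢
  linear_combination h1' + Complex.I * (√(P.quartic (p 0)) : ℝ) * (√(-P.quartic (p 1)) : ℝ) * h2'
    - 3 * ((petrovFrame hk hp).lam 1 / 2 : ℂ) * (p 0 : ℂ) ^ 2 * qY
    - 3 * ((petrovFrame hk hp).lam 1 / 2 : ℂ) * (p 1 : ℂ) ^ 2 * (√(P.quartic (p 0)) : ℝ) ^ 2
      * Complex.I_sq + 3 * ((petrovFrame hk hp).lam 1 / 2 : ℂ) * (p 1 : ℂ) ^ 2 * qX

end Params

/-! ### Density of the points where W⁻ is algebraically general -/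

open Filter Topology

namespace QuarticPoint

/-- The anti-self-dual Weyl tensor is algebraically general where this does not vanish. -/
def generic (Q : QuarticPoint) : ℝ :=
  9 * Q.P ^ 2 + 72 * (1 - Q.ν) * (Q.X * Q.Y) * Q.J * Q.h

end QuarticPoint

namespace Params

/-- Although written in the coefficients at a point, J is a constant of the metric. -/
theorem pt_J (P : Params) (p : Pt) : (P.pt p).J = P.a₀ * P.a₃ ^ 2 - P.a₁ ^ 2 * P.a₄ := by
  rw [QuarticPoint.J, pt_a₃]
  simp only [Params.pt]
  ring

theorem pt_congr (P : Params) {p r : Pt} (h0 : p 0 = r 0) (h1 : p 1 = r 1) : P.pt p = P.pt r := by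
  simp only [Params.pt, h0, h1]

theorem quartic_ofRoots (k ν a₄ x₁ x₂ x₃ x₄ t : ℝ) : (ofRoots k ν a₄ x₁ x₂ x₃ x₄).quartic t
    = a₄ * (t - x₁) * (t - x₂) * (t - x₃) * (t - x₄) := by
  simp only [quartic, ofRoots]; ring

section Roots

variable {k ν a₄ x₁ x₂ x₃ x₄ : ℝ}

local notation "P₀" => ofRoots k ν a₄ x₁ x₂ x₃ x₄

theorem domain_subset_regular (ha₄ : 0 < a₄) (h₃₄ : x₃ < x₄)
    (hH : ∀ x ∈ Set.Ioo x₂ x₃, ∀ y ∈ Set.Ioo x₁ x₂, 0 < (P₀).H x y) :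
    domain x₁ x₂ x₃ ⊆ (P₀).regular := by
  rintro p ⟨⟨hx2, hx3⟩, hy1, hy2⟩
  refine ⟨hy2.trans hx2, ?_, ?_, hH _ ⟨hx2, hx3⟩ _ ⟨hy1, hy2⟩⟩
  · rw [quartic_ofRoots, mul_assoc _ (p 0 - x₃)]
    exact mul_pos (mul_pos (mul_pos ha₄ (by linarith)) (by linarith))
      (mul_pos_of_neg_of_neg (by linarith) (by linarith))
  · rw [quartic_ofRoots, mul_assoc _ (p 1 - x₂)]
    exact mul_neg_of_pos_of_neg (mul_pos (mul_pos ha₄ (by linarith))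
      (mul_pos_of_neg_of_neg (by linarith) (by linarith))) (by linarith)

/-- J vanishes only if the four roots split into two pairs with equal products. Each of the three
splittings contributes a factor to H at one of the three turning points. -/
theorem J_ne_zero (hn₁ : (P₀).H x₂ x₁ ≠ 0) (hn₂ : (P₀).H x₃ x₁ ≠ 0) (hn₃ : (P₀).H x₃ x₂ ≠ 0)
    (p : Pt) : ((P₀).pt p).J ≠ 0 := by
  have e1 : (P₀).H x₂ x₁ = -a₄ * (x₃ * x₄ - x₁ * x₂) * (x₂ - x₁) * (ν * x₂ + x₁) ^ 2 := by
    simp only [H, ofRoots]; ring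
  have e2 : (P₀).H x₃ x₁ = -a₄ * (x₂ * x₄ - x₁ * x₃) * (x₃ - x₁) * (ν * x₃ + x₁) ^ 2 := by
    simp only [H, ofRoots]; ring
  have e3 : (P₀).H x₃ x₂ = -a₄ * (x₁ * x₄ - x₂ * x₃) * (x₃ - x₂) * (ν * x₃ + x₂) ^ 2 := by
    simp only [H, ofRoots]; ring
  have e : ((P₀).pt p).J
      = a₄ ^ 3 * (x₃ * x₄ - x₁ * x₂) * (x₂ * x₄ - x₁ * x₃) * (x₁ * x₄ - x₂ * x₃) := by
    rw [pt_J]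
    simp only [ofRoots]
    ring
  rw [e]
  rw [e1] at hn₁
  rw [e2] at hn₂
  rw [e3] at hn₃
  simp only [mul_ne_zero_iff, neg_ne_zero] at hn₁ hn₂ hn₃
  simp only [mul_ne_zero_iff]
  exact ⟨⟨⟨pow_ne_zero 3 hn₁.1.1.1, hn₁.1.1.2⟩, hn₂.1.1.2⟩, hn₃.1.1.2⟩

/-- If the genericity condition fails along a line `x = const`, then `h` vanishes at `y = x₁`. -/
theorem h_eq_zero_of_generic (ha₄ : a₄ ≠ 0) (h₁₂ : x₁ ≠ x₂) (h₁₃ : x₁ ≠ x₃) (h₁₄ : x₁ ≠ x₄)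
    (hν : ν ≠ 1) {x : ℝ} (hX : (P₀).quartic x ≠ 0) (hJ : ((P₀).pt ![x, x₁, 0, 0]).J ≠ 0)
    (h : ∀ y, ((P₀).pt ![x, y, 0, 0]).generic = 0) : ((P₀).pt ![x, x₁, 0, 0]).h = 0 := by
  -- The simple factor y - x₁ of Y is split off.
  have hgen : ∀ y, 9 * ((P₀).pt ![x, y, 0, 0]).P ^ 2 + (y - x₁) * (72 * (1 - ν) * (P₀).quartic x
      * ((P₀).pt ![x, x₁, 0, 0]).J * (a₄ * (y - x₂) * (y - x₃) * (y - x₄))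
      * ((P₀).pt ![x, y, 0, 0]).h) = 0 := by
    intro y
    refine Eq.trans ?_ (h y)
    rw [QuarticPoint.generic, pt_X, pt_Y, pt_J, pt_J,
      show (![x, y, 0, 0] : Pt) 0 = x from rfl, show (![x, y, 0, 0] : Pt) 1 = y from rfl,
      quartic_ofRoots _ _ _ _ _ _ _ y, show ((P₀).pt ![x, y, 0, 0]).ν = ν from rfl]
    ring
  have hP : ((P₀).pt ![x, x₁, 0, 0]).P = 0 := by
    have := hgen x₁
    rw [sub_self, zero_mul, add_zero] at this
    simpa using this
  have dP : DifferentiableAt ℝ (fun y => ((P₀).pt ![x, y, 0, 0]).P) x₁ := by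
    simp only [QuarticPoint.P, QuarticPoint.V, QuarticPoint.D, QuarticPoint.J, pt_a₃]
    simp only [Params.pt, Matrix.cons_val_zero, Matrix.cons_val_one]
    fun_prop
  have dh : DifferentiableAt ℝ (fun y => ((P₀).pt ![x, y, 0, 0]).h) x₁ := by
    simp only [QuarticPoint.h, Params.pt, Matrix.cons_val_zero, Matrix.cons_val_one]
    fun_prop
  have dr : DifferentiableAt ℝ (fun y => 72 * (1 - ν) * (P₀).quartic x
      * ((P₀).pt ![x, x₁, 0, 0]).J * (a₄ * (y - x₂) * (y - x₃) * (y - x₄))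
      * ((P₀).pt ![x, y, 0, 0]).h) x₁ := by
    fun_prop
  -- Since P(x₁) = 0, the derivative of 9 P² at x₁ is zero, so that of the whole expression is the
  -- cofactor of y - x₁ at x₁.
  have d := ((dP.hasDerivAt.pow 2).const_mul 9).add
    (((hasDerivAt_id x₁).sub_const x₁).mul dr.hasDerivAt)
  have d0 := d.congr_of_eventuallyEq (f₁ := fun _ => 0)
    (Eventually.of_forall fun y => (hgen y).symm)
  have := d0.unique (hasDerivAt_const x₁ (0 : ℝ))
  simp only [hP, id, sub_self, zero_mul, one_mul, add_zero] at this
  by_contra hne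
  have h1 : 1 - ν ≠ 0 := sub_ne_zero.mpr hν.symm
  have : 72 * (1 - ν) * (P₀).quartic x * ((P₀).pt ![x, x₁, 0, 0]).J
      * (a₄ * (x₁ - x₂) * (x₁ - x₃) * (x₁ - x₄)) * ((P₀).pt ![x, x₁, 0, 0]).h = 0 := by
    simpa using this
  exact mul_ne_zero (mul_ne_zero (mul_ne_zero (mul_ne_zero (mul_ne_zero (by norm_num) h1) hX) hJ)
    (mul_ne_zero (mul_ne_zero (mul_ne_zero ha₄ (sub_ne_zero.mpr h₁₂)) (sub_ne_zero.mpr h₁₃))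
      (sub_ne_zero.mpr h₁₄))) hne this

/-- Otherwise the polynomial vanishes near p. It is continued in y to all of ℝ for each x near `p
0`, which reaches the root x₁ on the boundary; then h(·, x₁) is continued in x to x₂, where the
first turning point gives a contradiction. -/
theorem frequently_generic (ha₄ : a₄ ≠ 0) (h₁₂ : x₁ < x₂) (h₂₃ : x₂ < x₃) (h₃₄ : x₃ < x₄)
    (hν : ν ≠ 1) (hJ : ∀ p, ((P₀).pt p).J ≠ 0) (hn₁ : (P₀).H x₂ x₁ ≠ 0) {p : Pt}
    (hp : p ∈ domain x₁ x₂ x₃) : ∃ᶠ r in 𝓝 p, ((P₀).pt r).generic ≠ 0 := by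
  intro hev
  simp only [not_not] at hev
  have hc : Continuous fun z : ℝ × ℝ => (![z.1, z.2, p 2, p 3] : Pt) := by
    refine continuous_pi fun i => ?_
    fin_cases i
    · exact continuous_fst
    · exact continuous_snd
    · exact continuous_const
    · exact continuous_const
  have hpp : (![p 0, p 1, p 2, p 3] : Pt) = p := by
    ext i; fin_cases i <;> rfl
  -- Nothing depends on τ and φ, so they are set to 0.
  have hz : ∀ᶠ z : ℝ × ℝ in 𝓝 (p 0, p 1), ((P₀).pt ![z.1, z.2, 0, 0]).generic = 0 := by
    have ht := hc.tendsto (p 0, p 1)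
    rw [hpp] at ht
    filter_upwards [ht.eventually hev] with z hz
    rw [← hz]
    exact congrArg _ (pt_congr _ rfl rfl)
  have hx : ∀ᶠ x in 𝓝 (p 0), ((P₀).pt ![x, x₁, 0, 0]).h = 0 := by
    filter_upwards [hz.curry_nhds, isOpen_Ioo.mem_nhds hp.1] with x hx hxI
    refine h_eq_zero_of_generic ha₄ h₁₂.ne (h₁₂.trans h₂₃).ne (h₁₂.trans (h₂₃.trans h₃₄)).ne hν
      ?_ (hJ _) ?_
    · rw [quartic_ofRoots]
      refine mul_ne_zero (mul_ne_zero (mul_ne_zero (mul_ne_zero ha₄ ?_) ?_) ?_) ?_ <;>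
        rw [sub_ne_zero]
      · exact (h₁₂.trans hxI.1).ne'
      · exact hxI.1.ne'
      · exact hxI.2.ne
      · exact (hxI.2.trans h₃₄).ne
    · have ha : AnalyticOnNhd ℝ (fun y => ((P₀).pt ![x, y, 0, 0]).generic) Set.univ := by
        intro y _
        simp only [QuarticPoint.generic, QuarticPoint.P, QuarticPoint.V, QuarticPoint.D,
          QuarticPoint.J, pt_a₃, QuarticPoint.X, QuarticPoint.Y, QuarticPoint.h]
        simp only [Params.pt, Matrix.cons_val_zero, Matrix.cons_val_one]
        fun_prop
      intro y
      exact ha.eqOn_zero_of_preconnected_of_eventuallyEq_zero isPreconnected_univ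
        (Set.mem_univ (p 1)) hx (Set.mem_univ y)
  have ha : AnalyticOnNhd ℝ (fun x => ((P₀).pt ![x, x₁, 0, 0]).h) Set.univ := by
    intro y _
    simp only [QuarticPoint.h, Params.pt, Matrix.cons_val_zero, Matrix.cons_val_one]
    fun_prop
  have h0 : ((P₀).pt ![x₂, x₁, 0, 0]).h = 0 := ha.eqOn_zero_of_preconnected_of_eventuallyEq_zero
    isPreconnected_univ (Set.mem_univ (p 0)) hx (Set.mem_univ x₂)
  refine hn₁ ?_
  have := (P₀).pt_N_mul_h ![x₂, x₁, 0, 0]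
  rw [h0, mul_zero] at this
  exact this.symm

theorem subset_closure_isTypeI (hk : 0 < k) (ha₄ : 0 < a₄) (h₁₂ : x₁ < x₂) (h₂₃ : x₂ < x₃)
    (h₃₄ : x₃ < x₄) (hH : ∀ x ∈ Set.Ioo x₂ x₃, ∀ y ∈ Set.Ioo x₁ x₂, 0 < (P₀).H x y)
    (hν : ν ≠ 1) (hJ : ∀ p, ((P₀).pt p).J ≠ 0) (hn₁ : (P₀).H x₂ x₁ ≠ 0) :
    domain x₁ x₂ x₃ ⊆ closure {p ∈ domain x₁ x₂ x₃ | IsTypeI (P₀).metric p (-1)} := by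
  intro p hp
  rw [mem_closure_iff_frequently]
  have hU : IsOpen (domain x₁ x₂ x₃) :=
    (isOpen_Ioo.preimage (continuous_apply 0)).inter (isOpen_Ioo.preimage (continuous_apply 1))
  refine ((frequently_generic ha₄.ne' h₁₂ h₂₃ h₃₄ hν hJ hn₁ hp).and_eventually
    (hU.mem_nhds hp)).mono ?_
  rintro r ⟨hr, hrU⟩
  exact ⟨hrU, isTypeI_neg_one hk hν (domain_subset_regular ha₄ h₃₄ hH hrU) (hJ r) hr⟩

end Roots

end Params

end ChenTeo

end

/-! ### The algebraic types of the Chen–Teo metrics -/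

theorem theorem3p5 (k ν a₄ x₁ x₂ x₃ x₄ : ℝ)
    (hk : 0 < k) (ha₄ : 0 < a₄) (h₁₂ : x₁ < x₂) (h₂₃ : x₂ < x₃) (h₃₄ : x₃ < x₄)
    (hH : ∀ x ∈ Set.Ioo x₂ x₃, ∀ y ∈ Set.Ioo x₁ x₂,
      0 < (ChenTeo.Params.ofRoots k ν a₄ x₁ x₂ x₃ x₄).H x y)
    (hn₁ : (ChenTeo.Params.ofRoots k ν a₄ x₁ x₂ x₃ x₄).H x₂ x₁ ≠ 0)
    (hn₂ : (ChenTeo.Params.ofRoots k ν a₄ x₁ x₂ x₃ x₄).H x₃ x₁ ≠ 0)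
    (hn₃ : (ChenTeo.Params.ofRoots k ν a₄ x₁ x₂ x₃ x₄).H x₃ x₂ ≠ 0) :
    let P := ChenTeo.Params.ofRoots k ν a₄ x₁ x₂ x₃ x₄
    let U := ChenTeo.domain x₁ x₂ x₃
    -- the metric is Riemannian and Ricci-flat on the domain
    (∀ p ∈ U, (P.metric p).PosDef ∧ ∀ i j, ChenTeo.ricci P.metric p i j = 0) ∧
    -- the self-dual Weyl scalars
    (∀ p ∈ U,
      P.Psi2 p = (((1 + ν) * (p 0 - p 1) ^ 3 / (4 * k * (ν * p 0 + p 1) ^ 3) : ℝ) : ℂ) ∧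
      P.Psi0 p = 3 * P.f (p 0) (p 1) * P.Psi2 p / (starRingEnd ℂ) (P.f (p 0) (p 1))) ∧
    -- type `O⁺ I⁻`
    (ν = -1 →
      (∀ p ∈ U, ChenTeo.IsTypeO P.metric p 1) ∧
      U ⊆ closure {p ∈ U | ChenTeo.IsTypeI P.metric p (-1)}) ∧
    -- type `D⁺ D⁻`
    (ν = 1 →
      (∀ p ∈ U, ChenTeo.IsTypeD P.metric p 1) ∧
      (∀ p ∈ U, ChenTeo.IsTypeD P.metric p (-1))) ∧
    -- type `D⁺ I⁻`
    (-1 < ν ∧ ν < 1 →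
      (∀ p ∈ U, ChenTeo.IsTypeD P.metric p 1) ∧
      U ⊆ closure {p ∈ U | ChenTeo.IsTypeI P.metric p (-1)}) := by
  intro P U
  have hU : U ⊆ P.regular := ChenTeo.Params.domain_subset_regular ha₄ h₃₄ hH
  have hJ := ChenTeo.Params.J_ne_zero hn₁ hn₂ hn₃
  have hI : ν ≠ 1 → U ⊆ closure {p ∈ U | ChenTeo.IsTypeI P.metric p (-1)} := fun hν =>
    ChenTeo.Params.subset_closure_isTypeI hk ha₄ h₁₂ h₂₃ h₃₄ hH hν hJ hn₁
  refine ⟨fun p hp => ?_, fun p hp => ?_, fun hν => ⟨fun p hp => ?_, hI (by linarith)⟩,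
    fun hν => ⟨fun p hp => ?_, fun p hp => ?_⟩, fun hν => ⟨fun p hp => ?_, hI hν.2.ne⟩⟩
  · exact ⟨(ChenTeo.Params.petrovFrame hk (hU hp)).posDef,
      (ChenTeo.Params.petrovFrame hk (hU hp)).ricci_eq_zero⟩
  · exact ⟨ChenTeo.Params.psi2_eq hk (hU hp), ChenTeo.Params.psi0_eq hk (hU hp)⟩
  · exact ChenTeo.Params.isTypeO_one hk hν (hU hp)
  · exact ChenTeo.Params.isTypeD_one hk (show -1 < P.ν from (by linarith : -1 < ν)) (hU hp)
  · exact ChenTeo.Params.isTypeD_neg_one hk hν (hU hp) (hJ p)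
  · exact ChenTeo.Params.isTypeD_one hk hν.1 (hU hp)
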